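/- Let $g\ge 2$ and let $f\in\mathbb C[x]$ be a monic polynomial of degree $2g+1$ or $2g+2$ with distinct roots. Let $X$ be the hyperelliptic curve of genus $g$ defined by $y^2=f(x)$, that is, the compact Riemann surface obtained by gluing $C_0=\{y^2=f(x)\}$ and $C_0'=\{w^2=z^{2g+2}f(1/z)\}$ along $z=1/x$, $w=y/x^{g+1}$. Let $\iota(x,y)=(x,-y)$, $\iota(z,w)=(z,-w)$ be the hyperelliptic involution and let $W$ be the Weierstrass divisor, the sum of the fixed points of $\iota$. Give $X$ the canonical metric $$ds^2=\sum_{i=1}^g\omega_i\otimes\overline{\omega_i},\qquad \omega_i=x^{i-1}\,\frac{dx}{y},$$ and let $d\nu$, $K$ and $\Delta$ be its area measure, Gaussian curvature and Laplace–Beltrami operator (so that $\Delta=\frac4\rho\frac{\partial^2}{\partial\zeta\,\partial\bar\zeta}$ and $d\nu=\rho\,dA$ in a coordinate $\zeta$ with $ds^2=\rho\,d\zeta\otimes d\bar\zeta$). Put $\sigma_g(t)=1+t+\dots+t^{g-1}$ and $N(t)=\bigl(\sigma_g(t)(1+t)^2\bigr)^{1/(2g+2)}$. For $P\in C_0$ let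 $F_P(Q)=|x(Q)-x(P)|/N(|x(Q)|^2)$ for $Q\in C_0$ and $F_P(Q)=|1-z(Q)x(P)|/N(|z(Q)|^2)$ for $Q\in C_0'$; for a point $P$ at infinity let $F_P(Q)=1/N(|x(Q)|^2)$ for $Q\in C_0$ and $F_P(Q)=|z(Q)|/N(|z(Q)|^2)$ for $Q\in C_0'$. For a divisor $D=\sum_P n_PP$ on $X$ put $F_D=\prod_P F_P^{n_P}$ and $u_D=\log F_D=\sum_P n_P\log F_P$ (where terms with the same function $F_P=F_{\iota(P)}$ are combined, so that $u_D$ is defined off $\operatorname{supp}\alpha(D)$), $\deg D=\sum_P n_P$, $\iota(D)=\sum_P n_P\,\iota(P)$, $\alpha(D)=D+\iota(D)$, and $\delta_D(\varphi)=\sum_P n_P\varphi(P)$ for $\varphi\in C^\infty(X,\mathbb C)$. A function $h$ such as $K$ or $F_W$ is identified with the distribution $\varphi\mapsto\int_X h\varphi\,d\nu$. Then for every divisor $D$ on $X$ the function $u_D$ is smooth on $X\setminus\operatorname{supp}\alpha(D)$, and $$(\Delta u_D)(\varphi)=\lim_{\epsilon\to0+}\int_{X\setminus\bigcup_{Q\in\operatorname{supp}\alpha(D)}D_\epsilon(Q)}u_D\,\Delta\varphi\,d\nu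 ,$$ where $D_\epsilon(Q)$ is the closed disc of radius $\epsilon$ in a holomorphic coordinate centred at $Q$, exists for all $\varphi\in C^\infty(X,\mathbb C)$, does not depend on the coordinates, and defines a continuous linear functional on $C^\infty(X,\mathbb C)$ with its Fréchet topology. Moreover $$\Delta u_D=\frac{\deg D}{g+1}K-\frac{4\deg D}{g+1}F_W+2\pi\,\delta_{\alpha(D)} .$$ If $g=2$, then $K=-2F_W$, and this equation simplifies to $$\Delta u_D=(\deg D)\,K+2\pi\,\delta_{\alpha(D)} .$$ -/

import Mathlib

open Polynomial Set Filter Topology MeasureTheory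
open scoped Manifold ContDiff

noncomputable section

/-! ### The hyperelliptic curve `y² = f(x)` as a complex manifold -/

/-- The datum of a hyperelliptic equation `y² = f(x)` of genus `g`: a monic complex polynomial `f`
of degree `2g+1` or `2g+2` with distinct roots. -/
structure HyperellipticEquation (g : ℕ) where
  f : ℂ[X]
  monic : f.Monic
  squarefree : Squarefree f
  degree : f.natDegree = 2 * g + 1 ∨ f.natDegree = 2 * g + 2

namespace HyperellipticEquation

variable {g : ℕ} (E : HyperellipticEquation g)

/-- The polynomial `z ^ (2g+2) * f (1/z)`, which defines the curve near infinity. -/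
def fInf : ℂ[X] := E.f.reflect (2 * g + 2)

lemma natDegree_le : E.f.natDegree ≤ 2 * g + 2 := by
  rcases E.degree with h | h <;> omega

lemma eval_fInf_inv (x : ℂ) (hx : x ≠ 0) :
    E.fInf.eval x⁻¹ * x ^ (2 * g + 2) = E.f.eval x := by
  let _ := invertibleOfNonzero hx
  have := eval₂_reflect_mul_pow (RingHom.id ℂ) x (2 * g + 2) E.f E.natDegree_le
  simpa [fInf, eval₂_id, invOf_eq_inv] using this

lemma eval_fInf (z : ℂ) (hz : z ≠ 0) :
    E.fInf.eval z = E.f.eval z⁻¹ * z ^ (2 * g + 2) := by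
  have := E.eval_fInf_inv z⁻¹ (inv_ne_zero hz)
  rw [inv_inv] at this
  rw [← this, mul_assoc, ← mul_pow, inv_mul_cancel₀ hz, one_pow, mul_one]

lemma derivative_f_ne_zero {a : ℂ} (h : E.f.eval a = 0) : E.f.derivative.eval a ≠ 0 := by
  intro h'
  have hs : E.f.Separable := (PerfectField.separable_iff_squarefree).2 E.squarefree
  obtain ⟨u, v, huv⟩ := hs
  have := congrArg (Polynomial.eval a) huv
  simp [h, h'] at this

lemma derivative_fInf_ne_zero (h : E.fInf.eval 0 = 0) : E.fInf.derivative.eval 0 ≠ 0 := by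
  have h0 : E.f.coeff (2 * g + 2) = 0 := by
    rw [← coeff_zero_eq_eval_zero, fInf, coeff_reflect, revAt_le (Nat.zero_le _)] at h
    simpa using h
  have hd : E.f.natDegree = 2 * g + 1 := by
    rcases E.degree with hd | hd
    · exact hd
    · have := E.monic.coeff_natDegree
      rw [hd, h0] at this
      exact absurd this zero_ne_one
  have h1 : E.f.coeff (2 * g + 1) = 1 := hd ▸ E.monic.coeff_natDegree
  rw [← coeff_zero_eq_eval_zero, coeff_derivative, fInf, coeff_reflect, revAt_le (by omega)]
  simp [h1]

/-- The affine plane curve `y² = p(x)`, with the topology of `ℂ²`. -/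
abbrev PlaneCurve (p : ℂ[X]) : Type := {q : ℂ × ℂ // q.2 ^ 2 = p.eval q.1}

/-- The compactification `X` of `y² = f(x)`, that is, the gluing of the curves `C₀ : y² = f(x)`
and `C₀' : w² = z^(2g+2) f(1/z)` along `z = 1/x`, `w = y / x^(g+1)` (where `x ≠ 0`, `z ≠ 0`).
The points are those of `C₀` together with the points of `C₀'` with `z = 0`, which are the only
ones that are not identified with a point of `C₀`. -/
inductive Curve : Type
  | affine (x y : ℂ) (h : y ^ 2 = E.f.eval x) : Curve
  | infinity (w : ℂ) (h : w ^ 2 = E.fInf.eval 0) : Curve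

variable {E}

/-- The inclusion of `C₀` in the curve. -/
def ofAffine (q : PlaneCurve E.f) : E.Curve := .affine q.1.1 q.1.2 q.2

open Classical in
/-- The inclusion of `C₀'` in the curve. -/
def ofInfinity (q : PlaneCurve E.fInf) : E.Curve :=
  if h : q.1.1 = 0 then .infinity q.1.2 (by rw [q.2, h])
  else .affine (q.1.1)⁻¹ (q.1.2 / q.1.1 ^ (g + 1)) (by
    have := q.2
    rw [E.eval_fInf _ h] at this
    rw [div_pow, this, ← pow_mul, show (g + 1) * 2 = 2 * g + 2 by ring]
    exact mul_div_cancel_right₀ _ (pow_ne_zero _ h))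

/-- The gluing topology: the finest topology for which both inclusions are continuous. -/
instance : TopologicalSpace E.Curve :=
  TopologicalSpace.coinduced ofAffine inferInstance ⊔
    TopologicalSpace.coinduced ofInfinity inferInstance

lemma isOpen_iff {U : Set E.Curve} :
    IsOpen U ↔ IsOpen (ofAffine ⁻¹' U) ∧ IsOpen (ofInfinity ⁻¹' U) := Iff.rfl

lemma ofAffine_injective : Function.Injective (ofAffine (E := E)) := by
  rintro ⟨⟨a, b⟩, h⟩ ⟨⟨c, d⟩, h'⟩ hh
  simp only [ofAffine, Curve.affine.injEq] at hh
  obtain ⟨rfl, rfl⟩ := hh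
  rfl

lemma ofInfinity_injective : Function.Injective (ofInfinity (E := E)) := by
  rintro ⟨⟨a, b⟩, h⟩ ⟨⟨c, d⟩, h'⟩ hh
  by_cases ha : a = 0 <;> by_cases hc : c = 0
  · subst ha; subst hc
    simp only [ofInfinity, dite_true, Curve.infinity.injEq] at hh
    subst hh; rfl
  · simp [ofInfinity, ha, hc] at hh
  · simp [ofInfinity, ha, hc] at hh
  · simp only [ofInfinity, ha, hc, dite_false, Curve.affine.injEq, inv_inj] at hh
    obtain ⟨rfl, hh⟩ := hh
    have : b = d := by field_simp at hh; exact hh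
    subst this; rfl

lemma continuousOn_swap : ContinuousOn
    (fun q : ℂ × ℂ => ((q.1⁻¹, q.2 / q.1 ^ (g + 1)) : ℂ × ℂ)) {q | q.1 ≠ 0} := by
  intro q hq
  apply ContinuousAt.continuousWithinAt
  have hq' : q.1 ≠ 0 := hq
  exact (continuousAt_fst.inv₀ hq').prodMk
    (continuousAt_snd.div (continuousAt_fst.pow _) (pow_ne_zero _ hq'))

lemma isOpen_swap {O : Set (ℂ × ℂ)} (hO : IsOpen O) :
    IsOpen {q : ℂ × ℂ | q.1 ≠ 0 ∧ ((q.1⁻¹, q.2 / q.1 ^ (g + 1)) : ℂ × ℂ) ∈ O} :=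
  continuousOn_swap.isOpen_inter_preimage (isOpen_ne_fun continuous_fst continuous_const) hO

lemma ofAffine_eq_ofInfinity_iff {p : PlaneCurve E.f} {q : PlaneCurve E.fInf} :
    ofAffine p = ofInfinity q ↔
      q.1.1 ≠ 0 ∧ p.1 = ((q.1.1)⁻¹, q.1.2 / q.1.1 ^ (g + 1)) := by
  by_cases h : q.1.1 = 0
  · simp [ofAffine, ofInfinity, h]
  · simp [ofAffine, ofInfinity, h, Prod.ext_iff]

lemma ofAffine_eq_ofInfinity_iff' {p : PlaneCurve E.f} {q : PlaneCurve E.fInf} :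
    ofAffine p = ofInfinity q ↔
      p.1.1 ≠ 0 ∧ q.1 = ((p.1.1)⁻¹, p.1.2 / p.1.1 ^ (g + 1)) := by
  rw [ofAffine_eq_ofInfinity_iff]
  constructor
  · rintro ⟨h, h'⟩
    rw [Prod.ext_iff] at h' ⊢
    obtain ⟨h1, h2⟩ := h'
    simp only at h1 h2
    refine ⟨by rw [h1]; exact inv_ne_zero h, ?_, ?_⟩
    · simp [h1]
    · simp only [h1, h2, inv_pow, div_inv_eq_mul]; field_simp
  · rintro ⟨h, h'⟩
    rw [Prod.ext_iff] at h' ⊢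
    obtain ⟨h1, h2⟩ := h'
    simp only at h1 h2
    refine ⟨by rw [h1]; exact inv_ne_zero h, ?_, ?_⟩
    · simp [h1]
    · simp only [h1, h2, inv_pow, div_inv_eq_mul]; field_simp

lemma exists_ofInfinity (p : PlaneCurve E.f) (h : p.1.1 ≠ 0) :
    ∃ q : PlaneCurve E.fInf, ofAffine p = ofInfinity q ∧
      q.1 = ((p.1.1)⁻¹, p.1.2 / p.1.1 ^ (g + 1)) := by
  refine ⟨⟨((p.1.1)⁻¹, p.1.2 / p.1.1 ^ (g + 1)), ?_⟩, ?_, rfl⟩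
  · have h1 := E.eval_fInf_inv _ h
    simp only
    rw [div_pow, p.2, ← h1, ← pow_mul, show (g + 1) * 2 = 2 * g + 2 by ring]
    exact mul_div_cancel_right₀ _ (pow_ne_zero _ h)
  · rw [ofAffine_eq_ofInfinity_iff']
    exact ⟨h, rfl⟩

lemma isOpenEmbedding_ofAffine : IsOpenEmbedding (ofAffine (E := E)) := by
  refine .of_continuous_injective_isOpenMap ?_ ofAffine_injective ?_
  · exact continuous_def.2 fun U hU => (isOpen_iff.1 hU).1
  · intro V hV
    obtain ⟨O, hO, rfl⟩ := isOpen_induced_iff.1 hV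
    refine isOpen_iff.2 ⟨?_, ?_⟩
    · rwa [preimage_image_eq _ ofAffine_injective]
    · refine isOpen_induced_iff.2 ⟨_, isOpen_swap (g := g) hO, ?_⟩
      ext q
      simp only [mem_preimage, mem_ofPred_eq, mem_image]
      constructor
      · rintro ⟨h, h'⟩
        by_cases hz : q.1.1 = 0
        · exact absurd hz h
        · refine ⟨⟨((q.1.1)⁻¹, q.1.2 / q.1.1 ^ (g + 1)), ?_⟩, h', ?_⟩
          · have := q.2
            rw [E.eval_fInf _ h] at this
            simp only
            rw [div_pow, this, ← pow_mul, show (g + 1) * 2 = 2 * g + 2 by ring]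
            exact mul_div_cancel_right₀ _ (pow_ne_zero _ h)
          · rw [ofAffine_eq_ofInfinity_iff]; exact ⟨h, rfl⟩
      · rintro ⟨p, hp, hpq⟩
        rw [ofAffine_eq_ofInfinity_iff] at hpq
        refine ⟨hpq.1, ?_⟩
        rw [← hpq.2]; exact hp

lemma isOpenEmbedding_ofInfinity : IsOpenEmbedding (ofInfinity (E := E)) := by
  refine .of_continuous_injective_isOpenMap ?_ ofInfinity_injective ?_
  · exact continuous_def.2 fun U hU => (isOpen_iff.1 hU).2
  · intro V hV
    obtain ⟨O, hO, rfl⟩ := isOpen_induced_iff.1 hV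
    refine isOpen_iff.2 ⟨?_, ?_⟩
    · refine isOpen_induced_iff.2 ⟨_, isOpen_swap (g := g) hO, ?_⟩
      ext p
      simp only [mem_preimage, mem_ofPred_eq, mem_image]
      constructor
      · rintro ⟨h, h'⟩
        obtain ⟨q, hq, hq'⟩ := exists_ofInfinity p h
        exact ⟨q, by rw [hq']; exact h', hq.symm⟩
      · rintro ⟨q, hq, hpq⟩
        have hpq := hpq.symm
        rw [ofAffine_eq_ofInfinity_iff'] at hpq
        refine ⟨hpq.1, ?_⟩
        rw [← hpq.2]; exact hq
    · rwa [preimage_image_eq _ ofInfinity_injective]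

/-- A local inverse of the polynomial `p` near a point `a` with `p'(a) ≠ 0`, restricted to
points where `p'` does not vanish. -/
def localHomeo (p : ℂ[X]) (a : ℂ) (h : p.derivative.eval a ≠ 0) : OpenPartialHomeomorph ℂ ℂ :=
  (((p.hasStrictDerivAt a).hasStrictFDerivAt_equiv h).toOpenPartialHomeomorph
    (fun x => p.eval x)).restrOpen {x | p.derivative.eval x ≠ 0}
    (isOpen_ne_fun p.derivative.continuous continuous_const)

lemma localHomeo_coe (p : ℂ[X]) (a : ℂ) (h : p.derivative.eval a ≠ 0) :
    ⇑(localHomeo p a h) = fun x => p.eval x := rfl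

lemma mem_localHomeo_source (p : ℂ[X]) (a : ℂ) (h : p.derivative.eval a ≠ 0) :
    a ∈ (localHomeo p a h).source :=
  ⟨HasStrictFDerivAt.mem_toOpenPartialHomeomorph_source _, h⟩

lemma derivative_ne_zero_of_mem {p : ℂ[X]} {a : ℂ} {h : p.derivative.eval a ≠ 0} {x : ℂ}
    (hx : x ∈ (localHomeo p a h).source) : p.derivative.eval x ≠ 0 := hx.2

/-- The coordinate `x` on the curve `y² = p(x)` near a point with `y = b ≠ 0`; the inverse is
given by a local branch of `√p`. -/
def chartFst (p : ℂ[X]) (b : ℂ) (hb : (X ^ 2 : ℂ[X]).derivative.eval b ≠ 0) :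
    OpenPartialHomeomorph (PlaneCurve p) ℂ where
  toFun q := q.1.1
  invFun x := open Classical in
    if h : p.eval x ∈ (localHomeo (X ^ 2) b hb).target then
      ⟨(x, (localHomeo (X ^ 2) b hb).symm (p.eval x)), by
        simpa [localHomeo_coe] using (localHomeo (X ^ 2) b hb).right_inv h⟩
    else ⟨(x, (IsAlgClosed.exists_pow_nat_eq (p.eval x) two_pos).choose),
      (IsAlgClosed.exists_pow_nat_eq (p.eval x) two_pos).choose_spec⟩
  source := {q | q.1.2 ∈ (localHomeo (X ^ 2) b hb).source}
  target := {x | p.eval x ∈ (localHomeo (X ^ 2) b hb).target}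
  map_source' q hq := by
    have := (localHomeo (X ^ 2) b hb).map_source hq
    simpa [localHomeo_coe, q.2] using this
  map_target' x hx := by
    have hx' : p.eval x ∈ (localHomeo (X ^ 2) b hb).target := hx
    simp [hx']
  left_inv' q hq := by
    have hq' := (localHomeo (X ^ 2) b hb).map_source hq
    have h2 := (localHomeo (X ^ 2) b hb).left_inv hq
    simp only [localHomeo_coe, eval_pow, eval_X, q.2] at hq' h2
    simp only [hq', dite_true]
    exact Subtype.ext (Prod.ext rfl h2)
  right_inv' x hx := by
    have hx' : p.eval x ∈ (localHomeo (X ^ 2) b hb).target := hx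
    simp [hx']
  open_source := (localHomeo (X ^ 2) b hb).open_source.preimage
    (continuous_snd.comp continuous_subtype_val)
  open_target := (localHomeo (X ^ 2) b hb).open_target.preimage p.continuous
  continuousOn_toFun := (continuous_fst.comp continuous_subtype_val).continuousOn
  continuousOn_invFun := by
    refine (Topology.IsInducing.subtypeVal.continuousOn_iff).2 ?_
    refine ContinuousOn.congr (f := fun x => (x, (localHomeo (X ^ 2) b hb).symm (p.eval x))) ?_ ?_
    · exact continuousOn_id.prodMk
        ((localHomeo (X ^ 2) b hb).continuousOn_symm.comp p.continuous.continuousOn fun x hx => hx)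
    · intro x hx
      have hx' : p.eval x ∈ (localHomeo (X ^ 2) b hb).target := hx
      simp [hx']

/-- The coordinate `y` on the curve `y² = p(x)` near a point with `x = a`, `p'(a) ≠ 0`; the
inverse is given by a local inverse of `p`. -/
def chartSnd (p : ℂ[X]) (a : ℂ) (ha : p.derivative.eval a ≠ 0) :
    OpenPartialHomeomorph (PlaneCurve p) ℂ where
  toFun q := q.1.2
  invFun y := open Classical in
    if h : y ^ 2 ∈ (localHomeo p a ha).target then
      ⟨((localHomeo p a ha).symm (y ^ 2), y), ((localHomeo p a ha).right_inv h).symm⟩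
    else ⟨(a, (IsAlgClosed.exists_pow_nat_eq (p.eval a) two_pos).choose),
      (IsAlgClosed.exists_pow_nat_eq (p.eval a) two_pos).choose_spec⟩
  source := {q | q.1.1 ∈ (localHomeo p a ha).source}
  target := {y | y ^ 2 ∈ (localHomeo p a ha).target}
  map_source' q hq := by
    have := (localHomeo p a ha).map_source hq
    simpa [localHomeo_coe, q.2] using this
  map_target' y hy := by
    have hy' : y ^ 2 ∈ (localHomeo p a ha).target := hy
    simp [hy']
  left_inv' q hq := by
    have hq' := (localHomeo p a ha).map_source hq
    have h2 := (localHomeo p a ha).left_inv hq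
    simp only [localHomeo_coe, ← q.2] at hq' h2
    simp only [hq', dite_true]
    exact Subtype.ext (Prod.ext h2 rfl)
  right_inv' y hy := by
    have hy' : y ^ 2 ∈ (localHomeo p a ha).target := hy
    simp [hy']
  open_source := (localHomeo p a ha).open_source.preimage
    (continuous_fst.comp continuous_subtype_val)
  open_target := (localHomeo p a ha).open_target.preimage (continuous_pow 2)
  continuousOn_toFun := (continuous_snd.comp continuous_subtype_val).continuousOn
  continuousOn_invFun := by
    refine (Topology.IsInducing.subtypeVal.continuousOn_iff).2 ?_
    refine ContinuousOn.congr (f := fun y => ((localHomeo p a ha).symm (y ^ 2), y)) ?_ ?_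
    · exact ((localHomeo p a ha).continuousOn_symm.comp (continuous_pow 2).continuousOn
        fun x hx => hx).prodMk continuousOn_id
    · intro y hy
      have hy' : y ^ 2 ∈ (localHomeo p a ha).target := hy
      simp [hy']

lemma derivative_sq_ne_zero {b : ℂ} (hb : b ≠ 0) :
    (X ^ 2 : ℂ[X]).derivative.eval b ≠ 0 := by simpa using hb

open Classical in
/-- The chart at a point: the coordinate `x` if `y ≠ 0` and `y` if `y = 0`; at infinity, the
coordinate `z` if `w ≠ 0` and `w` if `w = 0`. -/
def chart : E.Curve → OpenPartialHomeomorph E.Curve ℂ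
  | .affine a b h =>
    if hb : b = 0 then
      (chartSnd E.f a (E.derivative_f_ne_zero (by rw [← h, hb]; simp))).lift_openEmbedding
        isOpenEmbedding_ofAffine
    else (chartFst E.f b (derivative_sq_ne_zero hb)).lift_openEmbedding isOpenEmbedding_ofAffine
  | .infinity w h =>
    if hw : w = 0 then
      (chartSnd E.fInf 0 (E.derivative_fInf_ne_zero
        (by rw [← h, hw]; simp))).lift_openEmbedding isOpenEmbedding_ofInfinity
    else (chartFst E.fInf w (derivative_sq_ne_zero hw)).lift_openEmbedding
      isOpenEmbedding_ofInfinity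

lemma mem_chart_source (P : E.Curve) : P ∈ (chart P).source := by
  rcases P with ⟨a, b, h⟩ | ⟨w, h⟩
  · by_cases hb : b = 0
    · simp only [chart, hb, dite_true]
      exact ⟨⟨(a, b), h⟩, mem_localHomeo_source E.f a _, by simp [ofAffine, hb]⟩
    · simp only [chart, hb, dite_false]
      exact ⟨⟨(a, b), h⟩, mem_localHomeo_source (X ^ 2) b _, rfl⟩
  · by_cases hw : w = 0
    · simp only [chart, hw, dite_true]
      exact ⟨⟨(0, w), h⟩, mem_localHomeo_source E.fInf 0 _, by simp [ofInfinity, hw]⟩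
    · simp only [chart, hw, dite_false]
      exact ⟨⟨(0, w), h⟩, mem_localHomeo_source (X ^ 2) w _, by simp [ofInfinity]⟩

instance : ChartedSpace ℂ E.Curve where
  atlas := range chart
  chartAt := chart
  mem_chart_source := mem_chart_source
  chart_mem_atlas P := mem_range_self P

/-- The coordinate `x` of `C₀` (used on `C₀` only). -/
def xCoord : E.Curve → ℂ
  | .affine x _ _ => x
  | .infinity _ _ => 0

/-- The coordinate `y` of `C₀` (used on `C₀` only). -/
def yCoord : E.Curve → ℂ
  | .affine _ y _ => y
  | .infinity _ _ => 0

/-- The coordinate `z` of `C₀'` (used on `C₀'` only). -/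
def zCoord : E.Curve → ℂ
  | .affine x _ _ => x⁻¹
  | .infinity _ _ => 0

/-- The coordinate `w` of `C₀'` (used on `C₀'` only). -/
def wCoord : E.Curve → ℂ
  | .affine x y _ => y / x ^ (g + 1)
  | .infinity w _ => w

lemma zCoord_ofInfinity (q : PlaneCurve E.fInf) : zCoord (ofInfinity q) = q.1.1 := by
  by_cases h : q.1.1 = 0 <;> simp [ofInfinity, h, zCoord]

lemma wCoord_ofInfinity (q : PlaneCurve E.fInf) : wCoord (ofInfinity q) = q.1.2 := by
  by_cases h : q.1.1 = 0
  · simp [ofInfinity, h, wCoord]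
  · simp only [ofInfinity, h, dite_false, wCoord, inv_pow, div_inv_eq_mul]; field_simp

lemma contDiff_eval (p : ℂ[X]) : ContDiff ℂ ω (fun x => p.eval x) := by
  simpa [coe_aeval_eq_eval] using p.contDiff_aeval (𝕜 := ℂ) (n := ω)

lemma contDiffAt_localHomeo_symm {p : ℂ[X]} {a : ℂ} {h : p.derivative.eval a ≠ 0} {t : ℂ}
    (ht : t ∈ (localHomeo p a h).target) : ContDiffAt ℂ ω (localHomeo p a h).symm t :=
  (localHomeo p a h).contDiffAt_symm_deriv
    (derivative_ne_zero_of_mem ((localHomeo p a h).map_target ht)) ht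
    (p.hasDerivAt _) (contDiff_eval p).contDiffAt

/-- A partial homeomorphism of a plane curve whose inverse is a holomorphic map to `ℂ²`. -/
def HolInverse {p : ℂ[X]} (e : OpenPartialHomeomorph (PlaneCurve p) ℂ) : Prop :=
  ∀ t ∈ e.target, ContDiffAt ℂ ω (fun t => (e.symm t).1.1) t ∧
    ContDiffAt ℂ ω (fun t => (e.symm t).1.2) t

lemma holInverse_chartFst (p : ℂ[X]) (b : ℂ) (hb : (X ^ 2 : ℂ[X]).derivative.eval b ≠ 0) :
    HolInverse (chartFst p b hb) := by
  intro t ht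
  have hn := (chartFst p b hb).open_target.mem_nhds ht
  constructor
  · refine contDiffAt_id.congr_of_eventuallyEq ?_
    filter_upwards [hn] with s hs
    exact (chartFst p b hb).right_inv hs
  · have h1 : ContDiffAt ℂ ω (fun s => (localHomeo (X ^ 2) b hb).symm (p.eval s)) t :=
      (contDiffAt_localHomeo_symm (show p.eval t ∈ _ from ht)).comp t (contDiff_eval p).contDiffAt
    refine h1.congr_of_eventuallyEq ?_
    filter_upwards [hn] with s hs
    have hs' : p.eval s ∈ (localHomeo (X ^ 2) b hb).target := hs
    exact congrArg (fun q : PlaneCurve p => q.1.2) (dif_pos hs')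

lemma holInverse_chartSnd (p : ℂ[X]) (a : ℂ) (ha : p.derivative.eval a ≠ 0) :
    HolInverse (chartSnd p a ha) := by
  intro t ht
  have hn := (chartSnd p a ha).open_target.mem_nhds ht
  constructor
  · have h1 : ContDiffAt ℂ ω (fun s => (localHomeo p a ha).symm (s ^ 2)) t :=
      (contDiffAt_localHomeo_symm (show t ^ 2 ∈ _ from ht)).comp t (contDiffAt_id.pow 2)
    refine h1.congr_of_eventuallyEq ?_
    filter_upwards [hn] with s hs
    have hs' : s ^ 2 ∈ (localHomeo p a ha).target := hs
    exact congrArg (fun q : PlaneCurve p => q.1.1) (dif_pos hs')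
  · refine contDiffAt_id.congr_of_eventuallyEq ?_
    filter_upwards [hn] with s hs
    exact (chartSnd p a ha).right_inv hs

lemma chart_cases (P : E.Curve) :
    (∃ e : OpenPartialHomeomorph (PlaneCurve E.f) ℂ, HolInverse e ∧
      chart P = e.lift_openEmbedding isOpenEmbedding_ofAffine ∧
      ((∀ q, e q = q.1.1) ∨ (∀ q, e q = q.1.2))) ∨
    (∃ e : OpenPartialHomeomorph (PlaneCurve E.fInf) ℂ, HolInverse e ∧
      chart P = e.lift_openEmbedding isOpenEmbedding_ofInfinity ∧
      ((∀ q, e q = q.1.1) ∨ (∀ q, e q = q.1.2))) := by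
  rcases P with ⟨a, b, h⟩ | ⟨w, h⟩
  · left
    by_cases hb : b = 0
    · exact ⟨_, holInverse_chartSnd _ _ _, dif_pos hb, .inr fun _ => rfl⟩
    · exact ⟨_, holInverse_chartFst _ _ _, dif_neg hb, .inl fun _ => rfl⟩
  · right
    by_cases hw : w = 0
    · exact ⟨_, holInverse_chartSnd _ _ _, dif_pos hw, .inr fun _ => rfl⟩
    · exact ⟨_, holInverse_chartFst _ _ _, dif_neg hw, .inl fun _ => rfl⟩

/-- In a chart, the coordinates of `C₀` are holomorphic on `C₀` and those of `C₀'` on `C₀'`. -/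
lemma contDiffAt_coord (P : E.Curve) {t : ℂ} (ht : t ∈ (chart P).target) :
    ((chart P).symm t ∈ range (ofAffine (E := E)) →
      ContDiffAt ℂ ω (fun s => xCoord ((chart P).symm s)) t ∧
      ContDiffAt ℂ ω (fun s => yCoord ((chart P).symm s)) t) ∧
    ((chart P).symm t ∈ range (ofInfinity (E := E)) →
      ContDiffAt ℂ ω (fun s => zCoord ((chart P).symm s)) t ∧
      ContDiffAt ℂ ω (fun s => wCoord ((chart P).symm s)) t) := by
  rcases chart_cases P with ⟨e, he, hP, -⟩ | ⟨e, he, hP, -⟩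
  · rw [hP] at ht ⊢
    obtain ⟨h1, h2⟩ := he t ht
    refine ⟨fun _ => ⟨h1, h2⟩, ?_⟩
    rintro ⟨q, hq⟩
    have h0 : (e.symm t).1.1 ≠ 0 := (ofAffine_eq_ofInfinity_iff'.1 hq.symm).1
    exact ⟨h1.inv h0, h2.div (h1.pow _) (pow_ne_zero _ h0)⟩
  · rw [hP] at ht ⊢
    obtain ⟨h1, h2⟩ := he t ht
    constructor
    · rintro ⟨q, hq⟩
      have h0 : (e.symm t).1.1 ≠ 0 := (ofAffine_eq_ofInfinity_iff.1 hq).1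
      have hev : ∀ᶠ s in 𝓝 t, (e.symm s).1.1 ≠ 0 := h1.continuousAt.eventually_ne h0
      refine ⟨(h1.inv h0).congr_of_eventuallyEq ?_,
        (h2.div (h1.pow (g + 1)) (pow_ne_zero _ h0)).congr_of_eventuallyEq ?_⟩
      · filter_upwards [hev] with s hs
        change xCoord (ofInfinity (e.symm s)) = _
        simp [ofInfinity, hs, xCoord]
      · filter_upwards [hev] with s hs
        change yCoord (ofInfinity (e.symm s)) = _
        simp [ofInfinity, hs, yCoord]
    · intro _
      refine ⟨h1.congr_of_eventuallyEq (.of_forall fun s => ?_),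
        h2.congr_of_eventuallyEq (.of_forall fun s => ?_)⟩
      · exact zCoord_ofInfinity (e.symm s)
      · exact wCoord_ofInfinity (e.symm s)

lemma contDiffAt_transition (P Q : E.Curve) {t : ℂ} (ht : t ∈ (chart P).target)
    (hQ : (chart P).symm t ∈ (chart Q).source) :
    ContDiffAt ℂ ω (fun s => chart Q ((chart P).symm s)) t := by
  have hn : ∀ᶠ s in 𝓝 t, (chart P).symm s ∈ (chart Q).source :=
    ((chart P).continuousAt_symm ht).eventually ((chart Q).open_source.mem_nhds hQ)
  have hc := contDiffAt_coord P ht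
  rcases chart_cases Q with ⟨e, -, hP, he⟩ | ⟨e, -, hP, he⟩
  · rw [hP] at hQ hn ⊢
    have hc := hc.1 (image_subset_range _ _ hQ)
    rcases he with he | he
    · refine hc.1.congr_of_eventuallyEq ?_
      filter_upwards [hn] with s hs
      obtain ⟨q, -, hq⟩ := hs
      rw [← hq, OpenPartialHomeomorph.lift_openEmbedding_apply, he]; rfl
    · refine hc.2.congr_of_eventuallyEq ?_
      filter_upwards [hn] with s hs
      obtain ⟨q, -, hq⟩ := hs
      rw [← hq, OpenPartialHomeomorph.lift_openEmbedding_apply, he]; rfl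
  · rw [hP] at hQ hn ⊢
    have hc := hc.2 (image_subset_range _ _ hQ)
    rcases he with he | he
    · refine hc.1.congr_of_eventuallyEq ?_
      filter_upwards [hn] with s hs
      obtain ⟨q, -, hq⟩ := hs
      rw [← hq, OpenPartialHomeomorph.lift_openEmbedding_apply, he, zCoord_ofInfinity]
    · refine hc.2.congr_of_eventuallyEq ?_
      filter_upwards [hn] with s hs
      obtain ⟨q, -, hq⟩ := hs
      rw [← hq, OpenPartialHomeomorph.lift_openEmbedding_apply, he, wCoord_ofInfinity]

/-- The curve is a Riemann surface. -/
instance : IsManifold 𝓘(ℂ) ω E.Curve := by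
  refine isManifold_of_contDiffOn _ _ _ ?_
  rintro _ _ ⟨P, rfl⟩ ⟨Q, rfl⟩
  intro t ht
  simp only [modelWithCornersSelf_coe_symm, modelWithCornersSelf_coe, preimage_id, range_id,
    inter_univ] at ht
  exact (contDiffAt_transition P Q ht.1 ht.2).contDiffWithinAt

lemma range_union_range : range (ofAffine (E := E)) ∪ range (ofInfinity (E := E)) = univ := by
  refine eq_univ_of_forall fun P => ?_
  rcases P with ⟨a, b, h⟩ | ⟨w, h⟩
  · exact .inl ⟨⟨(a, b), h⟩, rfl⟩
  · exact .inr ⟨⟨(0, w), h⟩, by simp [ofInfinity]⟩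

instance : SecondCountableTopology E.Curve := by
  let U : Bool → Set E.Curve := fun b => cond b (range ofAffine) (range ofInfinity)
  have : ∀ b, SecondCountableTopology (U b) := by
    rintro (_ | _)
    · exact (isOpenEmbedding_ofInfinity (E := E)).toIsEmbedding.toHomeomorph.symm.isEmbedding.secondCountableTopology
    · exact (isOpenEmbedding_ofAffine (E := E)).toIsEmbedding.toHomeomorph.symm.isEmbedding.secondCountableTopology
  refine TopologicalSpace.secondCountableTopology_of_countable_cover (U := U) ?_ ?_
  · rintro (_ | _)
    · exact isOpenEmbedding_ofInfinity.isOpen_range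
    · exact isOpenEmbedding_ofAffine.isOpen_range
  · rw [← range_union_range, union_eq_iUnion]

instance : Nonempty E.Curve := by
  obtain ⟨y, hy⟩ := IsAlgClosed.exists_pow_nat_eq (E.f.eval 0) two_pos
  exact ⟨.affine 0 y hy⟩

/-! ### The canonical metric, its area measure, curvature and Laplacian -/

open Classical in
/-- The coefficient of the holomorphic form `x^i dx/y` pulled back by `γ : ℂ → X`: with
`γ^*(x^i dx/y) = formCoeff i γ t dt`. Where `y = 0` one has `dx/y = 2 dy/f'(x)`; at infinity
`x^i dx/y = - z^(g-1-i) dz/w`, and `dz/w = 2 dw/h'(z)` where `w² = h(z)` vanishes. -/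
def formCoeff (i : ℕ) (γ : ℂ → E.Curve) (t : ℂ) : ℂ :=
  match γ t with
  | .affine a b _ => a ^ i *
      if b = 0 then 2 * deriv (fun s => yCoord (γ s)) t / E.f.derivative.eval a
      else deriv (fun s => xCoord (γ s)) t / b
  | .infinity w _ => - 0 ^ (g - 1 - i) *
      if w = 0 then 2 * deriv (fun s => wCoord (γ s)) t / E.fInf.derivative.eval 0
      else deriv (fun s => zCoord (γ s)) t / w

/-- The density `ρ` of the canonical metric `∑ ωᵢ ⊗ conj ωᵢ = ρ dt ⊗ conj dt`, where
`ωᵢ = x^(i-1) dx/y` for `1 ≤ i ≤ g`, in the coordinate `t` of the preferred chart at `P`. -/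
def metricDensity (P : E.Curve) (t : ℂ) : ℝ :=
  ∑ i ∈ Finset.range g, ‖formCoeff i (chartAt ℂ P).symm t‖ ^ 2

instance : MeasurableSpace E.Curve := borel _
instance : BorelSpace E.Curve := ⟨rfl⟩

/-- The area measure `ρ dA` of the domain of the preferred chart at `P`. -/
def chartArea (P : E.Curve) : Measure E.Curve :=
  ((volume.restrict (chartAt ℂ P).target).withDensity
    (fun t => ENNReal.ofReal (metricDensity P t))).map (chartAt ℂ P).symm

variable (E) in
lemma exists_chart_cover : ∃ p : ℕ → E.Curve, ⋃ n, (chartAt ℂ (p n)).source = univ := by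
  obtain ⟨s, hs, hU⟩ := TopologicalSpace.countable_cover_nhds
    (f := fun P : E.Curve => (chartAt ℂ P).source) (fun P => chart_source_mem_nhds ℂ P)
  have hne : s.Nonempty := by
    by_contra h
    rw [not_nonempty_iff_eq_empty] at h
    simp [h] at hU
    exact (univ_nonempty (α := E.Curve)).ne_empty hU.symm
  obtain ⟨p, rfl⟩ := hs.exists_eq_range hne
  exact ⟨p, by simpa using hU⟩

variable (E) in
/-- The area measure `dν` of the canonical metric: it is assembled from the area measures of
chart domains, by cutting the curve into countably many disjoint pieces contained in charts. -/
def area : Measure E.Curve :=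
  Measure.sum fun n => (chartArea ((exists_chart_cover E).choose n)).restrict
    (disjointed (fun k => (chartAt ℂ ((exists_chart_cover E).choose k)).source) n)

/-- The Laplace-Beltrami operator `Δ = ρ⁻¹ (∂²/∂s² + ∂²/∂t²) = (4/ρ) ∂²/∂ζ∂ζ̄`. -/
def laplaceBeltrami (φ : E.Curve → ℂ) (P : E.Curve) : ℂ :=
  ((metricDensity P (chartAt ℂ P P))⁻¹ : ℝ) *
    Laplacian.laplacian (φ ∘ (chartAt ℂ P).symm) (chartAt ℂ P P)

/-- The Gaussian curvature `K = -(1/(2ρ)) (∂²/∂s² + ∂²/∂t²) log ρ`. -/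
def gaussCurvature (P : E.Curve) : ℝ :=
  -(2 * metricDensity P (chartAt ℂ P P))⁻¹ *
    Laplacian.laplacian (fun t => Real.log (metricDensity P t)) (chartAt ℂ P P)

/-! ### Divisors and the functions `F_D`, `u_D` -/

/-- The hyperelliptic involution `(x, y) ↦ (x, -y)`, `(z, w) ↦ (z, -w)`. -/
def involution : E.Curve → E.Curve
  | .affine a b h => .affine a (-b) (by rw [neg_sq, h])
  | .infinity w h => .infinity (-w) (by rw [neg_sq, h])

variable (E) in
/-- Divisors on the curve. -/
abbrev Divisor : Type := E.Curve →₀ ℤ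

/-- The degree of a divisor. -/
def deg (D : E.Divisor) : ℤ := D.sum fun _ n => n

/-- The involution on divisors. -/
def involutionDiv (D : E.Divisor) : E.Divisor := D.mapDomain involution

/-- `α(D) = D + ι(D)`. -/
def alpha (D : E.Divisor) : E.Divisor := D + involutionDiv D

variable (E) in
lemma finite_fixed : {P : E.Curve | involution P = P}.Finite := by
  let π : E.Curve → Option ℂ := fun P => match P with
    | .affine a _ _ => some a
    | .infinity _ _ => none
  have hf : E.f ≠ 0 := E.monic.ne_zero
  refine Set.Finite.of_injOn (f := π)
    (t := insert none (some '' (E.f.roots.toFinset : Set ℂ))) ?_ ?_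
    ((Finset.finite_toSet _).image _ |>.insert _)
  · rintro (⟨a, b, h⟩ | ⟨w, h⟩) hP
    · have hb : b = 0 := by
        simpa [involution, neg_eq_self] using hP
      right
      refine ⟨a, ?_, rfl⟩
      simp [hf, IsRoot, ← h, hb]
    · exact .inl rfl
  · rintro (⟨a, b, h⟩ | ⟨w, h⟩) hP (⟨a', b', h'⟩ | ⟨w', h'⟩) hP' hh
    · have hb : b = 0 := by simpa [involution, neg_eq_self] using hP
      have hb' : b' = 0 := by simpa [involution, neg_eq_self] using hP'
      simp only [π, Option.some.injEq] at hh
      subst hh; subst hb; subst hb'; rfl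
    · simp [π] at hh
    · simp [π] at hh
    · have hb : w = 0 := by simpa [involution, neg_eq_self] using hP
      have hb' : w' = 0 := by simpa [involution, neg_eq_self] using hP'
      subst hb; subst hb'; rfl

variable (E) in
/-- The Weierstrass divisor: the sum of the Weierstrass points, which are the fixed points of the
hyperelliptic involution. -/
def weierstrassDiv : E.Divisor := ∑ P ∈ (finite_fixed E).toFinset, Finsupp.single P 1

/-- `(σ(t) (1 + t)²) ^ (1/(2g+2))` with `σ(t) = 1 + t + ⋯ + t^(g-1)`. -/
def weight (g : ℕ) (t : ℝ) : ℝ :=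
  ((∑ i ∈ Finset.range g, t ^ i) * (1 + t) ^ 2) ^ (1 / (2 * g + 2) : ℝ)

/-- `FPoint P Q = F_P(Q)`. At a point `Q` of infinity the coordinate `z` is `0`. -/
def FPoint : E.Curve → E.Curve → ℝ
  | .affine a _ _, .affine x _ _ => ‖x - a‖ / weight g (‖x‖ ^ 2)
  | .affine a _ _, .infinity _ _ => ‖1 - 0 * a‖ / weight g (‖(0 : ℂ)‖ ^ 2)
  | .infinity _ _, .affine x _ _ => 1 / weight g (‖x‖ ^ 2)
  | .infinity _ _, .infinity _ _ => ‖(0 : ℂ)‖ / weight g (‖(0 : ℂ)‖ ^ 2)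

/-- `F_D = ∏ F_P ^ n_P` for `D = ∑ n_P P`. -/
def FDiv (D : E.Divisor) (Q : E.Curve) : ℝ := D.prod fun P n => FPoint P Q ^ n

/-- `u_D = ∑ n_P log F_P` for `D = ∑ n_P P`. This is `log F_D`, and the sum also has the right
value at the points where factors `0 ^ n` and `0 ^ (-n)` of `F_D` cancel (because
`F_P = F_{ι(P)}`). -/
def uDiv (D : E.Divisor) (Q : E.Curve) : ℝ := D.sum fun P n => n * Real.log (FPoint P Q)

/-! ### Test functions and distributions -/

variable (E) in
/-- The space `C^∞(X, ℂ)` of complex valued functions that are smooth in the real sense. -/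
def smoothFunctions : Submodule ℂ (E.Curve → ℂ) where
  carrier := {φ | ContMDiff 𝓘(ℝ, ℂ) 𝓘(ℝ, ℂ) ∞ φ}
  add_mem' h h' := ContMDiff.add h h'
  zero_mem' := contMDiff_const
  smul_mem' c _ h := ((contDiff_const.mul contDiff_id :
    ContDiff ℝ ∞ fun v : ℂ => c * v).contMDiff).comp h

variable (E) in
/-- The space `C^∞(X, ℂ)`, to be equipped with its Fréchet topology. -/
def TestFunction : Type := smoothFunctions E

instance : AddCommGroup (TestFunction E) := inferInstanceAs (AddCommGroup (smoothFunctions E))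
instance : Module ℂ (TestFunction E) := inferInstanceAs (Module ℂ (smoothFunctions E))
instance : CoeFun (TestFunction E) (fun _ => E.Curve → ℂ) := ⟨Subtype.val⟩

/-- The Fréchet topology: the coarsest one for which, for each chart and each order `n`, the
`n`-th derivative in the chart depends continuously on the function, with respect to uniform
convergence on the compact subsets of the chart. -/
instance : TopologicalSpace (TestFunction E) :=
  ⨅ (P : E.Curve) (n : ℕ), TopologicalSpace.induced
    (fun φ : TestFunction E =>
      UniformOnFun.ofFun {s : Set ℂ | IsCompact s ∧ s ⊆ (chartAt ℂ P).target}
        (iteratedFDeriv ℝ n (φ ∘ (chartAt ℂ P).symm))) inferInstance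

/-- The distribution `φ ↦ ∫ h φ dν` given by a function `h`. -/
def distOfFun (h : E.Curve → ℝ) (φ : TestFunction E) : ℂ := ∫ P, (h P : ℂ) * φ P ∂(area E)

/-- The distribution `δ_D = ∑ n_P δ_P` for `D = ∑ n_P P`. -/
def deltaDiv (D : E.Divisor) (φ : TestFunction E) : ℂ := D.sum fun P n => (n : ℂ) * φ P

/-- `c` is a holomorphic coordinate of the curve centred at `Q`. -/
def IsCoordinateAt (Q : E.Curve) (c : OpenPartialHomeomorph E.Curve ℂ) : Prop :=
  c ∈ IsManifold.maximalAtlas 𝓘(ℂ) ω E.Curve ∧ Q ∈ c.source ∧ c Q = 0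

/-- The closed disc `|c| ≤ ε` in the coordinate `c`. -/
def coordDisc (c : OpenPartialHomeomorph E.Curve ℂ) (ε : ℝ) : Set E.Curve :=
  c.symm '' Metric.closedBall 0 ε

/-- `T` is the functional `Δu` of a function `u` with singularities in the finite set `S`:
for every smooth `φ`, `T φ` is the limit as `ε → 0+` of `∫ u Δφ dν` over the complement of the
coordinate discs of radius `ε` about the points of `S`, for every choice of coordinates. -/
def IsDistributionalLaplacian (u : E.Curve → ℝ) (S : Finset E.Curve) (T : TestFunction E → ℂ) :
    Prop :=
  ∀ c : E.Curve → OpenPartialHomeomorph E.Curve ℂ, (∀ Q ∈ S, IsCoordinateAt Q (c Q)) →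
    ∀ φ : TestFunction E,
      (∀ᶠ ε in 𝓝[>] (0 : ℝ), IntegrableOn (fun P => (u P : ℂ) * laplaceBeltrami φ P)
        (⋃ Q ∈ S, coordDisc (c Q) ε)ᶜ (area E)) ∧
      Tendsto (fun ε : ℝ => ∫ P in (⋃ Q ∈ S, coordDisc (c Q) ε)ᶜ,
        (u P : ℂ) * laplaceBeltrami φ P ∂(area E)) (𝓝[>] 0) (𝓝 (T φ))

end HyperellipticEquation

end

open HyperellipticEquation

/-!
Write `ρ` for the density of the metric in a chart, so that the Laplacian of the surface is `ρ⁻¹`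
times the plane Laplacian while its area measure is `ρ` times Lebesgue measure. The densities cancel
in `∫ u Δφ dν`, and every question about `Δ u_D` becomes one about plane Laplacians.

*The regular part.* In a chart the forms `ω_i` are `x ^ (i - 1) θ` with `θ` holomorphic and without
zeros (in the part at infinity, up to sign and order, with `z` in place of `x`), hence `ρ = σ_g(|x|²) |θ|²`. The equation
`x' = θ y` also gives `|x'|² = |θ|² |f(x)|`. Since `log |θ|` is harmonic, `ρ K` is
`-½ Δ log σ_g(|x|²)`; and since `Δ log (1 + |x|²) = 4 |x'|² / (1 + |x|²)²`, the product of `ρ` with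
`F_W = |f(x)| / (σ_g(|x|²) (1 + |x|²)²)` is a quarter of `Δ log (1 + |x|²)`. By the definition of
`N`, therefore, `-log N(|x|²)` has the Laplacian `ρ (K - 4 F_W) / (g + 1)` (`exists_localForm`,
`LocalForm.gaussCurvature_eq`, `LocalForm.metricDensity_mul_FDiv`). For `g = 2` one has
`σ_2(t) = 1 + t`, and comparing the two formulas gives `K = -2 F_W`.

*The singular part.* Near a point `Q` with coordinate `t₀`, `log F_P = m log |t - t₀| + v`, where `v`
is smooth with the Laplacian just found and `m` is the multiplicity of `Q` in `P + ι(P)`: the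
coordinate function `x` is ramified exactly at the fixed points of `ι` (`exists_log_FPoint_eq`).
Green's identity (`integral_smul_laplacian`) and the fundamental solution `log |t|` of the Laplacian
(`integral_log_norm_smul_laplacian`, proved with the regularisation `½ log (c + |t|²)`) give the
equation for `log F_P` against test functions supported near `Q`; a partition of unity on the
compact surface extends it to all test functions (`weakEquation`), and linearity to all divisors.

*The limit.* A logarithmic singularity is integrable, so `u_D Δφ` is integrable on the surface. The
closed coordinate discs shrink to points of measure zero, whatever the coordinates, and dominated
convergence identifies the limit with the integral over the whole surface
(`isDistributionalLaplacian_of_integrable`). The right-hand side of the equation is visibly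
continuous in `φ`, already for uniform convergence.

*Smoothness.* `F_P = F_{ι(P)}` gives `2 u_D = u_{α(D)}`, and every `log F_P` is smooth off
`{P, ι(P)}`.
-/

open Laplacian InnerProductSpace

/-! ### The Laplacian of the plane -/

section Plane

variable {F : Type*} [NormedAddCommGroup F] [NormedSpace ℝ F]

lemma laplacian_eq_fderiv_fderiv (f : ℂ → F) (t : ℂ) :
    Δ f t = fderiv ℝ (fderiv ℝ f) t 1 1 + fderiv ℝ (fderiv ℝ f) t Complex.I Complex.I := by
  simp [laplacian_eq_iteratedFDeriv_complexPlane, iteratedFDeriv_two_apply]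

lemma fderiv_fderiv_apply {f : ℂ → F} {t : ℂ} (hf : ContDiffAt ℝ 2 f t) (v w : ℂ) :
    fderiv ℝ (fun s => fderiv ℝ f s v) t w = fderiv ℝ (fderiv ℝ f) t w v := by
  have h : DifferentiableAt ℝ (fderiv ℝ f) t :=
    (hf.fderiv_right (m := 1) (by norm_num)).differentiableAt (by norm_num)
  rw [fderiv_clm_apply h (differentiableAt_const v)]
  simp

/-- The Laplacian is multiplied by `|h'|²` under a holomorphic substitution `h`. -/
lemma laplacian_comp_analyticAt {f : ℂ → F} {h : ℂ → ℂ} {t : ℂ} (hh : AnalyticAt ℂ h t)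
    (hf : ContDiffAt ℝ 2 f (h t)) :
    Δ (f ∘ h) t = ‖deriv h t‖ ^ 2 • Δ f (h t) := by
  have hev : ∀ᶠ s in 𝓝 t, fderiv ℝ (f ∘ h) s =
      (fderiv ℝ f (h s)).comp (deriv h s • (1 : ℂ →L[ℝ] ℂ)) := by
    have h1 : ∀ᶠ s in 𝓝 t, DifferentiableAt ℝ f (h s) :=
      hh.continuousAt.eventually
        ((hf.eventually (by simp)).mono fun s hs => hs.differentiableAt (by norm_num))
    filter_upwards [h1, hh.eventually_analyticAt] with s hs hs'
    have := hs'.differentiableAt.hasDerivAt.complexToReal_fderiv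
    exact (hs.hasFDerivAt.comp s this).fderiv
  have hD : HasFDerivAt (fderiv ℝ f) (fderiv ℝ (fderiv ℝ f) (h t)) (h t) :=
    ((hf.fderiv_right (m := 1) (by norm_num)).differentiableAt (by norm_num)).hasFDerivAt
  have hh1 := hh.differentiableAt.hasDerivAt.complexToReal_fderiv
  have hh2 := hh.deriv.differentiableAt.hasDerivAt.complexToReal_fderiv
  have key := (hD.comp t hh1).clm_comp (hh2.smul_const (1 : ℂ →L[ℝ] ℂ))
  have key' := (key.congr_of_eventuallyEq hev).fderiv
  rw [laplacian_eq_fderiv_fderiv, laplacian_eq_fderiv_fderiv, key']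
  set B := fderiv ℝ (fderiv ℝ f) (h t)
  set L := fderiv ℝ f (h t)
  set a := deriv h t with ha
  have hI : (Complex.I * Complex.I : ℂ) = -1 := Complex.I_mul_I
  have e1 : a = a.re • (1 : ℂ) + a.im • Complex.I := by
    simp [Complex.re_add_im]
  have e2 : a * Complex.I = a.re • Complex.I + (-a.im) • (1 : ℂ) := by
    conv_lhs => rw [e1]
    apply Complex.ext <;> simp
  have e3 : deriv (deriv h) t * Complex.I * Complex.I = - deriv (deriv h) t := by
    rw [mul_assoc, hI]; ring
  have e4 : ‖a‖ ^ 2 = a.re * a.re + a.im * a.im := by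
    rw [← Complex.normSq_eq_norm_sq, Complex.normSq_apply]
  simp only [add_apply, ContinuousLinearMap.comp_apply, smul_apply,
    ContinuousLinearMap.compL_apply, ContinuousLinearMap.flip_apply,
    ContinuousLinearMap.smulRight_apply, ContinuousLinearMap.one_def,
    ContinuousLinearMap.id_apply, smul_eq_mul, mul_one, Function.comp_apply]
  obtain ⟨p, hp⟩ : ∃ p, p = a.re := ⟨_, rfl⟩
  obtain ⟨q, hq⟩ : ∃ q, q = a.im := ⟨_, rfl⟩
  rw [← hp, ← hq] at e1 e2 e4
  rw [e2, e3, e4, e1]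
  simp only [map_add, map_smul, add_apply, smul_apply, map_neg, smul_add, smul_smul]
  module

lemma hasFDerivAt_log_add_normSq {c : ℝ} (hc : 0 < c) (x : ℂ) :
    HasFDerivAt (fun x : ℂ => Real.log (c + ‖x‖ ^ 2))
      ((c + ‖x‖ ^ 2)⁻¹ • (2 • innerSL ℝ x)) x :=
  ((hasStrictFDerivAt_norm_sq x).hasFDerivAt.const_add c).log (by positivity)

lemma contDiff_log_add_normSq {n : WithTop ℕ∞} {c : ℝ} (hc : 0 < c) :
    ContDiff ℝ n (fun x : ℂ => Real.log (c + ‖x‖ ^ 2)) :=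
  (contDiff_const.add (contDiff_norm_sq ℝ)).log fun x => by positivity

lemma laplacian_log_add_normSq {c : ℝ} (hc : 0 < c) (x : ℂ) :
    Δ (fun x : ℂ => Real.log (c + ‖x‖ ^ 2)) x = 4 * c / (c + ‖x‖ ^ 2) ^ 2 := by
  have h2 : ContDiffAt ℝ 2 (fun x : ℂ => Real.log (c + ‖x‖ ^ 2)) x :=
    (contDiff_log_add_normSq hc).contDiffAt
  have key : ∀ v : ℂ, fderiv ℝ (fderiv ℝ (fun x : ℂ => Real.log (c + ‖x‖ ^ 2))) x v v =
      2 * ‖v‖ ^ 2 / (c + ‖x‖ ^ 2) - 4 * (inner ℝ x v) ^ 2 / (c + ‖x‖ ^ 2) ^ 2 := by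
    intro v
    rw [← fderiv_fderiv_apply h2]
    have : (fun s => fderiv ℝ (fun x : ℂ => Real.log (c + ‖x‖ ^ 2)) s v) =
        fun s => (c + ‖s‖ ^ 2)⁻¹ * (2 * inner ℝ s v) := by
      ext s; rw [(hasFDerivAt_log_add_normSq hc s).fderiv]
      simp only [smul_apply, innerSL_apply_apply, smul_eq_mul, nsmul_eq_mul]
      push_cast
      rfl
    rw [this]
    have hne : c + ‖x‖ ^ 2 ≠ 0 := by positivity
    have d1 : HasFDerivAt (fun s : ℂ => (c + ‖s‖ ^ 2)⁻¹)
        (-((c + ‖x‖ ^ 2) ^ 2)⁻¹ • (2 • innerSL ℝ x)) x :=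
      (hasDerivAt_inv hne).comp_hasFDerivAt x
        ((hasStrictFDerivAt_norm_sq x).hasFDerivAt.const_add c)
    have d2 : HasFDerivAt (fun s : ℂ => 2 * inner ℝ s v) ((2 : ℝ) • innerSL ℝ v) x := by
      have : (fun s : ℂ => 2 * inner ℝ s v) = ((2 : ℝ) • innerSL ℝ v) := by
        ext s
        simp only [Pi.smul_apply, innerSL_apply_apply, smul_eq_mul, real_inner_comm]
      rw [this]; exact ((2 : ℝ) • innerSL ℝ v).hasFDerivAt
    rw [HasFDerivAt.fderiv (f := fun s : ℂ => (c + ‖s‖ ^ 2)⁻¹ * (2 * inner ℝ s v)) (d1.mul d2)]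
    simp only [add_apply, smul_apply, innerSL_apply_apply, smul_eq_mul,
      real_inner_self_eq_norm_sq, nsmul_eq_mul]
    field_simp
    push_cast
    ring
  rw [laplacian_eq_fderiv_fderiv, key, key]
  have e1 : inner ℝ x (1 : ℂ) = x.re := by simp [Complex.inner]
  have e2 : inner ℝ x Complex.I = x.im := by simp [Complex.inner]
  have e3 : ‖x‖ ^ 2 = x.re ^ 2 + x.im ^ 2 := by
    rw [← Complex.normSq_eq_norm_sq, Complex.normSq_apply]; ring
  have hne : c + ‖x‖ ^ 2 ≠ 0 := by positivity
  rw [e1, e2, e3] at *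
  simp only [norm_one, Complex.norm_I]
  field_simp
  ring

/-- **Green's identity** for a compactly supported function `ψ` and a function `v` that is smooth
near the support of `ψ`. -/
lemma integral_smul_laplacian {v : ℂ → ℝ} {ψ : ℂ → ℂ} (hψ : ContDiff ℝ 2 ψ)
    (hc : HasCompactSupport ψ) (hv : ∀ t ∈ tsupport ψ, ContDiffAt ℝ 2 v t) :
    Integrable (fun t => v t • Δ ψ t) ∧ ∫ t, v t • Δ ψ t = ∫ t, Δ v t • ψ t := by
  have htD : ∀ e : ℂ, tsupport (fun t => fderiv ℝ ψ t e) ⊆ tsupport ψ := fun e =>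
    (closure_mono fun t ht => by
      contrapose! ht
      have := (Function.notMem_support.1 ht)
      simp [this]).trans (tsupport_fderiv_subset ℝ (f := ψ))
  have hv' : ∀ e : ℂ, ∀ t ∈ tsupport ψ, ContDiffAt ℝ 1 (fun t => fderiv ℝ v t e) t :=
    fun e t ht => ((hv t ht).fderiv_right (m := 1) (by norm_num)).clm_apply contDiffAt_const
  have hψ' : ∀ e : ℂ, ContDiff ℝ 1 (fun t => fderiv ℝ ψ t e) := fun e =>
    (hψ.fderiv_right (m := 1) (by norm_num)).clm_apply contDiff_const
  have hcD : ∀ e : ℂ, HasCompactSupport (fun t => fderiv ℝ ψ t e) := fun e =>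
    hc.mono' ((subset_tsupport _).trans (htD e))
  -- a product of continuous functions, one of them only continuous near the support of the other
  have hint : ∀ (a : ℂ → ℝ) (b : ℂ → ℂ), Continuous b → HasCompactSupport b →
      (∀ t ∈ tsupport b, ContinuousAt a t) → Integrable (fun t => a t • b t) := by
    intro a b hb hbc hab
    have hs : HasCompactSupport fun t => a t • b t :=
      hbc.mono fun t ht hb0 => ht (by simp [hb0])
    refine Continuous.integrable_of_hasCompactSupport ?_ hs
    refine continuous_of_tsupport fun t ht => ?_
    have ht' : t ∈ tsupport b := closure_mono
      (show Function.support _ ⊆ Function.support b from fun s hs hb0 => hs (by simp [hb0])) ht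
    exact (hab t ht').smul hb.continuousAt
  have hD2c : ∀ e : ℂ, Continuous fun t => fderiv ℝ (fun s => fderiv ℝ ψ s e) t e := fun e =>
    ((hψ' e).continuous_fderiv (by norm_num)).clm_apply continuous_const
  have htD2 : ∀ e : ℂ, tsupport (fun t => fderiv ℝ (fun s => fderiv ℝ ψ s e) t e) ⊆ tsupport ψ :=
    fun e => (closure_mono fun t ht => by
      contrapose! ht
      have := (Function.notMem_support.1 ht)
      simp [this]).trans ((tsupport_fderiv_subset ℝ (f := fun s => fderiv ℝ ψ s e)).trans (htD e))
  have hcD2 : ∀ e : ℂ, HasCompactSupport fun t => fderiv ℝ (fun s => fderiv ℝ ψ s e) t e :=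
    fun e => hc.mono' ((subset_tsupport _).trans (htD2 e))
  have i1 : ∀ e, Integrable fun t => v t • fderiv ℝ (fun s => fderiv ℝ ψ s e) t e := fun e =>
    hint _ _ (hD2c e) (hcD2 e) fun t ht => (hv t (htD2 e ht)).continuousAt
  have i2 : ∀ e, Integrable fun t => fderiv ℝ v t e • fderiv ℝ ψ t e := fun e =>
    hint _ _ (hψ' e).continuous (hcD e) fun t ht => (hv' e t (htD e ht)).continuousAt
  have i3 : ∀ e, Integrable fun t => v t • fderiv ℝ ψ t e := fun e =>
    hint _ _ (hψ' e).continuous (hcD e) fun t ht => (hv t (htD e ht)).continuousAt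
  have i4 : ∀ e, Integrable fun t => fderiv ℝ (fun s => fderiv ℝ v s e) t e • ψ t := fun e =>
    hint _ _ hψ.continuous hc fun t ht =>
      ((hv' e t ht).fderiv_right (m := 0) (by norm_num)).continuousAt.clm_apply continuousAt_const
  have i5 : ∀ e, Integrable fun t => fderiv ℝ v t e • ψ t := fun e =>
    hint _ _ hψ.continuous hc fun t ht => (hv' e t ht).continuousAt
  have step : ∀ e : ℂ, ∫ t, v t • fderiv ℝ (fun s => fderiv ℝ ψ s e) t e =
      ∫ t, fderiv ℝ (fun s => fderiv ℝ v s e) t e • ψ t := by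
    intro e
    rw [integral_smul_fderiv_eq_neg_fderiv_smul_of_integrable (i2 e) (i1 e) (i3 e)
      (fun t ht => (hv t (htD e ht)).differentiableAt (by norm_num))
      (fun t _ => (hψ' e).differentiable (by norm_num) t),
      integral_smul_fderiv_eq_neg_fderiv_smul_of_integrable (i4 e) (i2 e) (i5 e)
      (fun t ht => (hv' e t ht).differentiableAt (by norm_num))
      (fun t _ => hψ.differentiable (by norm_num) t), neg_neg]
  have e1 : (fun t => v t • Δ ψ t) = fun t => v t • fderiv ℝ (fun s => fderiv ℝ ψ s 1) t 1 +
      v t • fderiv ℝ (fun s => fderiv ℝ ψ s Complex.I) t Complex.I := by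
    ext1 t
    rw [fderiv_fderiv_apply hψ.contDiffAt, fderiv_fderiv_apply hψ.contDiffAt, ← smul_add,
      laplacian_eq_fderiv_fderiv]
  have e2 : (fun t => Δ v t • ψ t) = fun t => fderiv ℝ (fun s => fderiv ℝ v s 1) t 1 • ψ t +
      fderiv ℝ (fun s => fderiv ℝ v s Complex.I) t Complex.I • ψ t := by
    ext1 t
    by_cases ht : t ∈ tsupport ψ
    · rw [fderiv_fderiv_apply (hv t ht), fderiv_fderiv_apply (hv t ht), ← add_smul,
        laplacian_eq_fderiv_fderiv]
    · simp [image_eq_zero_of_notMem_tsupport ht]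
  rw [e1, e2, integral_add (i1 _) (i1 _), integral_add (i4 _) (i4 _), step, step]
  exact ⟨(i1 _).add (i1 _), rfl⟩

/-- The logarithm is locally integrable in the plane. -/
lemma integrableOn_log_norm (R : ℝ) :
    IntegrableOn (fun t : ℂ => Real.log ‖t‖) (Metric.ball 0 R) := by
  rw [integrableOn_fun_norm_addHaar volume (f := Real.log)]
  simp only [Complex.finrank_real_complex, smul_eq_mul]
  have : Continuous fun y : ℝ => y * Real.log y := Real.continuous_mul_log
  have h2 : IntegrableOn (fun y : ℝ => y * Real.log y) (Icc 0 R) :=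
    this.continuousOn.integrableOn_Icc
  simpa using h2.mono_set Ioo_subset_Icc_self

lemma integral_two_div_sq_one_add_normSq :
    Integrable (fun s : ℂ => 2 / (1 + ‖s‖ ^ 2) ^ 2) ∧
      ∫ s : ℂ, 2 / (1 + ‖s‖ ^ 2) ^ 2 = 2 * Real.pi := by
  have hder : ∀ r ∈ Ici (0 : ℝ), HasDerivAt (fun r : ℝ => -(1 + r ^ 2)⁻¹)
      (2 * r / (1 + r ^ 2) ^ 2) r := by
    intro r _
    have hne : 1 + r ^ 2 ≠ 0 := by positivity
    have := (((hasDerivAt_pow 2 r).const_add 1).inv hne).neg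
    convert! this using 1
    simp; ring
  have hlim : Tendsto (fun r : ℝ => -(1 + r ^ 2)⁻¹) atTop (𝓝 (-0)) := by
    refine (tendsto_inv_atTop_zero.comp ?_).neg
    exact tendsto_atTop_add_const_left _ _ (tendsto_pow_atTop two_ne_zero)
  have hpos : ∀ r ∈ Ioi (0 : ℝ), 0 ≤ 2 * r / (1 + r ^ 2) ^ 2 := fun r hr => by
    have : 0 < r := hr
    positivity
  have hi := integrableOn_Ioi_deriv_of_nonneg' hder hpos hlim
  have hv := integral_Ioi_of_hasDerivAt_of_nonneg' hder hpos hlim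
  have e : ∀ y : ℝ, y * (2 / (1 + y ^ 2) ^ 2) = 2 * y / (1 + y ^ 2) ^ 2 := fun y => by ring
  constructor
  · rw [integrable_fun_norm_addHaar volume (f := fun r : ℝ => 2 / (1 + r ^ 2) ^ 2)]
    simpa [Complex.finrank_real_complex, e] using hi
  · rw [integral_fun_norm_addHaar volume (fun r : ℝ => 2 / (1 + r ^ 2) ^ 2)]
    simp only [Complex.finrank_real_complex, smul_eq_mul, Nat.add_one_sub_one, pow_one, e]
    rw [hv]
    simp [Measure.real]

lemma continuous_laplacian {ψ : ℂ → F} (hψ : ContDiff ℝ 2 ψ) : Continuous (Δ ψ) := by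
  have h : ContDiff ℝ 0 (fderiv ℝ (fderiv ℝ ψ)) :=
    (hψ.fderiv_right (m := 1) (by norm_num)).fderiv_right (m := 0) (by norm_num)
  have : Δ ψ = fun t => fderiv ℝ (fderiv ℝ ψ) t 1 1 +
      fderiv ℝ (fderiv ℝ ψ) t Complex.I Complex.I := funext (laplacian_eq_fderiv_fderiv ψ)
  rw [this]
  have hc := h.continuous
  exact ((hc.clm_apply continuous_const).clm_apply continuous_const).add
    ((hc.clm_apply continuous_const).clm_apply continuous_const)

lemma hasCompactSupport_laplacian {ψ : ℂ → F} (hc : HasCompactSupport ψ) :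
    HasCompactSupport (Δ ψ) := by
  refine hc.mono' fun t ht => ?_
  by_contra h
  refine ht ((laplacian_congr_nhds (notMem_tsupport_iff_eventuallyEq.1 h)).eq_of_nhds.trans ?_)
  exact congrFun (laplacian_const (c := (0 : F))) t

/-- `log ‖t‖ / 2π` is a fundamental solution of the Laplace equation in the plane: it is the limit
of the smooth functions `log (ε ^ 2 + ‖t‖ ^ 2) / 4π`, whose Laplacians are an approximate
identity. -/
lemma integral_log_norm_smul_laplacian_zero {ψ : ℂ → ℂ} (hψ : ContDiff ℝ 2 ψ)
    (hc : HasCompactSupport ψ) :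
    Integrable (fun t => Real.log ‖t‖ • Δ ψ t) ∧
      ∫ t, Real.log ‖t‖ • Δ ψ t = (2 * Real.pi) • ψ 0 := by
  have hΔ : Continuous (Δ ψ) := continuous_laplacian hψ
  have hΔc : HasCompactSupport (Δ ψ) := hasCompactSupport_laplacian hc
  have hloc : LocallyIntegrable (fun t : ℂ => Real.log ‖t‖) := fun t =>
    ⟨_, Metric.isOpen_ball.mem_nhds (by simp : t ∈ Metric.ball (0 : ℂ) (‖t‖ + 1)),
      integrableOn_log_norm _⟩
  have hlog : Integrable (fun t => Real.log ‖t‖ • Δ ψ t) :=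
    hloc.integrable_smul_right_of_hasCompactSupport hΔ hΔc
  refine ⟨hlog, ?_⟩
  have hL : ∀ ε : ℝ, 0 < ε → ContDiff ℝ 2 fun t : ℂ => (2⁻¹ : ℝ) * Real.log (ε ^ 2 + ‖t‖ ^ 2) :=
    fun ε hε => contDiff_const.mul (contDiff_log_add_normSq (by positivity))
  have hΔL : ∀ ε : ℝ, 0 < ε → ∀ t : ℂ,
      Δ (fun t : ℂ => (2⁻¹ : ℝ) * Real.log (ε ^ 2 + ‖t‖ ^ 2)) t =
        2 * ε ^ 2 / (ε ^ 2 + ‖t‖ ^ 2) ^ 2 := by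
    intro ε hε t
    have h := laplacian_smul (𝕜 := ℝ) (2⁻¹ : ℝ)
      (contDiff_log_add_normSq (n := 2) (c := ε ^ 2) (by positivity)).contDiffAt (x := t)
    rw [laplacian_log_add_normSq (by positivity)] at h
    refine h.trans ?_
    simp only [smul_eq_mul]; ring
  -- both sides of Green's identity for the regularised logarithm
  have hgreen : ∀ ε : ℝ, 0 < ε →
      ∫ t, ((2⁻¹ : ℝ) * Real.log (ε ^ 2 + ‖t‖ ^ 2)) • Δ ψ t =
        ∫ s : ℂ, (2 / (1 + ‖s‖ ^ 2) ^ 2 : ℝ) • ψ (ε • s) := by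
    intro ε hε
    rw [(integral_smul_laplacian hψ hc fun t _ => (hL ε hε).contDiffAt).2]
    have := Measure.integral_comp_smul volume (fun t : ℂ =>
      Δ (fun t : ℂ => (2⁻¹ : ℝ) * Real.log (ε ^ 2 + ‖t‖ ^ 2)) t • ψ t) ε
    rw [Complex.finrank_real_complex, abs_of_pos (by positivity), eq_inv_smul_iff₀ (by positivity),
      ← integral_smul] at this
    rw [← this]
    congr 1
    ext1 s
    rw [hΔL ε hε, smul_smul, norm_smul, Real.norm_of_nonneg hε.le]
    congr 1
    field_simp
  have lim1 : Tendsto (fun ε : ℝ => ∫ t, ((2⁻¹ : ℝ) * Real.log (ε ^ 2 + ‖t‖ ^ 2)) • Δ ψ t)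
      (𝓝[>] 0) (𝓝 (∫ t, Real.log ‖t‖ • Δ ψ t)) := by
    have hb2 : Integrable fun t : ℂ => Real.log (1 + ‖t‖ ^ 2) • Δ ψ t :=
      (contDiff_log_add_normSq (n := 2) one_pos).continuous.locallyIntegrable
        |>.integrable_smul_right_of_hasCompactSupport hΔ hΔc
    refine tendsto_integral_filter_of_dominated_convergence
      (fun t => ‖Real.log ‖t‖ • Δ ψ t‖ + ‖Real.log (1 + ‖t‖ ^ 2) • Δ ψ t‖) ?_ ?_
      (hlog.norm.add hb2.norm) ?_
    · filter_upwards [self_mem_nhdsWithin] with ε hε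
      exact ((hL ε hε).continuous.smul hΔ).aestronglyMeasurable
    · have h1 : ∀ᶠ ε : ℝ in 𝓝[>] 0, ε < 1 := mem_nhdsWithin_of_mem_nhds (Iio_mem_nhds one_pos)
      filter_upwards [self_mem_nhdsWithin, h1] with ε (hε : 0 < ε) hε1
      filter_upwards [Measure.ae_ne volume 0] with t ht
      have ht' : 0 < ‖t‖ := norm_pos_iff.2 ht
      rw [norm_smul, norm_smul, norm_smul, ← add_mul]
      refine mul_le_mul_of_nonneg_right ?_ (norm_nonneg _)
      have l1 : 2 * Real.log ‖t‖ ≤ Real.log (ε ^ 2 + ‖t‖ ^ 2) := by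
        rw [← Nat.cast_two, ← Real.log_pow]
        exact Real.log_le_log (by positivity) (by nlinarith)
      have l2 : Real.log (ε ^ 2 + ‖t‖ ^ 2) ≤ Real.log (1 + ‖t‖ ^ 2) :=
        Real.log_le_log (by positivity) (by nlinarith)
      have l3 : 0 ≤ Real.log (1 + ‖t‖ ^ 2) := Real.log_nonneg (by nlinarith)
      rw [Real.norm_eq_abs, Real.norm_eq_abs, Real.norm_eq_abs, abs_of_nonneg l3, abs_le]
      have := neg_abs_le (Real.log ‖t‖)
      have := abs_nonneg (Real.log ‖t‖)
      constructor <;> linarith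
    · filter_upwards [Measure.ae_ne volume 0] with t ht
      have ht' : 0 < ‖t‖ := norm_pos_iff.2 ht
      refine Tendsto.smul_const ?_ _
      have h0 : Real.log ‖t‖ = (2⁻¹ : ℝ) * Real.log (0 ^ 2 + ‖t‖ ^ 2) := by
        rw [zero_pow two_ne_zero, zero_add, Real.log_pow]; push_cast; ring
      rw [h0]
      have hcont : ContinuousAt (fun ε : ℝ => (2⁻¹ : ℝ) * Real.log (ε ^ 2 + ‖t‖ ^ 2)) 0 := by
        refine continuousAt_const.mul (ContinuousAt.log (by fun_prop) ?_)
        positivity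
      exact hcont.tendsto.mono_left nhdsWithin_le_nhds
  have lim2 : Tendsto (fun ε : ℝ => ∫ s : ℂ, (2 / (1 + ‖s‖ ^ 2) ^ 2 : ℝ) • ψ (ε • s))
      (𝓝[>] 0) (𝓝 ((2 * Real.pi) • ψ 0)) := by
    obtain ⟨hi, hv⟩ := integral_two_div_sq_one_add_normSq
    rw [← hv, ← integral_smul_const]
    obtain ⟨M, hM⟩ := hψ.continuous.bounded_above_of_compact_support hc
    refine tendsto_integral_filter_of_dominated_convergence
      (fun s => (2 / (1 + ‖s‖ ^ 2) ^ 2) * M) ?_ ?_ (hi.mul_const M) ?_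
    · refine .of_forall fun ε => ?_
      exact hi.aestronglyMeasurable.smul
        (hψ.continuous.comp (continuous_const_smul ε)).aestronglyMeasurable
    · refine .of_forall fun ε => .of_forall fun s => ?_
      rw [norm_smul, Real.norm_of_nonneg (by positivity)]
      exact mul_le_mul_of_nonneg_left (hM _) (by positivity)
    · refine .of_forall fun s => Tendsto.const_smul ?_ _
      have hcont : ContinuousAt (fun ε : ℝ => ψ (ε • s)) 0 :=
        (hψ.continuous.comp (continuous_id.smul continuous_const)).continuousAt
      have := hcont.tendsto
      rw [zero_smul] at this
      exact this.mono_left nhdsWithin_le_nhds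
  refine tendsto_nhds_unique lim1 (lim2.congr' ?_)
  filter_upwards [self_mem_nhdsWithin] with ε hε
  exact (hgreen ε hε).symm

/-- `log ‖t - t₀‖ / 2π` is a fundamental solution with pole `t₀`. -/
lemma integral_log_norm_smul_laplacian {ψ : ℂ → ℂ} (hψ : ContDiff ℝ 2 ψ)
    (hc : HasCompactSupport ψ) (t₀ : ℂ) :
    Integrable (fun t => Real.log ‖t - t₀‖ • Δ ψ t) ∧
      ∫ t, Real.log ‖t - t₀‖ • Δ ψ t = (2 * Real.pi) • ψ t₀ := by
  have hΔ : ∀ t, Δ (fun s => ψ (s + t₀)) t = Δ ψ (t + t₀) := by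
    intro t
    have := laplacian_comp_analyticAt (h := fun s : ℂ => s + t₀) (t := t) (f := ψ)
      (by fun_prop) hψ.contDiffAt
    have h1 : deriv (fun s : ℂ => s + t₀) t = 1 := by simp
    rw [h1] at this
    simpa [Function.comp_def] using this
  have h := integral_log_norm_smul_laplacian_zero (ψ := fun s => ψ (s + t₀))
    (hψ.comp (contDiff_id.add contDiff_const))
    (hc.comp_homeomorph (Homeomorph.addRight t₀))
  simp only [hΔ, zero_add] at h
  constructor
  · have := h.1.comp_sub_right t₀
    simpa using this
  · rw [← h.2, ← integral_add_right_eq_self _ t₀]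
    simp

end Plane

namespace HyperellipticEquation

variable {g : ℕ} {E : HyperellipticEquation g}

/-! ### The curve as a compact real surface -/

lemma isCompact_planeCurve_unit (p : ℂ[X]) : IsCompact {q : PlaneCurve p | ‖q.1.1‖ ≤ 1} := by
  have hcl : IsClosed {q : ℂ × ℂ | q.2 ^ 2 = p.eval q.1} :=
    isClosed_eq (continuous_snd.pow 2) (p.continuous.comp continuous_fst)
  obtain ⟨M, hM⟩ := ((isCompact_closedBall (0 : ℂ) 1).image p.continuous).isBounded.exists_norm_le
  have hK := hcl.isClosedEmbedding_subtypeVal.isCompact_preimage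
    ((isCompact_closedBall (0 : ℂ) 1).prod (isCompact_closedBall (0 : ℂ) (1 + M)))
  convert! hK using 1
  ext q
  simp only [mem_ofPred_eq, mem_preimage, mem_prod, mem_closedBall_zero_iff]
  refine ⟨fun h => ⟨h, ?_⟩, fun h => h.1⟩
  have h1 : ‖q.1.2‖ ^ 2 ≤ M := by
    rw [← norm_pow, q.2]
    exact hM _ (mem_image_of_mem _ (mem_closedBall_zero_iff.2 h))
  nlinarith [norm_nonneg q.1.2, sq_nonneg (‖q.1.2‖ - 1)]

instance : CompactSpace E.Curve := by
  refine ⟨?_⟩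
  have h := ((isCompact_planeCurve_unit E.f).image isOpenEmbedding_ofAffine.continuous).union
    ((isCompact_planeCurve_unit E.fInf).image isOpenEmbedding_ofInfinity.continuous)
  convert! h using 1
  refine (eq_univ_of_forall fun P => ?_).symm
  rcases P with ⟨a, b, h⟩ | ⟨w, h⟩
  · by_cases ha : ‖a‖ ≤ 1
    · exact .inl ⟨⟨(a, b), h⟩, ha, rfl⟩
    · have ha0 : a ≠ 0 := by rintro rfl; simp at ha
      obtain ⟨q, hq, hq'⟩ := exists_ofInfinity ⟨(a, b), h⟩ ha0
      refine .inr ⟨q, ?_, hq.symm⟩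
      simp only [mem_ofPred_eq, hq', norm_inv]
      exact inv_le_one_of_one_le₀ (le_of_not_ge ha)
  · exact .inr ⟨⟨(0, w), h⟩, by simp, by simp [ofInfinity]⟩

lemma separated_of_range {Y : Type*} [TopologicalSpace Y] [T2Space Y] {j : Y → E.Curve}
    (hj : IsOpenEmbedding j) {a b : Y} (hab : j a ≠ j b) :
    ∃ U V : Set E.Curve, IsOpen U ∧ IsOpen V ∧ j a ∈ U ∧ j b ∈ V ∧ Disjoint U V := by
  obtain ⟨U, V, hU, hV, ha, hb, hd⟩ := t2_separation (ne_of_apply_ne j hab)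
  exact ⟨_, _, hj.isOpenMap _ hU, hj.isOpenMap _ hV, mem_image_of_mem _ ha, mem_image_of_mem _ hb,
    (disjoint_image_iff hj.injective).2 hd⟩

/-- A point with `x = 0` and a point at infinity are separated by `|x| < 1` and `|z| < 1`. -/
lemma separated_zero_infinity (b : ℂ) (h : b ^ 2 = E.f.eval 0) (w : ℂ) (h' : w ^ 2 = E.fInf.eval 0) :
    ∃ U V : Set E.Curve, IsOpen U ∧ IsOpen V ∧ .affine 0 b h ∈ U ∧ .infinity w h' ∈ V ∧
      Disjoint U V := by
  have ho : ∀ p : ℂ[X], IsOpen {q : PlaneCurve p | ‖q.1.1‖ < 1} := fun p =>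
    isOpen_lt (continuous_norm.comp (continuous_fst.comp continuous_subtype_val)) continuous_const
  refine ⟨_, _, isOpenEmbedding_ofAffine.isOpenMap _ (ho E.f),
    isOpenEmbedding_ofInfinity.isOpenMap _ (ho E.fInf), ⟨⟨(0, b), h⟩, by simp, rfl⟩,
    ⟨⟨(0, w), h'⟩, by simp, by simp [ofInfinity]⟩, ?_⟩
  rw [Set.disjoint_left]
  rintro _ ⟨p, hp, rfl⟩ ⟨q, hq, hpq⟩
  obtain ⟨h0, h1⟩ := ofAffine_eq_ofInfinity_iff.1 hpq.symm
  simp only [mem_ofPred_eq, h1, norm_inv] at hp hq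
  exact absurd hq (not_lt.2 (by
    by_contra hlt
    exact absurd hp (not_lt.2 ((one_le_inv₀ (norm_pos_iff.2 h0)).2 (not_le.1 hlt).le))))

instance : T2Space E.Curve := by
  refine ⟨fun P Q hPQ => ?_⟩
  rcases P with ⟨a, b, h⟩ | ⟨w, h⟩ <;> rcases Q with ⟨a', b', h'⟩ | ⟨w', h'⟩
  · exact separated_of_range isOpenEmbedding_ofAffine (a := ⟨(a, b), h⟩) (b := ⟨(a', b'), h'⟩) hPQ
  · by_cases ha : a = 0
    · subst ha
      exact separated_zero_infinity b h w' h'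
    · obtain ⟨q, hq, -⟩ := exists_ofInfinity ⟨(a, b), h⟩ ha
      have e1 : Curve.affine a b h = ofInfinity q := hq
      have e2 : Curve.infinity w' h' = ofInfinity ⟨(0, w'), h'⟩ := by simp [ofInfinity]
      rw [e1, e2] at hPQ ⊢
      exact separated_of_range isOpenEmbedding_ofInfinity hPQ
  · by_cases ha : a' = 0
    · subst ha
      obtain ⟨U, V, hU, hV, h1, h2, hd⟩ := separated_zero_infinity b' h' w h
      exact ⟨V, U, hV, hU, h2, h1, hd.symm⟩
    · obtain ⟨q, hq, -⟩ := exists_ofInfinity ⟨(a', b'), h'⟩ ha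
      have e1 : Curve.affine a' b' h' = ofInfinity q := hq
      have e2 : Curve.infinity w h = ofInfinity ⟨(0, w), h⟩ := by simp [ofInfinity]
      rw [e1, e2] at hPQ ⊢
      exact separated_of_range isOpenEmbedding_ofInfinity hPQ
  · have e1 : Curve.infinity w h = ofInfinity ⟨(0, w), h⟩ := by simp [ofInfinity]
    have e2 : Curve.infinity w' h' = ofInfinity ⟨(0, w'), h'⟩ := by simp [ofInfinity]
    rw [e1, e2] at hPQ ⊢
    exact separated_of_range isOpenEmbedding_ofInfinity hPQ

/-- The transition map from the chart at `P` to the chart at `Q` is analytic. -/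
lemma analyticAt_transition (P Q : E.Curve) {t : ℂ} (ht : t ∈ (chartAt ℂ P).target)
    (hQ : (chartAt ℂ P).symm t ∈ (chartAt ℂ Q).source) :
    AnalyticAt ℂ (fun s => chartAt ℂ Q ((chartAt ℂ P).symm s)) t :=
  ContDiffAt.analyticAt (contDiffAt_transition P Q ht hQ)

instance : IsManifold 𝓘(ℝ, ℂ) ∞ E.Curve := by
  refine isManifold_of_contDiffOn _ _ _ ?_
  rintro _ _ ⟨P, rfl⟩ ⟨Q, rfl⟩
  intro t ht
  simp only [modelWithCornersSelf_coe_symm, modelWithCornersSelf_coe, preimage_id, range_id,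
    inter_univ] at ht
  exact (((contDiffAt_transition P Q ht.1 ht.2).restrict_scalars ℝ).of_le
    (by simp)).contDiffWithinAt

/-! ### The holomorphic forms in the charts -/

/-- On `C₀`, if `dx/y = θ dt` in the sense that `dx = y θ dt` and `2 dy = f'(x) θ dt`, then
`x^i dx/y = x^i θ dt`, at branch points too. -/
lemma formCoeff_affine {γ : ℂ → E.Curve} {t a b θ : ℂ} {h : b ^ 2 = E.f.eval a}
    (hγ : γ t = .affine a b h) (hx : deriv (fun s => xCoord (γ s)) t = θ * b)
    (hy : 2 * deriv (fun s => yCoord (γ s)) t = θ * E.f.derivative.eval a) (i : ℕ) :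
    formCoeff i γ t = a ^ i * θ := by
  simp only [formCoeff, hγ]
  split_ifs with hb
  · have : E.f.derivative.eval a ≠ 0 := E.derivative_f_ne_zero (by rw [← h, hb]; simp)
    rw [hy, mul_div_assoc, div_self this, mul_one]
  · rw [hx, mul_div_assoc, div_self hb, mul_one]

lemma eval_derivative_fInf {z : ℂ} (hz : z ≠ 0) :
    E.fInf.derivative.eval z = (2 * g + 2) * E.f.eval z⁻¹ * z ^ (2 * g + 1) -
      E.f.derivative.eval z⁻¹ * z ^ (2 * g) := by
  have h1 := E.fInf.hasDerivAt z
  have h2 : HasDerivAt (fun z => E.f.eval z⁻¹ * z ^ (2 * g + 2)) _ z :=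
    ((E.f.hasDerivAt z⁻¹).comp z (hasDerivAt_inv hz)).mul (hasDerivAt_pow (2 * g + 2) z)
  have h3 : (fun z => E.fInf.eval z) =ᶠ[𝓝 z] fun z => E.f.eval z⁻¹ * z ^ (2 * g + 2) := by
    filter_upwards [isOpen_ne.mem_nhds hz] with s hs
    exact E.eval_fInf s hs
  rw [h1.unique (h2.congr_of_eventuallyEq h3)]
  simp only [Function.comp_apply, Nat.add_succ_sub_one]
  push_cast
  field_simp
  ring

lemma yCoord_eq_of_zCoord_ne_zero {R : E.Curve} (h : zCoord R ≠ 0) :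
    yCoord R = wCoord R / zCoord R ^ (g + 1) := by
  rcases R with ⟨a, b, hab⟩ | ⟨w, hw⟩
  · have ha : a ≠ 0 := by simpa [zCoord] using h
    simp only [yCoord, wCoord, zCoord, inv_pow]
    field_simp
  · simp [zCoord] at h

/-- On `C₀'`, if `dz/w = η dt`, then `x^i dx/y = -z^(g-1-i) η dt`. -/
lemma formCoeff_infinity {γ : ℂ → E.Curve} {t η w' : ℂ} {q : PlaneCurve E.fInf}
    (hγ : γ t = ofInfinity q) (hz : HasDerivAt (fun s => zCoord (γ s)) (η * q.1.2) t)
    (hw : HasDerivAt (fun s => wCoord (γ s)) w' t)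
    (hw' : 2 * w' = η * E.fInf.derivative.eval q.1.1) {i : ℕ} (hi : i < g) :
    formCoeff i γ t = -(q.1.1 ^ (g - 1 - i) * η) := by
  have hzt : zCoord (γ t) = q.1.1 := by rw [hγ, zCoord_ofInfinity]
  have hwt : wCoord (γ t) = q.1.2 := by rw [hγ, wCoord_ofInfinity]
  by_cases h0 : q.1.1 = 0
  · have hγ' : γ t = .infinity q.1.2 (by rw [q.2, h0]) := by rw [hγ]; simp [ofInfinity, h0]
    simp only [formCoeff, hγ']
    rw [h0] at hw' ⊢
    split_ifs with hb
    · have : E.fInf.derivative.eval 0 ≠ 0 := by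
        have h2 : q.1.2 ^ 2 = E.fInf.eval 0 := by rw [q.2, h0]
        exact E.derivative_fInf_ne_zero (by rw [← h2, hb]; simp)
      rw [hw.deriv, hw', mul_div_assoc, div_self this]; ring
    · rw [hz.deriv, mul_div_assoc, div_self hb]; ring
  · have hx : ∀ s, xCoord (γ s) = (zCoord (γ s))⁻¹ := by
      intro s
      rcases γ s with ⟨a, b, h⟩ | ⟨w, h⟩ <;> simp [xCoord, zCoord]
    have hy : ∀ᶠ s in 𝓝 t, yCoord (γ s) = wCoord (γ s) / zCoord (γ s) ^ (g + 1) := by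
      filter_upwards [hz.continuousAt.eventually_ne (by rwa [hzt])] with s hs
      exact yCoord_eq_of_zCoord_ne_zero hs
    have hγ' : γ t = .affine (q.1.1)⁻¹ (q.1.2 / q.1.1 ^ (g + 1)) (by
        have := E.eval_fInf _ h0
        rw [← q.2] at this
        rw [div_pow, this, ← pow_mul, show (g + 1) * 2 = 2 * g + 2 by ring]
        exact mul_div_cancel_right₀ _ (pow_ne_zero _ h0)) := by
      rw [hγ]; simp [ofInfinity, h0]
    obtain ⟨k, rfl⟩ : ∃ k, g = i + 1 + k := ⟨g - (i + 1), by omega⟩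
    have hsq : q.1.2 ^ 2 = E.f.eval (q.1.1)⁻¹ * q.1.1 ^ (2 * (i + 1 + k) + 2) := by
      rw [q.2, E.eval_fInf _ h0]
    rw [formCoeff_affine hγ' (θ := -(η * q.1.1 ^ (i + k)))]
    · have : i + 1 + k - 1 - i = k := by omega
      rw [this, inv_pow]
      field_simp
      ring
    · have := (hz.inv (by rwa [hzt])).congr_of_eventuallyEq (.of_forall hx)
      rw [this.deriv, hzt]
      field_simp
      ring
    · have hzne : (fun s => zCoord (γ s)) t ≠ 0 := by simp only [hzt]; exact h0
      have := (hw.div (hz.pow (i + 1 + k + 1)) (pow_ne_zero _ hzne))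
        |>.congr_of_eventuallyEq hy
      rw [this.deriv]
      simp only [Pi.pow_apply, hzt, hwt, Nat.add_one_sub_one]
      have e1 := eval_derivative_fInf (E := E) h0
      rw [e1] at hw'
      have e2 : 2 * ((w' * q.1.1 ^ (i + 1 + k + 1) - q.1.2 * (((i + 1 + k + 1 : ℕ) : ℂ) *
          q.1.1 ^ (i + 1 + k) * (η * q.1.2))) / (q.1.1 ^ (i + 1 + k + 1)) ^ 2) =
          ((2 * w') * q.1.1 ^ (i + 1 + k + 1) - 2 * q.1.2 ^ 2 * (((i + 1 + k + 1 : ℕ) : ℂ) *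
          q.1.1 ^ (i + 1 + k) * η)) / (q.1.1 ^ (i + 1 + k + 1)) ^ 2 := by ring
      rw [e2, hw', hsq]
      push_cast
      field_simp
      ring

lemma formCoeff_congr {γ γ' : ℂ → E.Curve} {t : ℂ} (h : γ =ᶠ[𝓝 t] γ') (i : ℕ) :
    formCoeff i γ t = formCoeff i γ' t := by
  have hx := (h.fun_comp xCoord).deriv_eq
  have hy := (h.fun_comp yCoord).deriv_eq
  have hz := (h.fun_comp zCoord).deriv_eq
  have hw := (h.fun_comp wCoord).deriv_eq
  simp only [Function.comp_def] at hx hy hz hw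
  simp only [formCoeff, h.eq_of_nhds, hx, hy, hz, hw]

/-- The forms `x^i dx/y` transform by the chain rule under a change of parameter. -/
lemma formCoeff_comp (Q : E.Curve) {h : ℂ → ℂ} {t : ℂ} (hh : DifferentiableAt ℂ h t)
    (ht : h t ∈ (chartAt ℂ Q).target) (i : ℕ) :
    formCoeff i (fun s => (chartAt ℂ Q).symm (h s)) t =
      formCoeff i (chartAt ℂ Q).symm (h t) * deriv h t := by
  have hc := contDiffAt_coord Q ht
  have comp : ∀ c : E.Curve → ℂ, ContDiffAt ℂ ω (fun s => c ((chart Q).symm s)) (h t) →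
      deriv (fun s => c ((chartAt ℂ Q).symm (h s))) t =
        deriv (fun s => c ((chartAt ℂ Q).symm s)) (h t) * deriv h t := fun c hc =>
    deriv_comp t (h₂ := fun s => c ((chartAt ℂ Q).symm s)) (hc.differentiableAt (by simp)) hh
  rcases hQ : (chartAt ℂ Q).symm (h t) with ⟨a, b, hab⟩ | ⟨w, hw⟩
  · have hr : (chart Q).symm (h t) ∈ range (ofAffine (E := E)) := ⟨⟨(a, b), hab⟩, hQ.symm⟩
    simp only [formCoeff, hQ, comp _ (hc.1 hr).1, comp _ (hc.1 hr).2]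
    split_ifs <;> ring
  · have hr : (chart Q).symm (h t) ∈ range (ofInfinity (E := E)) :=
      ⟨⟨(0, w), hw⟩, by rw [show (chart Q).symm (h t) = _ from hQ]; simp [ofInfinity]⟩
    simp only [formCoeff, hQ, comp _ (hc.2 hr).1, comp _ (hc.2 hr).2]
    split_ifs <;> ring

/-- The density of the canonical metric is multiplied by `|h'|²` under a transition map `h`. -/
lemma metricDensity_transition (P Q : E.Curve) {t : ℂ} (ht : t ∈ (chartAt ℂ P).target)
    (hQ : (chartAt ℂ P).symm t ∈ (chartAt ℂ Q).source) :
    metricDensity P t = metricDensity Q (chartAt ℂ Q ((chartAt ℂ P).symm t)) *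
      ‖deriv (fun s => chartAt ℂ Q ((chartAt ℂ P).symm s)) t‖ ^ 2 := by
  have hev : (chartAt ℂ P).symm =ᶠ[𝓝 t]
      fun s => (chartAt ℂ Q).symm (chartAt ℂ Q ((chartAt ℂ P).symm s)) := by
    filter_upwards [((chartAt ℂ P).continuousAt_symm ht).eventually
      ((chartAt ℂ Q).open_source.mem_nhds hQ)] with s hs
    exact ((chartAt ℂ Q).left_inv hs).symm
  simp only [metricDensity, Finset.sum_mul]
  refine Finset.sum_congr rfl fun i _ => ?_
  rw [formCoeff_congr hev, formCoeff_comp Q (analyticAt_transition P Q ht hQ).differentiableAt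
    ((chartAt ℂ Q).map_source hQ), norm_mul, mul_pow]

/-! ### The charts of a plane curve -/

/-- The properties of the chart `e` of the curve `y² = p(x)` about its point `q` that are common to
the coordinates `x` and `y`: there is a nonvanishing holomorphic `θ` with `dx/y = θ dt` and
`2 dy = p'(x) θ dt`, and `x - x(q)` vanishes at `q` to the first or second order according to
whether `q` is a branch point. -/
structure IsPlaneChartAt {p : ℂ[X]} (e : OpenPartialHomeomorph (PlaneCurve p) ℂ)
    (q : PlaneCurve p) : Prop where
  holInverse : HolInverse e
  mem_source : q ∈ e.source
  form : ∃ θ : ℂ → ℂ, ∀ t ∈ e.target, AnalyticAt ℂ θ t ∧ θ t ≠ 0 ∧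
    deriv (fun s => (e.symm s).1.1) t = θ t * (e.symm t).1.2 ∧
    2 * deriv (fun s => (e.symm s).1.2) t = θ t * p.derivative.eval (e.symm t).1.1
  order : ∃ u : ℂ → ℂ, AnalyticAt ℂ u (e q) ∧ u (e q) ≠ 0 ∧
    ∀ᶠ t in 𝓝 (e q),
      (e.symm t).1.1 - q.1.1 = (t - e q) ^ (if q.1.2 = 0 then 2 else 1) * u t

lemma HolInverse.deriv_eq {p : ℂ[X]} {e : OpenPartialHomeomorph (PlaneCurve p) ℂ}
    (he : HolInverse e) {t : ℂ} (ht : t ∈ e.target) :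
    2 * (e.symm t).1.2 * deriv (fun s => (e.symm s).1.2) t =
      p.derivative.eval (e.symm t).1.1 * deriv (fun s => (e.symm s).1.1) t := by
  obtain ⟨h1, h2⟩ := he t ht
  have d1 := (h1.differentiableAt (by simp)).hasDerivAt
  have d2 := (h2.differentiableAt (by simp)).hasDerivAt
  have e1 := d2.pow 2
  have e2 := (p.hasDerivAt (e.symm t).1.1).comp t d1
  have : (fun s => (e.symm s).1.2) ^ 2 = (fun x => p.eval x) ∘ fun s => (e.symm s).1.1 := by
    ext s; exact (e.symm s).2
  rw [this] at e1
  simpa using e1.unique e2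

lemma isPlaneChartAt_chartFst (p : ℂ[X]) (q : PlaneCurve p)
    (hb : (X ^ 2 : ℂ[X]).derivative.eval q.1.2 ≠ 0) :
    IsPlaneChartAt (chartFst p q.1.2 hb) q := by
  have hol := holInverse_chartFst p q.1.2 hb
  have hX : ∀ t ∈ (chartFst p q.1.2 hb).target, ((chartFst p q.1.2 hb).symm t).1.1 = t :=
    fun t ht => (chartFst p q.1.2 hb).right_inv ht
  have hq : q ∈ (chartFst p q.1.2 hb).source := mem_localHomeo_source (X ^ 2) q.1.2 hb
  refine ⟨hol, hq, ⟨fun t => (((chartFst p q.1.2 hb).symm t).1.2)⁻¹, fun t ht => ?_⟩,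
    ⟨fun _ => 1, analyticAt_const, one_ne_zero, ?_⟩⟩
  · have hs : (chartFst p q.1.2 hb).symm t ∈ (chartFst p q.1.2 hb).source :=
      (chartFst p q.1.2 hb).map_target ht
    have hne : ((chartFst p q.1.2 hb).symm t).1.2 ≠ 0 := by
      have : (X ^ 2 : ℂ[X]).derivative.eval ((chartFst p q.1.2 hb).symm t).1.2 ≠ 0 :=
        derivative_ne_zero_of_mem hs
      simpa using this
    have hd : deriv (fun s => ((chartFst p q.1.2 hb).symm s).1.1) t = 1 := by
      have : (fun s => ((chartFst p q.1.2 hb).symm s).1.1) =ᶠ[𝓝 t] id := by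
        filter_upwards [(chartFst p q.1.2 hb).open_target.mem_nhds ht] with s hs using hX s hs
      rw [this.deriv_eq]; simp
    have he := hol.deriv_eq ht
    rw [hd] at he
    refine ⟨(hol t ht).2.analyticAt.inv hne, inv_ne_zero hne, ?_, ?_⟩
    · rw [hd, inv_mul_cancel₀ hne]
    · field_simp
      linear_combination he
  · have h0 : q.1.2 ≠ 0 := by simpa using hb
    filter_upwards [(chartFst p q.1.2 hb).open_target.mem_nhds
      ((chartFst p q.1.2 hb).map_source hq)] with t ht
    rw [hX t ht, if_neg h0, pow_one, mul_one]
    rfl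

lemma isPlaneChartAt_chartSnd (p : ℂ[X]) (q : PlaneCurve p) (hq0 : q.1.2 = 0)
    (ha : p.derivative.eval q.1.1 ≠ 0) :
    IsPlaneChartAt (chartSnd p q.1.1 ha) q := by
  have hol := holInverse_chartSnd p q.1.1 ha
  have hY : ∀ t ∈ (chartSnd p q.1.1 ha).target, ((chartSnd p q.1.1 ha).symm t).1.2 = t :=
    fun t ht => (chartSnd p q.1.1 ha).right_inv ht
  have hq : q ∈ (chartSnd p q.1.1 ha).source := mem_localHomeo_source p q.1.1 ha
  have hqt := (chartSnd p q.1.1 ha).map_source hq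
  refine ⟨hol, hq, ⟨fun t => 2 / p.derivative.eval ((chartSnd p q.1.1 ha).symm t).1.1,
    fun t ht => ?_⟩, ?_⟩
  · have hs : (chartSnd p q.1.1 ha).symm t ∈ (chartSnd p q.1.1 ha).source :=
      (chartSnd p q.1.1 ha).map_target ht
    have hne : p.derivative.eval ((chartSnd p q.1.1 ha).symm t).1.1 ≠ 0 :=
      derivative_ne_zero_of_mem hs
    have hd : deriv (fun s => ((chartSnd p q.1.1 ha).symm s).1.2) t = 1 := by
      have : (fun s => ((chartSnd p q.1.1 ha).symm s).1.2) =ᶠ[𝓝 t] id := by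
        filter_upwards [(chartSnd p q.1.1 ha).open_target.mem_nhds ht] with s hs using hY s hs
      rw [this.deriv_eq]; simp
    have he := hol.deriv_eq ht
    rw [hd] at he
    refine ⟨analyticAt_const.div ?_ hne, div_ne_zero two_ne_zero hne, ?_, ?_⟩
    · exact (((contDiff_eval p.derivative).contDiffAt).comp t (hol t ht).1).analyticAt
    · field_simp
      linear_combination -he
    · rw [hd]
      field_simp
  · -- `t² = p(x) = (x - a) r(x)` with `r(a) ≠ 0`
    have hroot : p.IsRoot q.1.1 := by rw [IsRoot, ← q.2, hq0]; simp
    obtain ⟨r, hr⟩ := dvd_iff_isRoot.2 hroot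
    have hr0 : r.eval q.1.1 ≠ 0 := by
      have := congrArg (fun r => r.derivative.eval q.1.1) hr
      simp only [derivative_mul, derivative_X_sub_C, eval_add, eval_mul, eval_sub, eval_X, eval_C,
        sub_self, zero_mul, add_zero, one_mul] at this
      rwa [← this]
    have hleft : (chartSnd p q.1.1 ha).symm (chartSnd p q.1.1 ha q) = q :=
      (chartSnd p q.1.1 ha).left_inv hq
    have hq1 : chartSnd p q.1.1 ha q = 0 := hq0
    have han : AnalyticAt ℂ (fun t => r.eval ((chartSnd p q.1.1 ha).symm t).1.1)
        (chartSnd p q.1.1 ha q) :=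
      (((contDiff_eval r).contDiffAt).comp _ (hol _ hqt).1).analyticAt
    have hne : r.eval ((chartSnd p q.1.1 ha).symm (chartSnd p q.1.1 ha q)).1.1 ≠ 0 := by
      rwa [hleft]
    refine ⟨fun t => (r.eval ((chartSnd p q.1.1 ha).symm t).1.1)⁻¹, han.inv hne,
      inv_ne_zero hne, ?_⟩
    filter_upwards [(chartSnd p q.1.1 ha).open_target.mem_nhds hqt,
      han.continuousAt.eventually_ne hne] with t ht hrt
    rw [if_pos hq0, hq1, sub_zero, eq_mul_inv_iff_mul_eq₀ hrt]
    have h2 := ((chartSnd p q.1.1 ha).symm t).2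
    rw [hY t ht] at h2
    rw [h2]
    have h3 := congrArg (Polynomial.eval ((chartSnd p q.1.1 ha).symm t).1.1) hr
    rw [h3]
    simp

/-- Every preferred chart of the curve comes from a chart of `C₀`, or from one of `C₀'` about a
point at infinity. -/
lemma chart_eq_lift (Q : E.Curve) :
    (∃ (q : PlaneCurve E.f) (e : OpenPartialHomeomorph (PlaneCurve E.f) ℂ),
      IsPlaneChartAt e q ∧ Q = ofAffine q ∧
      chartAt ℂ Q = e.lift_openEmbedding isOpenEmbedding_ofAffine) ∨
    (∃ (q : PlaneCurve E.fInf) (e : OpenPartialHomeomorph (PlaneCurve E.fInf) ℂ),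
      IsPlaneChartAt e q ∧ q.1.1 = 0 ∧ Q = ofInfinity q ∧
      chartAt ℂ Q = e.lift_openEmbedding isOpenEmbedding_ofInfinity) := by
  rcases Q with ⟨a, b, h⟩ | ⟨w, h⟩
  · left
    by_cases hb : b = 0
    · exact ⟨⟨(a, b), h⟩, _, isPlaneChartAt_chartSnd E.f ⟨(a, b), h⟩ hb
        (E.derivative_f_ne_zero (by rw [← h, hb]; simp)), rfl, dif_pos hb⟩
    · exact ⟨⟨(a, b), h⟩, _, isPlaneChartAt_chartFst E.f ⟨(a, b), h⟩ (derivative_sq_ne_zero hb),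
        rfl, dif_neg hb⟩
  · right
    by_cases hw : w = 0
    · exact ⟨⟨(0, w), h⟩, _, isPlaneChartAt_chartSnd E.fInf ⟨(0, w), h⟩ hw
        (E.derivative_fInf_ne_zero (by rw [← h, hw]; simp)), rfl, by simp [ofInfinity],
        dif_pos hw⟩
    · exact ⟨⟨(0, w), h⟩, _, isPlaneChartAt_chartFst E.fInf ⟨(0, w), h⟩
        (derivative_sq_ne_zero hw), rfl, by simp [ofInfinity], dif_neg hw⟩

/-! ### The functions `F_P` and `F_W` in the two affine parts -/

/-- `σ(t) = 1 + t + ⋯ + t ^ (g - 1)`. -/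
noncomputable def sigmaSum (g : ℕ) (t : ℝ) : ℝ := ∑ i ∈ Finset.range g, t ^ i

lemma sigmaSum_pos (hg : 2 ≤ g) {t : ℝ} (ht : 0 ≤ t) : 0 < sigmaSum g t := by
  refine Finset.sum_pos' (fun i _ => pow_nonneg ht i) ⟨0, ?_, by simp⟩
  simp; omega

lemma sigmaSum_inv {t : ℝ} (ht : 0 < t) : sigmaSum g t⁻¹ * t ^ (g - 1) = sigmaSum g t := by
  rw [sigmaSum, sigmaSum, Finset.sum_mul, ← Finset.sum_range_reflect]
  refine Finset.sum_congr rfl fun i hi => ?_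
  have hi := Finset.mem_range.1 hi
  obtain ⟨k, hk⟩ : ∃ k, g - 1 = i + k := ⟨g - 1 - i, by omega⟩
  rw [hk, show i + k - i = k by omega, pow_add, inv_pow]
  field_simp

lemma weight_eq (t : ℝ) :
    weight g t = (sigmaSum g t * (1 + t) ^ 2) ^ (1 / (2 * g + 2) : ℝ) := rfl

lemma weight_pos (hg : 2 ≤ g) {t : ℝ} (ht : 0 ≤ t) : 0 < weight g t := by
  have := sigmaSum_pos hg ht
  rw [weight_eq]; positivity

lemma weight_zero (hg : 2 ≤ g) : weight g 0 = 1 := by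
  have : sigmaSum g 0 = 1 := by
    rw [sigmaSum, Finset.sum_eq_single 0] <;> simp
    omega
  simp [weight_eq, this]

lemma weight_pow (hg : 2 ≤ g) {t : ℝ} (ht : 0 ≤ t) :
    weight g t ^ (2 * g + 2) = sigmaSum g t * (1 + t) ^ 2 := by
  have := sigmaSum_pos hg ht
  rw [weight_eq, ← Real.rpow_natCast, ← Real.rpow_mul (by positivity)]
  push_cast
  rw [one_div_mul_cancel (by positivity), Real.rpow_one]

lemma log_weight (hg : 2 ≤ g) {t : ℝ} (ht : 0 ≤ t) :
    Real.log (weight g t) =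
      (2 * g + 2 : ℝ)⁻¹ * (Real.log (sigmaSum g t) + 2 * Real.log (1 + t)) := by
  have := sigmaSum_pos hg ht
  rw [weight_eq, Real.log_rpow (by positivity), Real.log_mul this.ne' (by positivity),
    Real.log_pow]
  push_cast
  ring

lemma weight_inv_sq (hg : 2 ≤ g) {r : ℝ} (hr : 0 < r) :
    weight g (r⁻¹ ^ 2) = weight g (r ^ 2) / r := by
  have h1 := weight_pos hg (sq_nonneg r)
  have h2 := weight_pos hg (sq_nonneg r⁻¹)
  have hn : 2 * g + 2 ≠ 0 := by omega
  refine (pow_left_inj₀ h2.le (by positivity) hn).1 ?_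
  rw [div_pow, weight_pow hg (by positivity), weight_pow hg (by positivity),
    ← sigmaSum_inv (g := g) (t := r ^ 2) (by positivity), inv_pow]
  obtain ⟨k, rfl⟩ : ∃ k, g = k + 1 := ⟨g - 1, by omega⟩
  rw [Nat.add_sub_cancel]
  field_simp
  ring

/-- The affine function `ℓ` with `F_P = |ℓ(x)| / N(|x|²)` on `C₀`. -/
noncomputable def affineLine : E.Curve → ℂ → ℂ
  | .affine a _ _ => fun x => x - a
  | .infinity _ _ => fun _ => 1

/-- The affine function `ℓ` with `F_P = |ℓ(z)| / N(|z|²)` on `C₀'`. -/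
noncomputable def infinityLine : E.Curve → ℂ → ℂ
  | .affine a _ _ => fun z => 1 - z * a
  | .infinity _ _ => fun z => z

lemma differentiable_affineLine (P : E.Curve) : Differentiable ℂ (affineLine P) := by
  rcases P with ⟨a, b, h⟩ | ⟨w, h⟩
  · exact differentiable_id.sub_const a
  · exact differentiable_const _

lemma differentiable_infinityLine (P : E.Curve) : Differentiable ℂ (infinityLine P) := by
  rcases P with ⟨a, b, h⟩ | ⟨w, h⟩
  · exact (differentiable_id.mul_const a).const_sub 1
  · exact differentiable_id

lemma FPoint_ofAffine (P : E.Curve) (q : PlaneCurve E.f) :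
    FPoint P (ofAffine q) = ‖affineLine P q.1.1‖ / weight g (‖q.1.1‖ ^ 2) := by
  rcases P with ⟨a, b, h⟩ | ⟨w, h⟩ <;> simp [FPoint, ofAffine, affineLine]

lemma FPoint_ofInfinity (hg : 2 ≤ g) (P : E.Curve) (q : PlaneCurve E.fInf) :
    FPoint P (ofInfinity q) = ‖infinityLine P q.1.1‖ / weight g (‖q.1.1‖ ^ 2) := by
  by_cases h0 : q.1.1 = 0
  · rcases P with ⟨a, b, h⟩ | ⟨w, h⟩ <;> simp [FPoint, ofInfinity, infinityLine, h0]
  · have hp : 0 < ‖q.1.1‖ := norm_pos_iff.2 h0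
    have hw := weight_pos hg (sq_nonneg ‖q.1.1‖)
    rcases P with ⟨a, b, h⟩ | ⟨w, h⟩
    · simp only [FPoint, ofInfinity, infinityLine, h0, dite_false]
      rw [norm_inv, weight_inv_sq hg hp, show q.1.1⁻¹ - a = (1 - q.1.1 * a) / q.1.1 by field_simp,
        norm_div]
      field_simp
    · simp only [FPoint, ofInfinity, infinityLine, h0, dite_false]
      rw [norm_inv, weight_inv_sq hg hp]
      field_simp

lemma FPoint_involution (P Q : E.Curve) : FPoint (involution P) Q = FPoint P Q := by
  rcases P with ⟨a, b, h⟩ | ⟨w, h⟩ <;> rcases Q with ⟨a', b', h'⟩ | ⟨w', h'⟩ <;> rfl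

lemma involution_involution (P : E.Curve) : involution (involution P) = P := by
  rcases P with ⟨a, b, h⟩ | ⟨w, h⟩ <;> simp [involution]

/-- The `x`-coordinate of a point as a point of the projective line. -/
def xOption : E.Curve → Option ℂ
  | .affine a _ _ => some a
  | .infinity _ _ => none

lemma eval_fInf_zero : E.fInf.eval 0 = E.f.coeff (2 * g + 2) := by
  rw [← coeff_zero_eq_eval_zero, fInf, coeff_reflect, revAt_le (Nat.zero_le _), Nat.sub_zero]

lemma natDegree_eq (E : HyperellipticEquation g) :
    E.f.natDegree + (if E.fInf.eval 0 = 0 then 1 else 0) = 2 * g + 2 ∧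
      ‖E.fInf.eval 0‖ = if E.fInf.eval 0 = 0 then 0 else 1 := by
  rw [eval_fInf_zero]
  rcases E.degree with h | h
  · rw [coeff_eq_zero_of_natDegree_lt (by omega), h]; simp
  · have := E.monic.coeff_natDegree
    rw [h] at this
    rw [this, h]; simp

open Classical in
/-- The Weierstrass points are the points over the roots of `f` and, in odd degree, `∞`. -/
lemma prod_fixed (h : Option ℂ → ℝ) :
    ∏ P ∈ (finite_fixed E).toFinset, h (xOption P) =
      (if E.fInf.eval 0 = 0 then h none else 1) * ∏ a ∈ E.f.roots.toFinset, h (some a) := by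
  have hf : E.f ≠ 0 := E.monic.ne_zero
  have hfix : ∀ P : E.Curve, P ∈ (finite_fixed E).toFinset → yCoord P = 0 ∧
      (∀ w hw, P = .infinity w hw → w = 0) := by
    rintro (⟨a, b, h⟩ | ⟨w, h⟩) hP
    · have hb : b = 0 := by
        simpa [involution, neg_eq_self] using hP
      exact ⟨hb, by simp⟩
    · have hw : w = 0 := by simpa [involution, neg_eq_self] using hP
      exact ⟨rfl, by rintro _ _ ⟨⟩; exact hw⟩
  have hinj : Set.InjOn xOption ((finite_fixed E).toFinset : Set E.Curve) := by
    intro P hP P' hP' hh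
    have h1 := hfix P hP
    have h2 := hfix P' hP'
    rcases P with ⟨a, b, h⟩ | ⟨w, h⟩ <;> rcases P' with ⟨a', b', h'⟩ | ⟨w', h'⟩ <;>
      simp only [xOption, Option.some.injEq, reduceCtorEq] at hh
    · simp only [yCoord] at h1 h2
      obtain ⟨rfl, -⟩ := h1
      obtain ⟨rfl, -⟩ := h2
      subst hh; rfl
    · obtain rfl := h1.2 w h rfl
      obtain rfl := h2.2 w' h' rfl
      rfl
  have himg : (finite_fixed E).toFinset.image xOption =
      (if E.fInf.eval 0 = 0 then {none} else ∅) ∪ E.f.roots.toFinset.image some := by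
    ext o
    simp only [Finset.mem_image, Finset.mem_union, Multiset.mem_toFinset, mem_roots hf, IsRoot]
    constructor
    · rintro ⟨P, hP, rfl⟩
      have h1 := hfix P hP
      rcases P with ⟨a, b, h⟩ | ⟨w, h⟩
      · refine .inr ⟨a, ?_, rfl⟩
        simp only [yCoord] at h1
        rw [← h, h1.1]; simp
      · have hw := h1.2 w h rfl
        rw [hw] at h
        left
        rw [if_pos (by rw [← h]; simp)]; simp [xOption]
    · rintro (h | ⟨a, ha, rfl⟩)
      · split_ifs at h with h0
        · obtain rfl := Finset.mem_singleton.1 h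
          exact ⟨.infinity 0 (by rw [h0]; simp), by simp [involution], rfl⟩
        · simp at h
      · exact ⟨.affine a 0 (by rw [ha]; simp), by simp [involution], rfl⟩
  rw [← Finset.prod_image hinj (f := h), himg, Finset.prod_union, Finset.prod_image]
  · congr 1
    split_ifs <;> simp
  · simp
  · rw [Finset.disjoint_left]
    intro o ho ho'
    obtain ⟨a, -, rfl⟩ := Finset.mem_image.1 ho'
    split_ifs at ho <;> simp at ho

lemma FDiv_weierstrassDiv (Q : E.Curve) :
    FDiv (weierstrassDiv E) Q = ∏ P ∈ (finite_fixed E).toFinset, FPoint P Q := by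
  classical
  have hv : ∀ P, weierstrassDiv E P = if P ∈ (finite_fixed E).toFinset then 1 else 0 := by
    intro P
    rw [weierstrassDiv, Finsupp.finsetSum_apply]
    simp [Finsupp.single_apply]
  have hs : (weierstrassDiv E).support = (finite_fixed E).toFinset := by
    ext P
    rw [Finsupp.mem_support_iff, hv]
    split_ifs with h <;> simp_all
  rw [FDiv, Finsupp.prod, hs]
  refine Finset.prod_congr rfl fun P hP => ?_
  rw [hv, if_pos hP, zpow_one]

lemma prod_roots (x : ℂ) : ∏ a ∈ E.f.roots.toFinset, ‖x - a‖ = ‖E.f.eval x‖ := by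
  have hn : E.f.roots.Nodup := nodup_roots (PerfectField.separable_iff_squarefree.2 E.squarefree)
  have := (IsAlgClosed.splits E.f).eval_eq_prod_roots_of_monic E.monic x
  rw [this, Finset.prod, Multiset.toFinset_val, hn.dedup]
  exact (Multiset.prod_hom' E.f.roots (normHom : ℂ →*₀ ℝ) fun a => x - a)

lemma card_roots_eq : E.f.roots.toFinset.card = E.f.natDegree := by
  have hn : E.f.roots.Nodup := nodup_roots (PerfectField.separable_iff_squarefree.2 E.squarefree)
  rw [Multiset.toFinset_card_of_nodup hn]
  exact (IsAlgClosed.splits E.f).natDegree_eq_card_roots.symm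

lemma FDiv_weierstrassDiv_ofAffine (hg : 2 ≤ g) (q : PlaneCurve E.f) :
    FDiv (weierstrassDiv E) (ofAffine q) =
      ‖E.f.eval q.1.1‖ / (sigmaSum g (‖q.1.1‖ ^ 2) * (1 + ‖q.1.1‖ ^ 2) ^ 2) := by
  let h : Option ℂ → ℝ := fun o =>
    (o.elim 1 fun a => ‖q.1.1 - a‖) / weight g (‖q.1.1‖ ^ 2)
  have hF : ∀ P : E.Curve, FPoint P (ofAffine q) = h (xOption P) := by
    rintro (⟨a, b, h⟩ | ⟨w, h⟩) <;> rfl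
  simp only [FDiv_weierstrassDiv, hF, prod_fixed]
  simp only [h, Option.elim, Finset.prod_div_distrib, prod_roots, Finset.prod_const, card_roots_eq]
  rw [← weight_pow hg (sq_nonneg _), ← (natDegree_eq E).1]
  have := weight_pos hg (sq_nonneg ‖q.1.1‖)
  split_ifs
  · field_simp
    ring
  · simp

lemma FDiv_weierstrassDiv_infinity (hg : 2 ≤ g) (w : ℂ) (hw : w ^ 2 = E.fInf.eval 0) :
    FDiv (weierstrassDiv E) (.infinity w hw) = ‖E.fInf.eval 0‖ := by
  let h : Option ℂ → ℝ := fun o => o.elim 0 fun a => 1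
  have hF : ∀ P : E.Curve, FPoint P (.infinity w hw) = h (xOption P) := by
    rintro (⟨a, b, h'⟩ | ⟨w, h'⟩) <;> simp [FPoint, h, xOption, weight_zero hg]
  simp only [FDiv_weierstrassDiv, hF, prod_fixed]
  rw [(natDegree_eq E).2]
  simp [h]

lemma FDiv_weierstrassDiv_ofInfinity (hg : 2 ≤ g) (q : PlaneCurve E.fInf) :
    FDiv (weierstrassDiv E) (ofInfinity q) =
      ‖E.fInf.eval q.1.1‖ / (sigmaSum g (‖q.1.1‖ ^ 2) * (1 + ‖q.1.1‖ ^ 2) ^ 2) := by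
  by_cases h0 : q.1.1 = 0
  · have : ofInfinity q = .infinity q.1.2 (by rw [q.2, h0]) := by simp [ofInfinity, h0]
    rw [this, FDiv_weierstrassDiv_infinity hg, h0, norm_zero, ← weight_pow hg (by positivity),
      zero_pow two_ne_zero, weight_zero hg]
    simp
  · have hp : 0 < ‖q.1.1‖ := norm_pos_iff.2 h0
    obtain ⟨r, hr, hr'⟩ : ∃ r : PlaneCurve E.f, ofInfinity q = ofAffine r ∧ r.1.1 = q.1.1⁻¹ :=
      ⟨⟨(q.1.1⁻¹, q.1.2 / q.1.1 ^ (g + 1)), by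
        have := E.eval_fInf _ h0
        rw [← q.2] at this
        simp only
        rw [div_pow, this, ← pow_mul, show (g + 1) * 2 = 2 * g + 2 by ring]
        exact mul_div_cancel_right₀ _ (pow_ne_zero _ h0)⟩, by simp [ofInfinity, h0, ofAffine], rfl⟩
    have hs := sigmaSum_pos hg (sq_nonneg ‖q.1.1‖)
    rw [hr, FDiv_weierstrassDiv_ofAffine hg, hr', E.eval_fInf _ h0, norm_inv, norm_mul, norm_pow,
      ← weight_pow hg (by positivity), ← weight_pow hg (by positivity), weight_inv_sq hg hp, div_pow]
    have hw := weight_pos hg (sq_nonneg ‖q.1.1‖)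
    field_simp

/-! ### Uniform description of the charts -/

open Classical in
lemma alpha_single_apply (P Q : E.Curve) :
    alpha (Finsupp.single P 1) Q = (if P = Q then 1 else 0) + if involution P = Q then 1 else 0 := by
  simp [alpha, involutionDiv, Finsupp.mapDomain_single, Finsupp.single_apply]

/-- The description of the metric, of `F_W` and of the functions `F_P` in the preferred chart at
`Q`. It has the same shape on `C₀` (where `coord = x`, `form dt = dx/y`, `poly = f`) and on `C₀'`
(where `coord = z`, `form dt = dz/w` and `poly` is the reversed polynomial). In both cases `line P`
is the affine function whose zero, if any, is the coordinate of `P`. -/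
structure LocalForm (Q : E.Curve) where
  coord : ℂ → ℂ
  form : ℂ → ℂ
  poly : ℂ[X]
  line : E.Curve → ℂ → ℂ
  analyticAt_coord : ∀ t ∈ (chartAt ℂ Q).target, AnalyticAt ℂ coord t
  analyticAt_form : ∀ t ∈ (chartAt ℂ Q).target, AnalyticAt ℂ form t
  form_ne_zero : ∀ t ∈ (chartAt ℂ Q).target, form t ≠ 0
  norm_deriv_coord : ∀ t ∈ (chartAt ℂ Q).target,
    ‖deriv coord t‖ ^ 2 = ‖form t‖ ^ 2 * ‖poly.eval (coord t)‖
  metricDensity_eq : ∀ t ∈ (chartAt ℂ Q).target,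
    metricDensity Q t = sigmaSum g (‖coord t‖ ^ 2) * ‖form t‖ ^ 2
  FDiv_eq : ∀ t ∈ (chartAt ℂ Q).target, FDiv (weierstrassDiv E) ((chartAt ℂ Q).symm t) =
    ‖poly.eval (coord t)‖ / (sigmaSum g (‖coord t‖ ^ 2) * (1 + ‖coord t‖ ^ 2) ^ 2)
  FPoint_eq : ∀ P, ∀ t ∈ (chartAt ℂ Q).target, FPoint P ((chartAt ℂ Q).symm t) =
    ‖line P (coord t)‖ / weight g (‖coord t‖ ^ 2)
  differentiable_line : ∀ P, Differentiable ℂ (line P)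
  line_order : ∀ P, ∃ (m : ℕ) (u : ℂ → ℂ), (m : ℤ) = alpha (Finsupp.single P 1) Q ∧
    AnalyticAt ℂ u (chartAt ℂ Q Q) ∧ u (chartAt ℂ Q Q) ≠ 0 ∧
    ∀ᶠ t in 𝓝 (chartAt ℂ Q Q), line P (coord t) = (t - chartAt ℂ Q Q) ^ m * u t

lemma norm_deriv_coord_of_form {p : ℂ[X]} {e : OpenPartialHomeomorph (PlaneCurve p) ℂ} {t θ : ℂ}
    (h : deriv (fun s => (e.symm s).1.1) t = θ * (e.symm t).1.2) :
    ‖deriv (fun s => (e.symm s).1.1) t‖ ^ 2 = ‖θ‖ ^ 2 * ‖p.eval (e.symm t).1.1‖ := by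
  rw [h, norm_mul, mul_pow, ← norm_pow _ 2, ← norm_pow (e.symm t).1.2, (e.symm t).2, norm_pow]

lemma IsPlaneChartAt.order_of_ne_zero {p : ℂ[X]} {e : OpenPartialHomeomorph (PlaneCurve p) ℂ}
    {q : PlaneCurve p} (he : IsPlaneChartAt e q) {l : ℂ → ℂ} (hl : Differentiable ℂ l)
    (h : l q.1.1 ≠ 0) :
    ∃ u : ℂ → ℂ, AnalyticAt ℂ u (e q) ∧ u (e q) ≠ 0 ∧
      ∀ᶠ t in 𝓝 (e q), l (e.symm t).1.1 = (t - e q) ^ 0 * u t := by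
  refine ⟨fun t => l (e.symm t).1.1, ?_, ?_, .of_forall fun t => by simp⟩
  · exact (hl.analyticAt _).comp (he.holInverse _ (e.map_source he.mem_source)).1.analyticAt
  · simpa only [e.left_inv he.mem_source] using h

/-- On both parts of the curve the sum of the `‖ω_i‖²` is `σ(‖coord‖²) ‖form‖²`, since `σ` is a
palindromic sum of powers. -/
lemma exists_localForm (hg : 2 ≤ g) (Q : E.Curve) : Nonempty (LocalForm Q) := by
  classical
  rcases chart_eq_lift Q with ⟨q, e, he, hQ, hc⟩ | ⟨q, e, he, hq0, hQ, hc⟩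
  · obtain ⟨θ, hθ⟩ := he.form
    have hsymm : ∀ t, (chartAt ℂ Q).symm t = ofAffine (e.symm t) := fun t => by rw [hc]; rfl
    have htgt : ∀ t ∈ (chartAt ℂ Q).target, t ∈ e.target := fun t ht => by rw [hc] at ht; exact ht
    have h0 : chartAt ℂ Q Q = e q := by
      rw [hc]; conv_lhs => rw [hQ]
      exact OpenPartialHomeomorph.lift_openEmbedding_apply ..
    refine ⟨⟨fun t => (e.symm t).1.1, θ, E.f, affineLine,
      fun t ht => (he.holInverse t (htgt t ht)).1.analyticAt,
      fun t ht => (hθ t (htgt t ht)).1, fun t ht => (hθ t (htgt t ht)).2.1,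
      fun t ht => norm_deriv_coord_of_form (hθ t (htgt t ht)).2.2.1, fun t ht => ?_,
      fun t _ => by rw [hsymm, FDiv_weierstrassDiv_ofAffine hg],
      fun P t _ => by rw [hsymm, FPoint_ofAffine], differentiable_affineLine, fun P => ?_⟩⟩
    · simp only [metricDensity, sigmaSum, Finset.sum_mul]
      refine Finset.sum_congr rfl fun i _ => ?_
      have hγ : (chartAt ℂ Q).symm t = .affine (e.symm t).1.1 (e.symm t).1.2 (e.symm t).2 :=
        hsymm t
      rw [formCoeff_affine hγ (θ := θ t) ?_ ?_, norm_mul, norm_pow, mul_pow, ← pow_mul, ← pow_mul,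
        mul_comm i 2]
      · simp only [hsymm]; exact (hθ t (htgt t ht)).2.2.1
      · simp only [hsymm]; exact (hθ t (htgt t ht)).2.2.2
    · rw [h0]
      by_cases hl : affineLine P q.1.1 = 0
      · obtain ⟨u, hu⟩ := he.order
        refine ⟨if q.1.2 = 0 then 2 else 1, u, ?_, hu.1, hu.2.1, ?_⟩
        · rw [alpha_single_apply]
          rcases P with ⟨a, b, hab⟩ | ⟨w, hw⟩
          · obtain ⟨⟨x, y⟩, hxy⟩ := q
            simp only [affineLine, sub_eq_zero] at hl
            subst hl
            have hyb : y ^ 2 = b ^ 2 := by rw [hxy, hab]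
            rw [hQ]
            simp only [involution, ofAffine, Curve.affine.injEq, true_and]
            rcases sq_eq_sq_iff_eq_or_eq_neg.1 hyb with rfl | rfl
            · by_cases hy : y = 0
              · simp [hy]
              · simp [hy, neg_eq_self]
            · by_cases hy : b = 0
              · simp [hy]
              · simp [hy, self_eq_neg]
          · simp [affineLine] at hl
        · filter_upwards [hu.2.2] with t ht
          rw [← ht]
          rcases P with ⟨a, b, hab⟩ | ⟨w, hw⟩
          · simp only [affineLine, sub_eq_zero] at hl
            simp [affineLine, hl]
          · simp [affineLine] at hl
      · obtain ⟨u, hu⟩ := he.order_of_ne_zero (differentiable_affineLine P) hl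
        refine ⟨0, u, ?_, hu⟩
        rw [alpha_single_apply]
        rcases P with ⟨a, b, hab⟩ | ⟨w, hw⟩
        · have hl' : a ≠ q.1.1 := fun h => hl (by simp [affineLine, h])
          rw [hQ]; simp [involution, ofAffine, hl']
        · rw [hQ]; simp [involution, ofAffine]
  · obtain ⟨θ, hθ⟩ := he.form
    have hsymm : ∀ t, (chartAt ℂ Q).symm t = ofInfinity (e.symm t) := fun t => by rw [hc]; rfl
    have htgt : ∀ t ∈ (chartAt ℂ Q).target, t ∈ e.target := fun t ht => by rw [hc] at ht; exact ht
    have h0 : chartAt ℂ Q Q = e q := by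
      rw [hc]; conv_lhs => rw [hQ]
      exact OpenPartialHomeomorph.lift_openEmbedding_apply ..
    have hQ' : Q = .infinity q.1.2 (by rw [q.2, hq0]) := by rw [hQ]; simp [ofInfinity, hq0]
    refine ⟨⟨fun t => (e.symm t).1.1, θ, E.fInf, infinityLine,
      fun t ht => (he.holInverse t (htgt t ht)).1.analyticAt,
      fun t ht => (hθ t (htgt t ht)).1, fun t ht => (hθ t (htgt t ht)).2.1,
      fun t ht => norm_deriv_coord_of_form (hθ t (htgt t ht)).2.2.1, fun t ht => ?_,
      fun t _ => by rw [hsymm, FDiv_weierstrassDiv_ofInfinity hg],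
      fun P t _ => by rw [hsymm, FPoint_ofInfinity hg], differentiable_infinityLine,
      fun P => ?_⟩⟩
    · simp only [metricDensity, sigmaSum, Finset.sum_mul]
      rw [← Finset.sum_range_reflect]
      refine Finset.sum_congr rfl fun j hj => ?_
      have hj := Finset.mem_range.1 hj
      obtain ⟨h1, h2⟩ := he.holInverse t (htgt t ht)
      have d1 := (h1.differentiableAt (by simp)).hasDerivAt
      have d2 := (h2.differentiableAt (by simp)).hasDerivAt
      rw [(hθ t (htgt t ht)).2.2.1] at d1
      have hγ : (chartAt ℂ Q).symm t = ofInfinity (e.symm t) := hsymm t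
      rw [formCoeff_infinity hγ (η := θ t) ?_ ?_ (hθ t (htgt t ht)).2.2.2 (by omega), norm_neg,
        norm_mul, norm_pow, mul_pow, ← pow_mul, ← pow_mul, show g - 1 - (g - 1 - j) = j by omega,
        mul_comm j 2]
      · simpa only [hsymm, zCoord_ofInfinity] using d1
      · simpa only [hsymm, wCoord_ofInfinity] using d2
    · rw [h0]
      by_cases hl : infinityLine P q.1.1 = 0
      · obtain ⟨u, hu⟩ := he.order
        refine ⟨if q.1.2 = 0 then 2 else 1, u, ?_, hu.1, hu.2.1, ?_⟩
        · rw [alpha_single_apply]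
          rcases P with ⟨a, b, hab⟩ | ⟨w, hw⟩
          · simp [infinityLine, hq0] at hl
          · have hyb : q.1.2 ^ 2 = w ^ 2 := by rw [q.2, hq0, hw]
            rw [hQ']
            simp only [involution, Curve.infinity.injEq]
            rcases sq_eq_sq_iff_eq_or_eq_neg.1 hyb with h | h
            · rw [h]
              by_cases hy : w = 0
              · simp [hy]
              · simp [hy, neg_eq_self]
            · rw [h]
              by_cases hy : w = 0
              · simp [hy]
              · simp [hy, self_eq_neg]
        · filter_upwards [hu.2.2] with t ht
          rw [← ht]
          rcases P with ⟨a, b, hab⟩ | ⟨w, hw⟩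
          · simp [infinityLine, hq0] at hl
          · simp [infinityLine, hq0]
      · obtain ⟨u, hu⟩ := he.order_of_ne_zero (differentiable_infinityLine P) hl
        refine ⟨0, u, ?_, hu⟩
        rw [alpha_single_apply]
        rcases P with ⟨a, b, hab⟩ | ⟨w, hw⟩
        · rw [hQ']; simp [involution]
        · simp [infinityLine, hq0] at hl

/-! ### The area measure in the charts -/

lemma contDiff_log_sigmaSum (hg : 2 ≤ g) {n : WithTop ℕ∞} :
    ContDiff ℝ n (fun x : ℂ => Real.log (sigmaSum g (‖x‖ ^ 2))) := by
  refine ContDiff.log ?_ fun x => (sigmaSum_pos hg (sq_nonneg _)).ne'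
  exact ContDiff.sum fun i _ => (contDiff_norm_sq ℝ).pow i

lemma metricDensity_pos (hg : 2 ≤ g) (Q : E.Curve) {t : ℂ} (ht : t ∈ (chartAt ℂ Q).target) :
    0 < metricDensity Q t := by
  obtain ⟨L⟩ := exists_localForm hg Q
  have := norm_pos_iff.2 (L.form_ne_zero t ht)
  rw [L.metricDensity_eq t ht]
  exact mul_pos (sigmaSum_pos hg (sq_nonneg _)) (by positivity)

lemma contDiffAt_metricDensity (hg : 2 ≤ g) (Q : E.Curve) {t : ℂ}
    (ht : t ∈ (chartAt ℂ Q).target) : ContDiffAt ℝ ∞ (metricDensity Q) t := by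
  obtain ⟨L⟩ := exists_localForm hg Q
  have h1 : ContDiffAt ℝ ∞ L.coord t := (L.analyticAt_coord t ht).contDiffAt.restrict_scalars ℝ
  have h2 : ContDiffAt ℝ ∞ L.form t := (L.analyticAt_form t ht).contDiffAt.restrict_scalars ℝ
  have h3 : ContDiffAt ℝ ∞ (fun t => sigmaSum g (‖L.coord t‖ ^ 2) * ‖L.form t‖ ^ 2) t :=
    (ContDiffAt.sum fun i _ => (h1.norm_sq ℝ).pow i).mul (h2.norm_sq ℝ)
  refine h3.congr_of_eventuallyEq ?_
  filter_upwards [(chartAt ℂ Q).open_target.mem_nhds ht] with s hs using L.metricDensity_eq s hs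

lemma continuousOn_metricDensity (hg : 2 ≤ g) (Q : E.Curve) :
    ContinuousOn (metricDensity Q) (chartAt ℂ Q).target :=
  fun _ ht => (contDiffAt_metricDensity hg Q ht).continuousAt.continuousWithinAt

lemma isOpenEmbedding_chartAt_symm (Q : E.Curve) :
    IsOpenEmbedding (fun t : (chartAt ℂ Q).target => (chartAt ℂ Q).symm t) := by
  have := (chartAt ℂ Q).open_source.isOpenEmbedding_subtypeVal.comp
    (chartAt ℂ Q).toHomeomorphSourceTarget.symm.isOpenEmbedding
  exact this

lemma chartArea_eq_map (Q : E.Curve) :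
    chartArea Q = (((volume.restrict (chartAt ℂ Q).target).withDensity
      (fun t => ENNReal.ofReal (metricDensity Q t))).comap Subtype.val).map
        (fun t : (chartAt ℂ Q).target => (chartAt ℂ Q).symm t) := by
  have hT := (chartAt ℂ Q).open_target.measurableSet
  set μ := (volume.restrict (chartAt ℂ Q).target).withDensity
      (fun t => ENNReal.ofReal (metricDensity Q t)) with hμ
  have h1 : (μ.comap (Subtype.val : (chartAt ℂ Q).target → ℂ)).map Subtype.val = μ := by
    rw [map_comap_subtype_coe hT, hμ, restrict_withDensity hT, Measure.restrict_restrict hT,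
      inter_self]
  have h2 : AEMeasurable (chartAt ℂ Q).symm μ :=
    (((chartAt ℂ Q).continuousOn_symm).aemeasurable hT).mono_ac
      (withDensity_absolutelyContinuous _ _)
  have h3 : chartArea Q = μ.map (chartAt ℂ Q).symm := rfl
  rw [h3]
  conv_lhs => rw [← h1]
  rw [AEMeasurable.map_map_of_aemeasurable (by rwa [h1]) measurable_subtype_coe.aemeasurable]
  rfl

lemma aemeasurable_metricDensity (hg : 2 ≤ g) (Q : E.Curve) :
    AEMeasurable (fun t => ENNReal.ofReal (metricDensity Q t))
      (volume.restrict (chartAt ℂ Q).target) :=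
  ((continuousOn_metricDensity hg Q).aemeasurable
    (chartAt ℂ Q).open_target.measurableSet).ennreal_ofReal

lemma chartArea_apply (Q : E.Curve) {A : Set E.Curve} (hA : MeasurableSet A) :
    chartArea Q A = ∫⁻ t in (chartAt ℂ Q).target ∩ (chartAt ℂ Q).symm ⁻¹' A,
      ENNReal.ofReal (metricDensity Q t) ∧
    MeasurableSet ((chartAt ℂ Q).target ∩ (chartAt ℂ Q).symm ⁻¹' A) := by
  have hT := (chartAt ℂ Q).open_target.measurableSet
  have hj := (isOpenEmbedding_chartAt_symm Q).continuous.measurable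
  have himg : Subtype.val '' ((fun t : (chartAt ℂ Q).target => (chartAt ℂ Q).symm t) ⁻¹' A) =
      (chartAt ℂ Q).target ∩ (chartAt ℂ Q).symm ⁻¹' A := by
    ext t; simp [and_comm]
  have hm : MeasurableSet ((chartAt ℂ Q).target ∩ (chartAt ℂ Q).symm ⁻¹' A) := by
    rw [← himg]; exact hT.subtype_image (hj hA)
  refine ⟨?_, hm⟩
  rw [chartArea_eq_map, Measure.map_apply hj hA, comap_subtype_coe_apply hT, himg,
    withDensity_apply _ hm, Measure.restrict_restrict hm, inter_right_comm, inter_self]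

/-- The real Jacobian of multiplication by `a`. -/
lemma abs_det_smul_one (a : ℂ) : |(a • (1 : ℂ →L[ℝ] ℂ)).det| = ‖a‖ ^ 2 := by
  have h1 : ((a • (1 : ℂ →L[ℝ] ℂ) : ℂ →L[ℝ] ℂ) : ℂ →ₗ[ℝ] ℂ) = Algebra.lmul ℝ ℂ a := by
    ext
    simp
  rw [ContinuousLinearMap.det, h1, ← Algebra.norm_apply, Algebra.norm_complex_apply,
    Complex.normSq_eq_norm_sq, abs_of_nonneg (by positivity)]

/-- The area measures of two charts agree on their common domain. -/
lemma chartArea_eq_chartArea (P Q : E.Curve) {A : Set E.Curve} (hA : MeasurableSet A)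
    (hP : A ⊆ (chartAt ℂ P).source) (hQ : A ⊆ (chartAt ℂ Q).source) :
    chartArea P A = chartArea Q A := by
  obtain ⟨h1, hm⟩ := chartArea_apply P hA
  rw [h1, (chartArea_apply Q hA).1]
  set S := (chartAt ℂ P).target ∩ (chartAt ℂ P).symm ⁻¹' A
  have himg : (chartAt ℂ Q).target ∩ (chartAt ℂ Q).symm ⁻¹' A =
      (fun s => chartAt ℂ Q ((chartAt ℂ P).symm s)) '' S := by
    ext t
    constructor
    · rintro ⟨ht, hA⟩
      refine ⟨chartAt ℂ P ((chartAt ℂ Q).symm t), ⟨(chartAt ℂ P).map_source (hP hA), ?_⟩, ?_⟩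
      · rwa [mem_preimage, (chartAt ℂ P).left_inv (hP hA)]
      · simp only
        rw [(chartAt ℂ P).left_inv (hP hA), (chartAt ℂ Q).right_inv ht]
    · rintro ⟨s, ⟨hs, hA⟩, rfl⟩
      refine ⟨(chartAt ℂ Q).map_source (hQ hA), ?_⟩
      rwa [mem_preimage, (chartAt ℂ Q).left_inv (hQ hA)]
  have hinj : InjOn (fun s => chartAt ℂ Q ((chartAt ℂ P).symm s)) S := by
    rintro s ⟨hs, hsA⟩ s' ⟨hs', hsA'⟩ hh
    have := (chartAt ℂ Q).injOn (hQ hsA) (hQ hsA') hh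
    exact (chartAt ℂ P).symm.injOn hs hs' this
  rw [himg, lintegral_image_eq_lintegral_abs_det_fderiv_mul volume hm
    (f' := fun t => deriv (fun s => chartAt ℂ Q ((chartAt ℂ P).symm s)) t • (1 : ℂ →L[ℝ] ℂ))
    (fun t ht => (analyticAt_transition P Q ht.1
      (hQ ht.2)).differentiableAt.hasDerivAt.complexToReal_fderiv.hasFDerivWithinAt) hinj]
  refine setLIntegral_congr_fun hm fun t ht => ?_
  rw [abs_det_smul_one, ← ENNReal.ofReal_mul (by positivity),
    metricDensity_transition P Q ht.1 (hQ ht.2), mul_comm]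

/-- The area measure is given on each chart domain by the area measure of the chart. -/
lemma area_apply_of_subset (Q : E.Curve) {A : Set E.Curve} (hA : MeasurableSet A)
    (hQ : A ⊆ (chartAt ℂ Q).source) : area E A = chartArea Q A := by
  set p := (exists_chart_cover E).choose with hp
  have hcov : ⋃ n, (chartAt ℂ (p n)).source = univ := (exists_chart_cover E).choose_spec
  have hD : ∀ n, MeasurableSet (disjointed (fun k => (chartAt ℂ (p k)).source) n) := fun n =>
    MeasurableSet.disjointed (fun k => (chartAt ℂ (p k)).open_source.measurableSet) n
  have h1 : area E A = ∑' n, chartArea Q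
      (A ∩ disjointed (fun k => (chartAt ℂ (p k)).source) n) := by
    rw [area, Measure.sum_apply _ hA]
    refine tsum_congr fun n => ?_
    rw [Measure.restrict_apply hA]
    exact chartArea_eq_chartArea _ _ (hA.inter (hD n))
      (inter_subset_right.trans (disjointed_subset _ n)) (inter_subset_left.trans hQ)
  rw [h1, ← measure_iUnion, ← inter_iUnion, iUnion_disjointed, hcov, inter_univ]
  · exact fun i j hij => ((disjoint_disjointed _) hij).mono inter_subset_right inter_subset_right
  · exact fun n => hA.inter (hD n)

lemma area_restrict_source (Q : E.Curve) :
    (area E).restrict (chartAt ℂ Q).source = chartArea Q := by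
  have hs := (chartAt ℂ Q).open_source.measurableSet
  ext A hA
  rw [Measure.restrict_apply hA, area_apply_of_subset Q (hA.inter hs) inter_subset_right,
    (chartArea_apply Q (hA.inter hs)).1, (chartArea_apply Q hA).1]
  congr 2
  ext t
  simp only [mem_inter_iff, mem_preimage]
  exact ⟨fun h => ⟨h.1, h.2.1⟩, fun h => ⟨h.1, h.2, (chartAt ℂ Q).map_target h.1⟩⟩

lemma integrableOn_source_iff (hg : 2 ≤ g) (Q : E.Curve) (F : E.Curve → ℂ) :
    IntegrableOn F (chartAt ℂ Q).source (area E) ↔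
      IntegrableOn (fun t => metricDensity Q t • F ((chartAt ℂ Q).symm t))
        (chartAt ℂ Q).target := by
  have hT := (chartAt ℂ Q).open_target.measurableSet
  rw [IntegrableOn, area_restrict_source, chartArea_eq_map,
    (isOpenEmbedding_chartAt_symm Q).measurableEmbedding.integrable_map_iff]
  have := integrableOn_iff_comap_subtypeVal hT
    (μ := (volume.restrict (chartAt ℂ Q).target).withDensity
      (fun t => ENNReal.ofReal (metricDensity Q t))) (f := fun t => F ((chartAt ℂ Q).symm t))
  rw [show (F ∘ fun t : (chartAt ℂ Q).target => (chartAt ℂ Q).symm t) =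
    (fun t => F ((chartAt ℂ Q).symm t)) ∘ Subtype.val from rfl, ← this, IntegrableOn,
    restrict_withDensity hT, Measure.restrict_restrict hT, inter_self,
    integrable_withDensity_iff_integrable_smul₀' (aemeasurable_metricDensity hg Q) (by simp),
    IntegrableOn]
  refine integrable_congr ?_
  filter_upwards [ae_restrict_mem hT] with t ht
  rw [ENNReal.toReal_ofReal (metricDensity_pos hg Q ht).le]

lemma setIntegral_source (hg : 2 ≤ g) (Q : E.Curve) (F : E.Curve → ℂ) :
    ∫ P in (chartAt ℂ Q).source, F P ∂(area E) =
      ∫ t in (chartAt ℂ Q).target, metricDensity Q t • F ((chartAt ℂ Q).symm t) := by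
  have hT := (chartAt ℂ Q).open_target.measurableSet
  rw [area_restrict_source, chartArea_eq_map,
    (isOpenEmbedding_chartAt_symm Q).measurableEmbedding.integral_map,
    integral_subtype_comap hT (fun t => F ((chartAt ℂ Q).symm t)),
    restrict_withDensity hT, Measure.restrict_restrict hT, inter_self,
    integral_withDensity_eq_integral_toReal_smul₀ (aemeasurable_metricDensity hg Q) (by simp)]
  refine integral_congr_ae ?_
  filter_upwards [ae_restrict_mem hT] with t ht
  rw [ENNReal.toReal_ofReal (metricDensity_pos hg Q ht).le]

lemma area_singleton (Q : E.Curve) : area E {Q} = 0 := by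
  rw [area_apply_of_subset Q (measurableSet_singleton Q)
    (singleton_subset_iff.2 (_root_.mem_chart_source ℂ Q)),
    (chartArea_apply Q (measurableSet_singleton Q)).1]
  refine setLIntegral_measure_zero _ _ (measure_mono_null (t := {chartAt ℂ Q Q}) ?_ (by simp))
  rintro t ⟨ht, hQ⟩
  have hQ : (chartAt ℂ Q).symm t = Q := hQ
  have h1 := (chartAt ℂ Q).right_inv ht
  rw [hQ] at h1
  exact h1.symm

/-- The area of the curve is finite, by compactness. -/
lemma isFiniteMeasure_area (hg : 2 ≤ g) : IsFiniteMeasure (area E) := by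
  have : IsLocallyFiniteMeasure (area E) := by
    refine ⟨fun Q => ?_⟩
    obtain ⟨r, hr, hrT⟩ := Metric.nhds_basis_closedBall.mem_iff.1
      ((chartAt ℂ Q).open_target.mem_nhds (mem_chart_target ℂ Q))
    set U := (chartAt ℂ Q).source ∩ chartAt ℂ Q ⁻¹' Metric.ball (chartAt ℂ Q Q) r
    have hU : IsOpen U := (chartAt ℂ Q).isOpen_inter_preimage Metric.isOpen_ball
    refine ⟨U, hU.mem_nhds ⟨_root_.mem_chart_source ℂ Q, by simp [hr]⟩, ?_⟩
    rw [area_apply_of_subset Q hU.measurableSet inter_subset_left,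
      (chartArea_apply Q hU.measurableSet).1]
    refine lt_of_le_of_lt (lintegral_mono_set (t := Metric.closedBall (chartAt ℂ Q Q) r) ?_) ?_
    · rintro t ⟨ht, -, hb⟩
      rw [mem_preimage, (chartAt ℂ Q).right_inv ht] at hb
      exact Metric.ball_subset_closedBall hb
    · have := ((continuousOn_metricDensity hg Q).mono hrT).integrableOn_compact
        (isCompact_closedBall (chartAt ℂ Q Q) r) (μ := volume)
      exact this.lintegral_lt_top
  exact ⟨isCompact_univ.measure_lt_top⟩

/-! ### Curvature and Laplacian in the charts -/

lemma two_le_infty : (2 : WithTop ℕ∞) ≤ ∞ := 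
  WithTop.coe_le_coe.2 (le_top : (2 : ℕ∞) ≤ ⊤)

lemma contDiffAt_comp_chartAt_symm {φ : E.Curve → ℂ} (hφ : ContMDiff 𝓘(ℝ, ℂ) 𝓘(ℝ, ℂ) ∞ φ)
    (Q : E.Curve) {t : ℂ} (ht : t ∈ (chartAt ℂ Q).target) :
    ContDiffAt ℝ ∞ (φ ∘ (chartAt ℂ Q).symm) t := by
  have h1 : ContMDiffAt 𝓘(ℝ, ℂ) 𝓘(ℝ, ℂ) ∞ (chartAt ℂ Q).symm t :=
    (contMDiffOn_chart_symm (I := 𝓘(ℝ, ℂ)) (n := ∞) (x := Q)).contMDiffAt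
      ((chartAt ℂ Q).open_target.mem_nhds ht)
  exact contMDiffAt_iff_contDiffAt.1 (hφ.contMDiffAt.comp t h1)

lemma deriv_transition_ne_zero (hg : 2 ≤ g) (P Q : E.Curve) {t : ℂ}
    (ht : t ∈ (chartAt ℂ P).target) (hQ : (chartAt ℂ P).symm t ∈ (chartAt ℂ Q).source) :
    deriv (fun s => chartAt ℂ Q ((chartAt ℂ P).symm s)) t ≠ 0 := by
  intro h
  have := metricDensity_transition P Q ht hQ
  rw [h] at this
  have h2 := metricDensity_pos hg P ht
  simp [this] at h2

lemma eventually_transition (P Q : E.Curve) {t : ℂ} (ht : t ∈ (chartAt ℂ P).target)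
    (hQ : (chartAt ℂ P).symm t ∈ (chartAt ℂ Q).source) :
    ∀ᶠ s in 𝓝 t, s ∈ (chartAt ℂ P).target ∧ (chartAt ℂ P).symm s ∈ (chartAt ℂ Q).source :=
  ((chartAt ℂ P).open_target.eventually_mem ht).and (((chartAt ℂ P).continuousAt_symm ht).eventually
    ((chartAt ℂ Q).open_source.mem_nhds hQ))

/-- The Laplace-Beltrami operator may be computed in any preferred chart. -/
lemma laplaceBeltrami_chartAt_symm (hg : 2 ≤ g) {φ : E.Curve → ℂ}
    (hφ : ContMDiff 𝓘(ℝ, ℂ) 𝓘(ℝ, ℂ) ∞ φ) (Q : E.Curve) {t : ℂ} (ht : t ∈ (chartAt ℂ Q).target) :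
    metricDensity Q t • laplaceBeltrami φ ((chartAt ℂ Q).symm t) =
      Δ (φ ∘ (chartAt ℂ Q).symm) t := by
  set P := (chartAt ℂ Q).symm t with hP
  have hPs : (chartAt ℂ Q).symm t ∈ (chartAt ℂ P).source := _root_.mem_chart_source ℂ P
  have hev : φ ∘ (chartAt ℂ Q).symm =ᶠ[𝓝 t]
      (φ ∘ (chartAt ℂ P).symm) ∘ fun s => chartAt ℂ P ((chartAt ℂ Q).symm s) := by
    filter_upwards [eventually_transition Q P ht hPs] with s hs
    simp only [Function.comp_apply]
    rw [(chartAt ℂ P).left_inv hs.2]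
  rw [(laplacian_congr_nhds hev).eq_of_nhds,
    laplacian_comp_analyticAt (analyticAt_transition Q P ht hPs)
      ((contDiffAt_comp_chartAt_symm hφ P (mem_chart_target ℂ P)).of_le two_le_infty),
    metricDensity_transition Q P ht hPs, laplaceBeltrami]
  have hpos := metricDensity_pos hg P (mem_chart_target ℂ P)
  rw [← hP, Complex.real_smul, Complex.real_smul, ← mul_assoc, ← Complex.ofReal_mul]
  congr 2
  field_simp

lemma laplacian_log_norm_eq_zero {h : ℂ → ℂ} {t : ℂ} (hh : AnalyticAt ℂ h t) (h0 : h t ≠ 0) :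
    ContDiffAt ℝ ∞ (fun s => Real.log ‖h s‖) t ∧ Δ (fun s => Real.log ‖h s‖) t = 0 := by
  constructor
  · have h1 : ContDiffAt ℝ ∞ h t := hh.contDiffAt.restrict_scalars ℝ
    exact (h1.norm ℝ h0).log (norm_ne_zero_iff.2 h0)
  · exact (hh.harmonicAt_log_norm h0).2.eq_of_nhds

lemma laplacian_add_two_mul_log_norm {s : ℂ → ℝ} {h : ℂ → ℂ} {t : ℂ} (hs : ContDiffAt ℝ 2 s t)
    (hh : AnalyticAt ℂ h t) (h0 : h t ≠ 0) :
    Δ (fun r => s r + 2 * Real.log ‖h r‖) t = Δ s t := by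
  obtain ⟨h1, h2⟩ := laplacian_log_norm_eq_zero hh h0
  have h1' : ContDiffAt ℝ 2 (fun r => Real.log ‖h r‖) t := h1.of_le two_le_infty
  have h3 : ContDiffAt ℝ 2 ((2 : ℝ) • fun r => Real.log ‖h r‖) t := h1'.const_smul (2 : ℝ)
  have e := hs.laplacian_add h3
  rw [laplacian_smul 2 h1', h2, smul_zero, add_zero] at e
  exact e

lemma contDiffAt_log_metricDensity (hg : 2 ≤ g) (Q : E.Curve) {t : ℂ}
    (ht : t ∈ (chartAt ℂ Q).target) :
    ContDiffAt ℝ ∞ (fun t => Real.log (metricDensity Q t)) t :=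
  (contDiffAt_metricDensity hg Q ht).log (metricDensity_pos hg Q ht).ne'

/-- The Gaussian curvature may be computed in any preferred chart. -/
lemma gaussCurvature_chartAt_symm (hg : 2 ≤ g) (Q : E.Curve) {t : ℂ}
    (ht : t ∈ (chartAt ℂ Q).target) :
    metricDensity Q t * gaussCurvature ((chartAt ℂ Q).symm t) =
      -(2⁻¹ * Δ (fun t => Real.log (metricDensity Q t)) t) := by
  set P := (chartAt ℂ Q).symm t with hP
  have hPs : (chartAt ℂ Q).symm t ∈ (chartAt ℂ P).source := _root_.mem_chart_source ℂ P
  set h := fun s => chartAt ℂ P ((chartAt ℂ Q).symm s) with hh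
  have han := analyticAt_transition Q P ht hPs
  have hd := deriv_transition_ne_zero hg Q P ht hPs
  have hlog : ContDiffAt ℝ 2 (fun t => Real.log (metricDensity P t)) (h t) :=
    (contDiffAt_log_metricDensity hg P (mem_chart_target ℂ P)).of_le two_le_infty
  have hev : (fun t => Real.log (metricDensity Q t)) =ᶠ[𝓝 t] fun s =>
      ((fun t => Real.log (metricDensity P t)) ∘ h) s + 2 * Real.log ‖deriv h s‖ := by
    filter_upwards [eventually_transition Q P ht hPs] with s hs
    have h1 := metricDensity_pos hg P ((chartAt ℂ P).map_source hs.2)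
    have h2 := norm_pos_iff.2 (deriv_transition_ne_zero hg Q P hs.1 hs.2)
    rw [metricDensity_transition Q P hs.1 hs.2, Real.log_mul h1.ne' (by positivity), Real.log_pow]
    push_cast
    rfl
  rw [(laplacian_congr_nhds hev).eq_of_nhds, laplacian_add_two_mul_log_norm
    (hlog.comp t (han.contDiffAt.restrict_scalars ℝ)) han.deriv hd,
    laplacian_comp_analyticAt han hlog, metricDensity_transition Q P ht hPs, gaussCurvature]
  have hpos := metricDensity_pos hg P (mem_chart_target ℂ P)
  rw [← hP, smul_eq_mul]
  field_simp

/-- `ρ K = - ½ |X'|² (Δ log σ(|·|²))(X)`, because `log ρ - log σ(|X|²)` is harmonic. -/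
lemma LocalForm.gaussCurvature_eq (hg : 2 ≤ g) {Q : E.Curve} (L : LocalForm Q) {t : ℂ}
    (ht : t ∈ (chartAt ℂ Q).target) :
    metricDensity Q t * gaussCurvature ((chartAt ℂ Q).symm t) =
      -(2⁻¹ * (‖deriv L.coord t‖ ^ 2 *
        Δ (fun x : ℂ => Real.log (sigmaSum g (‖x‖ ^ 2))) (L.coord t))) := by
  have hs : ContDiffAt ℝ 2 (fun x : ℂ => Real.log (sigmaSum g (‖x‖ ^ 2))) (L.coord t) :=
    (contDiff_log_sigmaSum hg).contDiffAt
  have hev : (fun t => Real.log (metricDensity Q t)) =ᶠ[𝓝 t] fun s =>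
      ((fun x : ℂ => Real.log (sigmaSum g (‖x‖ ^ 2))) ∘ L.coord) s +
        2 * Real.log ‖L.form s‖ := by
    filter_upwards [(chartAt ℂ Q).open_target.mem_nhds ht] with s hs
    have h1 := sigmaSum_pos hg (sq_nonneg ‖L.coord s‖)
    have h2 := norm_pos_iff.2 (L.form_ne_zero s hs)
    rw [L.metricDensity_eq s hs, Real.log_mul h1.ne' (by positivity), Real.log_pow]
    push_cast
    rfl
  rw [gaussCurvature_chartAt_symm hg Q ht, (laplacian_congr_nhds hev).eq_of_nhds,
    laplacian_add_two_mul_log_norm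
      (hs.comp t ((L.analyticAt_coord t ht).contDiffAt.restrict_scalars ℝ))
      (L.analyticAt_form t ht) (L.form_ne_zero t ht),
    laplacian_comp_analyticAt (L.analyticAt_coord t ht) hs, smul_eq_mul]

lemma LocalForm.metricDensity_mul_FDiv (hg : 2 ≤ g) {Q : E.Curve} (L : LocalForm Q) {t : ℂ}
    (ht : t ∈ (chartAt ℂ Q).target) :
    metricDensity Q t * FDiv (weierstrassDiv E) ((chartAt ℂ Q).symm t) =
      ‖deriv L.coord t‖ ^ 2 / (1 + ‖L.coord t‖ ^ 2) ^ 2 := by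
  rw [L.FDiv_eq t ht, L.metricDensity_eq t ht, L.norm_deriv_coord t ht]
  have := sigmaSum_pos hg (sq_nonneg ‖L.coord t‖)
  field_simp

/-- In genus two `σ(t) = 1 + t`, and the curvature is `-2 F_W`. -/
lemma gaussCurvature_eq_of_genus_two {E : HyperellipticEquation 2} (P : E.Curve) :
    gaussCurvature P = -2 * FDiv (weierstrassDiv E) P := by
  obtain ⟨L⟩ := exists_localForm le_rfl P
  have ht := mem_chart_target ℂ P
  have h1 := L.gaussCurvature_eq le_rfl ht
  have h2 := L.metricDensity_mul_FDiv le_rfl ht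
  have h3 : (fun x : ℂ => Real.log (sigmaSum 2 (‖x‖ ^ 2))) = fun x : ℂ => Real.log (1 + ‖x‖ ^ 2) := by
    ext x; simp [sigmaSum, Finset.sum_range_succ]
  rw [h3, laplacian_log_add_normSq one_pos] at h1
  rw [(chartAt ℂ P).left_inv (_root_.mem_chart_source ℂ P)] at h1 h2
  have hpos := metricDensity_pos le_rfl P ht
  refine mul_left_cancel₀ hpos.ne' ?_
  rw [mul_left_comm, h1, h2]
  ring

lemma continuous_of_charts {F : E.Curve → ℝ}
    (h : ∀ Q, ContinuousAt (F ∘ (chartAt ℂ Q).symm) (chartAt ℂ Q Q)) : Continuous F := by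
  refine continuous_iff_continuousAt.2 fun Q => ?_
  have hs := _root_.mem_chart_source ℂ Q
  refine (((h Q).comp ((chartAt ℂ Q).continuousAt hs))).congr ?_
  filter_upwards [(chartAt ℂ Q).open_source.mem_nhds hs] with P hP
  simp only [Function.comp_apply]
  rw [(chartAt ℂ Q).left_inv hP]

lemma continuousAt_laplacian {v : ℂ → ℝ} {t : ℂ} (hv : ContDiffAt ℝ 2 v t) :
    ContinuousAt (Δ v) t := by
  have h : ContDiffAt ℝ 0 (fderiv ℝ (fderiv ℝ v)) t :=
    (hv.fderiv_right (m := 1) (by norm_num)).fderiv_right (m := 0) (by norm_num)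
  have : Δ v = fun t => fderiv ℝ (fderiv ℝ v) t 1 1 +
      fderiv ℝ (fderiv ℝ v) t Complex.I Complex.I := funext (laplacian_eq_fderiv_fderiv v)
  rw [this]
  have hc := h.continuousAt
  exact ((hc.clm_apply continuousAt_const).clm_apply continuousAt_const).add
    ((hc.clm_apply continuousAt_const).clm_apply continuousAt_const)

lemma continuous_gaussCurvature (hg : 2 ≤ g) : Continuous (gaussCurvature (E := E)) := by
  refine continuous_of_charts fun Q => ?_
  have ht := mem_chart_target ℂ Q
  have hc : ContinuousAt (fun t => -(2⁻¹ * Δ (fun t => Real.log (metricDensity Q t)) t) /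
      metricDensity Q t) (chartAt ℂ Q Q) :=
    ((continuousAt_laplacian ((contDiffAt_log_metricDensity hg Q ht).of_le
      two_le_infty)).const_mul _).neg.div
      (contDiffAt_metricDensity hg Q ht).continuousAt (metricDensity_pos hg Q ht).ne'
  refine hc.congr ?_
  filter_upwards [(chartAt ℂ Q).open_target.mem_nhds ht] with s hs
  rw [← gaussCurvature_chartAt_symm hg Q hs]
  exact mul_div_cancel_left₀ _ (metricDensity_pos hg Q hs).ne'

lemma continuous_FDiv_weierstrassDiv (hg : 2 ≤ g) : Continuous (FDiv (weierstrassDiv E)) := by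
  refine continuous_of_charts fun Q => ?_
  obtain ⟨L⟩ := exists_localForm hg Q
  have ht := mem_chart_target ℂ Q
  have hX := (L.analyticAt_coord _ ht).continuousAt
  have hσ : Continuous (sigmaSum g) := continuous_finsetSum _ fun i _ => continuous_pow i
  have hc : ContinuousAt (fun t => ‖L.poly.eval (L.coord t)‖ /
      (sigmaSum g (‖L.coord t‖ ^ 2) * (1 + ‖L.coord t‖ ^ 2) ^ 2)) (chartAt ℂ Q Q) := by
    refine ContinuousAt.div (L.poly.continuous.continuousAt.comp hX).norm
      ((hσ.continuousAt.comp (hX.norm.pow 2)).mul ((hX.norm.pow 2).const_add 1 |>.pow 2)) ?_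
    have := sigmaSum_pos hg (sq_nonneg ‖L.coord (chartAt ℂ Q Q)‖)
    positivity
  refine hc.congr ?_
  filter_upwards [(chartAt ℂ Q).open_target.mem_nhds ht] with s hs
  exact (L.FDiv_eq s hs).symm

/-! ### The logarithm of `F_P` near a point -/

/-- The smooth density `(K - 4 F_W) / (g + 1)` of `Δ log F_P`. -/
noncomputable def regularPart (Q : E.Curve) : ℝ :=
  (gaussCurvature Q - 4 * FDiv (weierstrassDiv E) Q) / (g + 1)

/-- Near any point `Q`, `log F_P` is `m log |t - t₀|` plus a smooth function with Laplacian
`(K - 4 F_W) / (g + 1)`, where `m` is the multiplicity of `Q` in `P + ι(P)`. -/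
lemma exists_log_FPoint_eq (hg : 2 ≤ g) (P Q : E.Curve) :
    ∃ V ⊆ (chartAt ℂ Q).target, IsOpen V ∧ chartAt ℂ Q Q ∈ V ∧ ∃ v : ℂ → ℝ,
      (∀ t ∈ V, ContDiffAt ℝ ∞ v t) ∧
      (∀ t ∈ V, Δ v t = metricDensity Q t * regularPart ((chartAt ℂ Q).symm t)) ∧
      (∀ t ∈ V, t ≠ chartAt ℂ Q Q → FPoint P ((chartAt ℂ Q).symm t) ≠ 0) ∧
      ∀ t ∈ V, (t ≠ chartAt ℂ Q Q ∨ alpha (Finsupp.single P 1) Q = 0) →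
        Real.log (FPoint P ((chartAt ℂ Q).symm t)) =
          (alpha (Finsupp.single P 1) Q : ℤ) * Real.log ‖t - chartAt ℂ Q Q‖ + v t := by
  obtain ⟨L⟩ := exists_localForm hg Q
  obtain ⟨m, u, hm, hu, hu0, hev⟩ := L.line_order P
  set t₀ := chartAt ℂ Q Q
  obtain ⟨V, hV, hVo, htV⟩ := eventually_nhds_iff.1
    ((((chartAt ℂ Q).open_target.eventually_mem (mem_chart_target ℂ Q)).and
      (hu.eventually_analyticAt.and (hu.continuousAt.eventually_ne hu0))).and hev)
  have hVT : V ⊆ (chartAt ℂ Q).target := fun t ht => (hV t ht).1.1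
  let S : ℂ → ℝ := fun x => Real.log (sigmaSum g (‖x‖ ^ 2))
  let R : ℂ → ℝ := fun x => Real.log (1 + ‖x‖ ^ 2)
  have hS : ContDiff ℝ ∞ S := contDiff_log_sigmaSum hg
  have hR : ContDiff ℝ ∞ R := contDiff_log_add_normSq one_pos
  have hX : ∀ t ∈ V, ContDiffAt ℝ ∞ L.coord t := fun t ht =>
    (L.analyticAt_coord t (hVT ht)).contDiffAt.restrict_scalars ℝ
  have hN : ∀ x : ℂ, Real.log (weight g (‖x‖ ^ 2)) = (2 * g + 2 : ℝ)⁻¹ * (S x + 2 * R x) :=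
    fun x => log_weight hg (sq_nonneg _)
  have hSR : ContDiff ℝ ∞ ((-(2 * g + 2 : ℝ)⁻¹) • (S + (2 : ℝ) • R)) :=
    (hS.add (hR.const_smul (2 : ℝ))).const_smul (-(2 * g + 2 : ℝ)⁻¹)
  refine ⟨V, hVT, hVo, htV, (fun t => Real.log ‖u t‖) +
    ((-(2 * g + 2 : ℝ)⁻¹) • (S + (2 : ℝ) • R)) ∘ L.coord, fun t ht => ?_, fun t ht => ?_,
    fun t ht hne => ?_, fun t ht hne => ?_⟩
  · exact (laplacian_log_norm_eq_zero (hV t ht).1.2.1 (hV t ht).1.2.2).1.add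
      (hSR.contDiffAt.comp t (hX t ht))
  · obtain ⟨h1, h2⟩ := laplacian_log_norm_eq_zero (hV t ht).1.2.1 (hV t ht).1.2.2
    have hS2 : ∀ x, ContDiffAt ℝ 2 S x := fun x => hS.contDiffAt.of_le two_le_infty
    have hR2 : ∀ x, ContDiffAt ℝ 2 R x := fun x => hR.contDiffAt.of_le two_le_infty
    have hR2' : ∀ x, ContDiffAt ℝ 2 ((2 : ℝ) • R) x := fun x => (hR2 x).const_smul (2 : ℝ)
    have hSR2' : ∀ x, ContDiffAt ℝ 2 (S + (2 : ℝ) • R) x := fun x => (hS2 x).add (hR2' x)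
    rw [(h1.of_le two_le_infty).laplacian_add ((hSR.contDiffAt.comp t (hX t ht)).of_le two_le_infty), h2, zero_add,
      laplacian_comp_analyticAt (L.analyticAt_coord t (hVT ht)) (hSR.contDiffAt.of_le two_le_infty),
      laplacian_smul _ (hSR2' _), (hS2 _).laplacian_add (hR2' _), laplacian_smul _ (hR2 _),
      laplacian_log_add_normSq one_pos]
    have e1 := L.gaussCurvature_eq hg (hVT ht)
    have e2 := L.metricDensity_mul_FDiv hg (hVT ht)
    have e3 : metricDensity Q t * regularPart ((chartAt ℂ Q).symm t) =
        (metricDensity Q t * gaussCurvature ((chartAt ℂ Q).symm t) -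
          4 * (metricDensity Q t * FDiv (weierstrassDiv E) ((chartAt ℂ Q).symm t))) /
          (g + 1) := by
      rw [regularPart]; ring
    rw [e3, e1, e2]
    have : (g : ℝ) + 1 ≠ 0 := by positivity
    simp only [smul_eq_mul, S]
    field_simp
    ring
  · rw [L.FPoint_eq P t (hVT ht), (hV t ht).2]
    have hw := weight_pos hg (sq_nonneg ‖L.coord t‖)
    exact div_ne_zero (norm_ne_zero_iff.2 (mul_ne_zero (pow_ne_zero _ (sub_ne_zero.2 hne))
      (hV t ht).1.2.2)) hw.ne'
  · have h0 : (t - t₀) ^ m ≠ 0 := by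
      rcases hne with hne | hne
      · exact pow_ne_zero _ (sub_ne_zero.2 hne)
      · have : m = 0 := by rw [← hm] at hne; exact_mod_cast hne
        rw [this, pow_zero]; exact one_ne_zero
    have hut := (hV t ht).1.2.2
    have hw := weight_pos hg (sq_nonneg ‖L.coord t‖)
    rw [L.FPoint_eq P t (hVT ht), (hV t ht).2, ← hm,
      Real.log_div (norm_ne_zero_iff.2 (mul_ne_zero h0 hut)) hw.ne', norm_mul,
      Real.log_mul (norm_ne_zero_iff.2 h0) (norm_ne_zero_iff.2 hut), norm_pow, Real.log_pow, hN]
    simp only [Pi.add_apply, Function.comp_apply, Pi.smul_apply, smul_eq_mul, Int.cast_natCast]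
    ring

/-! ### The weak equation for `log F_P` -/

lemma FPoint_eq_zero_iff (hg : 2 ≤ g) (P Q : E.Curve) :
    FPoint P Q = 0 ↔ P = Q ∨ involution P = Q := by
  have hw : ∀ x : ℂ, weight g (‖x‖ ^ 2) ≠ 0 := fun x => (weight_pos hg (sq_nonneg _)).ne'
  rcases P with ⟨a, b, h⟩ | ⟨w, h⟩ <;> rcases Q with ⟨a', b', h'⟩ | ⟨w', h'⟩
  · simp only [FPoint, div_eq_zero_iff, hw, or_false, norm_eq_zero, sub_eq_zero, involution,
      Curve.affine.injEq]
    constructor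
    · rintro rfl
      rcases sq_eq_sq_iff_eq_or_eq_neg.1 (h.trans h'.symm) with hb | hb
      · exact .inl ⟨rfl, hb⟩
      · exact .inr ⟨rfl, by rw [hb, neg_neg]⟩
    · rintro (h | h) <;> exact h.1.symm
  · have := hw 0
    simp_all [FPoint, involution]
  · have := hw a'
    simp_all [FPoint, involution]
  · simp only [FPoint, norm_zero, zero_div, true_iff, involution, Curve.infinity.injEq]
    rcases sq_eq_sq_iff_eq_or_eq_neg.1 (h.trans h'.symm) with hb | hb
    · exact .inl hb
    · exact .inr (by rw [hb, neg_neg])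

lemma laplaceBeltrami_of_notMem_tsupport {φ : E.Curve → ℂ} {P : E.Curve} (hP : P ∉ tsupport φ) :
    laplaceBeltrami φ P = 0 := by
  have h1 : φ =ᶠ[𝓝 ((chartAt ℂ P).symm (chartAt ℂ P P))] 0 := by
    rw [(chartAt ℂ P).left_inv (_root_.mem_chart_source ℂ P)]
    exact notMem_tsupport_iff_eventuallyEq.1 hP
  have h2 : φ ∘ (chartAt ℂ P).symm =ᶠ[𝓝 (chartAt ℂ P P)] fun _ => (0 : ℂ) :=
    ((chartAt ℂ P).continuousAt_symm (mem_chart_target ℂ P)).eventually h1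
  have h3 : Δ (φ ∘ (chartAt ℂ P).symm) (chartAt ℂ P P) = 0 :=
    (laplacian_congr_nhds h2).eq_of_nhds.trans (congrFun (laplacian_const (c := (0 : ℂ))) _)
  rw [laplaceBeltrami, h3, mul_zero]

lemma laplaceBeltrami_add {φ ψ : E.Curve → ℂ} (hφ : ContMDiff 𝓘(ℝ, ℂ) 𝓘(ℝ, ℂ) ∞ φ)
    (hψ : ContMDiff 𝓘(ℝ, ℂ) 𝓘(ℝ, ℂ) ∞ ψ) (P : E.Curve) :
    laplaceBeltrami (φ + ψ) P = laplaceBeltrami φ P + laplaceBeltrami ψ P := by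
  have h1 := contDiffAt_comp_chartAt_symm hφ P (mem_chart_target ℂ P)
  have h2 := contDiffAt_comp_chartAt_symm hψ P (mem_chart_target ℂ P)
  rw [laplaceBeltrami, laplaceBeltrami, laplaceBeltrami, ← mul_add,
    ← (h1.of_le two_le_infty).laplacian_add (h2.of_le two_le_infty)]
  rfl

/-- The weak form of `Δ log F_P = (K - 4 F_W) / (g + 1) + 2π (δ_P + δ_{ι(P)})`, tested against
`φ`. -/
def WeakEquation (P : E.Curve) (φ : E.Curve → ℂ) : Prop :=
  Integrable (fun R => (Real.log (FPoint P R) : ℂ) * laplaceBeltrami φ R) (area E) ∧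
    ∫ R, (Real.log (FPoint P R) : ℂ) * laplaceBeltrami φ R ∂(area E) =
      ∫ R, (regularPart R : ℂ) * φ R ∂(area E) + 2 * Real.pi * (φ P + φ (involution P))

lemma continuous_regularPart (hg : 2 ≤ g) : Continuous (regularPart (E := E)) :=
  ((continuous_gaussCurvature hg).sub
    (continuous_const.mul (continuous_FDiv_weierstrassDiv hg))).div_const _

lemma integrable_mul_of_continuous (hg : 2 ≤ g) {h : E.Curve → ℝ} (hh : Continuous h)
    {φ : E.Curve → ℂ} (hφ : Continuous φ) : Integrable (fun R => (h R : ℂ) * φ R) (area E) := by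
  have := isFiniteMeasure_area (E := E) hg
  exact ((Complex.continuous_ofReal.comp hh).mul hφ).integrable_of_hasCompactSupport
    (HasCompactSupport.of_compactSpace _)

/-- The weak equation for test functions supported in a small neighbourhood of a point `Q`. In the
chart the densities of `Δ` and of `dν` cancel, and the equation follows from Green's identity for
the smooth part of `log F_P` and the fundamental solution of the plane for the singular part. -/
lemma exists_nhds_weakEquation (hg : 2 ≤ g) (P Q : E.Curve) :
    ∃ W : Set E.Curve, IsOpen W ∧ Q ∈ W ∧ ∀ φ : E.Curve → ℂ,
      ContMDiff 𝓘(ℝ, ℂ) 𝓘(ℝ, ℂ) ∞ φ → tsupport φ ⊆ W → WeakEquation P φ := by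
  classical
  obtain ⟨V, hVT, hVo, htV, v, hv, hΔv, hne, hlog⟩ := exists_log_FPoint_eq hg P Q
  set t₀ := chartAt ℂ Q Q
  set T := (chartAt ℂ Q).target
  have hT : IsOpen T := (chartAt ℂ Q).open_target
  refine ⟨(chartAt ℂ Q).source ∩ chartAt ℂ Q ⁻¹' V, (chartAt ℂ Q).isOpen_inter_preimage hVo,
    ⟨_root_.mem_chart_source ℂ Q, htV⟩, fun φ hφ hsupp => ?_⟩
  -- the transported test function
  set ψ : ℂ → ℂ := T.indicator (φ ∘ (chartAt ℂ Q).symm) with hψdef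
  have hKc : IsCompact (chartAt ℂ Q '' tsupport φ) :=
    (isClosed_tsupport φ).isCompact.image_of_continuousOn
      ((chartAt ℂ Q).continuousOn.mono (hsupp.trans inter_subset_left))
  have hKV : chartAt ℂ Q '' tsupport φ ⊆ V := by
    rintro _ ⟨R, hR, rfl⟩; exact (hsupp hR).2
  have hψT : ∀ t ∈ T, ψ =ᶠ[𝓝 t] φ ∘ (chartAt ℂ Q).symm := fun t ht => by
    filter_upwards [hT.mem_nhds ht] with s hs using indicator_of_mem hs _
  have hψs : Function.support ψ ⊆ chartAt ℂ Q '' tsupport φ := by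
    intro t ht
    have htT : t ∈ T := by
      by_contra h; exact ht (indicator_of_notMem h _)
    have h1 : φ ((chartAt ℂ Q).symm t) ≠ 0 := by
      intro h; exact ht ((indicator_of_mem htT _).trans h)
    exact ⟨(chartAt ℂ Q).symm t, subset_tsupport φ h1, (chartAt ℂ Q).right_inv htT⟩
  have htsψ : tsupport ψ ⊆ chartAt ℂ Q '' tsupport φ := closure_minimal hψs hKc.isClosed
  have hψc : HasCompactSupport ψ := hKc.of_isClosed_subset (isClosed_tsupport ψ) htsψ
  have hψ2 : ContDiff ℝ 2 ψ := by
    refine contDiff_iff_contDiffAt.2 fun t => ?_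
    by_cases ht : t ∉ tsupport ψ
    · exact contDiffAt_const.congr_of_eventuallyEq (notMem_tsupport_iff_eventuallyEq.1 ht)
    rw [not_not] at ht
    have htT := hVT (hKV (htsψ ht))
    exact ((contDiffAt_comp_chartAt_symm hφ Q htT).congr_of_eventuallyEq
      (hψT t htT)).of_le two_le_infty
  have hΔψ : ∀ t ∈ T, Δ ψ t = metricDensity Q t • laplaceBeltrami φ ((chartAt ℂ Q).symm t) := by
    intro t ht
    rw [laplaceBeltrami_chartAt_symm hg hφ Q ht, (laplacian_congr_nhds (hψT t ht)).eq_of_nhds]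
  have hΔψ0 : ∀ t ∉ tsupport ψ, Δ ψ t = 0 := fun t ht =>
    (laplacian_congr_nhds (notMem_tsupport_iff_eventuallyEq.1 ht)).eq_of_nhds.trans
      (congrFun (laplacian_const (c := (0 : ℂ))) _)
  -- the two planar identities
  obtain ⟨iA, eA⟩ := integral_log_norm_smul_laplacian hψ2 hψc t₀
  obtain ⟨iB, eB⟩ := integral_smul_laplacian hψ2 hψc
    fun t ht => (hv t (hKV (htsψ ht))).of_le two_le_infty
  set m : ℝ := ((alpha (Finsupp.single P 1) Q : ℤ) : ℝ) with hm
  have hae : (fun t => m • (Real.log ‖t - t₀‖ • Δ ψ t) + v t • Δ ψ t) =ᵐ[volume]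
      T.indicator (fun t => metricDensity Q t • ((Real.log (FPoint P ((chartAt ℂ Q).symm t)) : ℂ) *
        laplaceBeltrami φ ((chartAt ℂ Q).symm t))) := by
    filter_upwards [Measure.ae_ne volume t₀] with t ht
    by_cases htV : t ∈ tsupport ψ
    · have htV := hKV (htsψ htV)
      rw [indicator_of_mem (hVT htV), hlog t htV (.inl ht), hΔψ t (hVT htV)]
      simp only [Complex.real_smul]
      push_cast
      ring
    · have h0 := hΔψ0 t htV
      by_cases htT : t ∈ T
      · rw [indicator_of_mem htT, h0]
        rw [hΔψ t htT] at h0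
        rw [(smul_eq_zero.1 h0).resolve_left (metricDensity_pos hg Q htT).ne']
        simp
      · rw [indicator_of_notMem htT, h0]; simp
  have hoff : ∀ h : E.Curve → ℂ, ∀ R ∉ (chartAt ℂ Q).source, h R * laplaceBeltrami φ R = 0 :=
    fun h R hR => by
      rw [laplaceBeltrami_of_notMem_tsupport fun hR' => hR (hsupp hR').1, mul_zero]
  have iA' : Integrable fun t => m • (Real.log ‖t - t₀‖ • Δ ψ t) := iA.smul m
  have hint : Integrable (fun t => m • (Real.log ‖t - t₀‖ • Δ ψ t) + v t • Δ ψ t) := iA'.add iB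
  constructor
  · have h1 : IntegrableOn (fun R => (Real.log (FPoint P R) : ℂ) * laplaceBeltrami φ R)
        (chartAt ℂ Q).source (area E) := by
      rw [integrableOn_source_iff hg Q, ← integrable_indicator_iff hT.measurableSet]
      exact hint.congr hae
    refine (integrableOn_iff_integrable_of_support_subset ?_).1 h1
    intro R hR
    by_contra h
    exact hR (hoff (fun R => (Real.log (FPoint P R) : ℂ)) R h)
  · have h1 : ∫ R, (Real.log (FPoint P R) : ℂ) * laplaceBeltrami φ R ∂(area E) =
        m • ((2 * Real.pi) • ψ t₀) + ∫ t, Δ v t • ψ t := by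
      rw [← setIntegral_eq_integral_of_forall_compl_eq_zero
        (hoff fun R => (Real.log (FPoint P R) : ℂ)), setIntegral_source hg Q,
        ← integral_indicator hT.measurableSet, ← integral_congr_ae hae,
        integral_add iA' iB, integral_smul, eA, eB]
    have h2 : ∫ R, (regularPart R : ℂ) * φ R ∂(area E) = ∫ t, Δ v t • ψ t := by
      rw [← setIntegral_eq_integral_of_forall_compl_eq_zero (s := (chartAt ℂ Q).source)
        (fun R hR => by
          rw [image_eq_zero_of_notMem_tsupport fun hR' => hR (hsupp hR').1, mul_zero]),
        setIntegral_source hg Q, ← integral_indicator hT.measurableSet]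
      congr 1
      ext1 t
      by_cases htT : t ∈ T
      · rw [indicator_of_mem htT, hψdef, indicator_of_mem htT]
        by_cases htV : t ∈ V
        · rw [hΔv t htV]
          simp only [Complex.real_smul, Function.comp_apply]
          push_cast
          ring
        · have h0 : φ ((chartAt ℂ Q).symm t) = 0 := by
            by_contra h
            have := (hsupp (subset_tsupport φ h)).2
            rw [mem_preimage, (chartAt ℂ Q).right_inv htT] at this
            exact htV this
          simp [h0]
      · rw [indicator_of_notMem htT, hψdef, indicator_of_notMem htT, smul_zero]
    -- only `Q` can carry a point mass in the support of `φ`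
    have hψ0 : ψ t₀ = φ Q := by
      rw [hψdef, indicator_of_mem (mem_chart_target ℂ Q), Function.comp_apply,
        (chartAt ℂ Q).left_inv (_root_.mem_chart_source ℂ Q)]
    have hpt : ∀ R, (P = R ∨ involution P = R) → φ R = if R = Q then φ Q else 0 := by
      intro R hR
      split_ifs with h
      · rw [h]
      · by_contra h0
        have hRW := hsupp (subset_tsupport φ h0)
        have h3 := hne (chartAt ℂ Q R) hRW.2 fun h4 =>
          h ((chartAt ℂ Q).injOn hRW.1 (_root_.mem_chart_source ℂ Q) h4)
        rw [(chartAt ℂ Q).left_inv hRW.1] at h3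
        exact h3 ((FPoint_eq_zero_iff hg P R).2 hR)
    rw [h1, h2, add_comm, hpt P (.inl rfl), hpt (involution P) (.inr rfl), hψ0, hm,
      alpha_single_apply]
    congr 1
    simp only [Complex.real_smul]
    split_ifs <;> push_cast <;> ring

lemma WeakEquation.add (hg : 2 ≤ g) {P : E.Curve} {φ ψ : E.Curve → ℂ}
    (hφ : ContMDiff 𝓘(ℝ, ℂ) 𝓘(ℝ, ℂ) ∞ φ) (hψ : ContMDiff 𝓘(ℝ, ℂ) 𝓘(ℝ, ℂ) ∞ ψ)
    (h1 : WeakEquation P φ) (h2 : WeakEquation P ψ) : WeakEquation P (φ + ψ) := by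
  have e1 : (fun R => (Real.log (FPoint P R) : ℂ) * laplaceBeltrami (φ + ψ) R) = fun R =>
      (Real.log (FPoint P R) : ℂ) * laplaceBeltrami φ R +
        (Real.log (FPoint P R) : ℂ) * laplaceBeltrami ψ R := by
    ext1 R; rw [laplaceBeltrami_add hφ hψ, mul_add]
  have e2 : (fun R => (regularPart R : ℂ) * (φ + ψ) R) = fun R =>
      (regularPart R : ℂ) * φ R + (regularPart R : ℂ) * ψ R := by
    ext1 R; rw [Pi.add_apply, mul_add]
  have i := fun {φ : E.Curve → ℂ} (hφ : ContMDiff 𝓘(ℝ, ℂ) 𝓘(ℝ, ℂ) ∞ φ) =>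
    integrable_mul_of_continuous hg (continuous_regularPart hg) hφ.continuous
  rw [WeakEquation, e1, e2]
  refine ⟨h1.1.add h2.1, ?_⟩
  rw [integral_add h1.1 h2.1, h1.2, h2.2, integral_add (i hφ) (i hψ)]
  simp only [Pi.add_apply]
  ring

lemma weakEquation_zero (P : E.Curve) : WeakEquation P 0 := by
  have : ∀ R, laplaceBeltrami (0 : E.Curve → ℂ) R = 0 := fun R =>
    laplaceBeltrami_of_notMem_tsupport (by simp [tsupport])
  simp [WeakEquation, this]

/-- The weak equation for `log F_P` and every test function, by a partition of unity. -/
lemma weakEquation (hg : 2 ≤ g) (P : E.Curve) {φ : E.Curve → ℂ}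
    (hφ : ContMDiff 𝓘(ℝ, ℂ) 𝓘(ℝ, ℂ) ∞ φ) : WeakEquation P φ := by
  choose W hWo hW hweak using exists_nhds_weakEquation hg P
  obtain ⟨f, hf⟩ := SmoothPartitionOfUnity.exists_isSubordinate 𝓘(ℝ, ℂ)
    (isClosed_univ (X := E.Curve)) W hWo fun Q _ => mem_iUnion.2 ⟨Q, hW Q⟩
  have hfin : {i | (Function.support (f i)).Nonempty}.Finite :=
    f.locallyFinite.finite_nonempty_of_compact
  have hsm : ∀ i, ContMDiff 𝓘(ℝ, ℂ) 𝓘(ℝ, ℂ) ∞ fun R => f i R • φ R := fun i =>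
    (f i).contMDiff.smul hφ
  have hsum : φ = ∑ i ∈ hfin.toFinset, fun R => f i R • φ R := by
    ext1 R
    have h1 := f.sum_eq_one (mem_univ R)
    rw [finsum_eq_sum_of_support_subset (s := hfin.toFinset)] at h1
    · rw [Finset.sum_apply, ← Finset.sum_smul, h1, one_smul]
    · intro i hi
      simp only [Finite.coe_toFinset, mem_ofPred_eq]
      exact ⟨R, hi⟩
  rw [hsum]
  refine (Finset.sum_induction _ (fun φ => ContMDiff 𝓘(ℝ, ℂ) 𝓘(ℝ, ℂ) ∞ φ ∧ WeakEquation P φ)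
    (fun a b ha hb => ⟨ha.1.add hb.1, ha.2.add hg ha.1 hb.1 hb.2⟩)
    ⟨contMDiff_const, weakEquation_zero P⟩ fun i _ => ⟨hsm i, ?_⟩).2
  refine hweak i _ (hsm i) (Subset.trans ?_ (hf i))
  exact closure_mono fun R hR h0 => hR (by simp [h0])

/-! ### The functions `u_D` -/

lemma alpha_apply (D : E.Divisor) (Q : E.Curve) : alpha D Q = D Q + D (involution Q) := by
  have hinj : Function.Injective (involution (E := E)) :=
    Function.LeftInverse.injective involution_involution
  have h := Finsupp.mapDomain_apply hinj D (involution Q)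
  rw [involution_involution] at h
  rw [alpha, Finsupp.add_apply, involutionDiv, h]

/-- Sums over `α(D)` of a quantity that is additive in the multiplicities. -/
lemma sum_alpha {M : Type*} [AddCommMonoid M] (D : E.Divisor) {h : E.Curve → ℤ → M}
    (h0 : ∀ P, h P 0 = 0) (ha : ∀ P m n, h P (m + n) = h P m + h P n) :
    (alpha D).sum h = D.sum h + D.sum fun P n => h (involution P) n := by
  rw [alpha, Finsupp.sum_add_index' h0 ha, involutionDiv, Finsupp.sum_mapDomain_index h0 ha]

lemma uDiv_eq_log_FDiv (hg : 2 ≤ g) (D : E.Divisor) {Q : E.Curve} (h1 : Q ∉ D.support)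
    (h2 : Q ∉ (involutionDiv D).support) : uDiv D Q = Real.log (FDiv D Q) := by
  rw [uDiv, FDiv, Finsupp.prod, Finsupp.sum, Real.log_prod]
  · refine Finset.sum_congr rfl fun P _ => ?_
    rw [Real.log_zpow]
  · intro P hP
    refine zpow_ne_zero _ fun h => ?_
    rcases (FPoint_eq_zero_iff hg P Q).1 h with rfl | rfl
    · exact h1 hP
    · have hinj : Function.Injective (involution (E := E)) :=
        Function.LeftInverse.injective involution_involution
      refine h2 (Finsupp.mem_support_iff.2 ?_)
      rw [involutionDiv, Finsupp.mapDomain_apply hinj]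
      exact Finsupp.mem_support_iff.1 hP

/-- Since `F_P = F_{ι(P)}`, one has `2 u_D = u_{α(D)}`; this removes the spurious singularities of
`u_D` at the points where `D` and `ι(D)` cancel. -/
lemma uDiv_eq_uDiv_alpha (D : E.Divisor) (Q : E.Curve) :
    uDiv D Q = 2⁻¹ * uDiv (alpha D) Q := by
  have h := sum_alpha D (h := fun P n => (n : ℝ) * Real.log (FPoint P Q)) (by simp)
    (fun P m n => by push_cast; ring)
  simp only [FPoint_involution] at h
  simp only [uDiv, h]
  ring

lemma contMDiffAt_log_FPoint (hg : 2 ≤ g) (P : E.Curve) {Q : E.Curve}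
    (hQ : alpha (Finsupp.single P 1) Q = 0) :
    ContMDiffAt 𝓘(ℝ, ℂ) 𝓘(ℝ, ℝ) ∞ (fun R => Real.log (FPoint P R)) Q := by
  obtain ⟨V, hVT, hVo, htV, v, hv, -, -, hlog⟩ := exists_log_FPoint_eq hg P Q
  have hc : ContMDiffAt 𝓘(ℝ, ℂ) 𝓘(ℝ, ℂ) ∞ (chartAt ℂ Q) Q :=
    (contMDiffOn_chart (I := 𝓘(ℝ, ℂ)) (n := ∞) (x := Q)).contMDiffAt
      ((chartAt ℂ Q).open_source.mem_nhds (_root_.mem_chart_source ℂ Q))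
  have hs := _root_.mem_chart_source ℂ Q
  refine (((hv _ htV).contMDiffAt).comp Q hc).congr_of_eventuallyEq ?_
  filter_upwards [(chartAt ℂ Q).open_source.mem_nhds hs,
    ((chartAt ℂ Q).continuousAt hs).eventually (hVo.mem_nhds htV)] with R hR hRV
  have := hlog _ hRV (.inr hQ)
  rw [(chartAt ℂ Q).left_inv hR, hQ] at this
  simpa using this

lemma contMDiffOn_uDiv (hg : 2 ≤ g) (D : E.Divisor) :
    ContMDiffOn 𝓘(ℝ, ℂ) 𝓘(ℝ, ℝ) ∞ (uDiv D) {Q : E.Curve | Q ∉ (alpha D).support} := by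
  classical
  intro Q hQ
  have hQ0 : alpha D Q = 0 := Finsupp.notMem_support_iff.1 hQ
  refine ContMDiffAt.contMDiffWithinAt ?_
  have h : ContMDiffAt 𝓘(ℝ, ℂ) 𝓘(ℝ, ℝ) ∞ (fun R => ∑ P ∈ (alpha D).support,
      2⁻¹ * ((alpha D P : ℝ) * Real.log (FPoint P R))) Q := by
    refine ContMDiffAt.sum fun P hP => ?_
    have hP0 := Finsupp.mem_support_iff.1 hP
    refine ((contDiff_const.mul (contDiff_const.mul contDiff_id) : ContDiff ℝ ∞
      fun r : ℝ => 2⁻¹ * ((alpha D P : ℝ) * r)).contMDiff.contMDiffAt).comp Q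
      (contMDiffAt_log_FPoint hg P ?_)
    have n1 : P ≠ Q := by rintro rfl; exact hP0 hQ0
    have n2 : involution P ≠ Q := by
      rintro rfl
      rw [alpha_apply, involution_involution, add_comm, ← alpha_apply] at hQ0
      exact hP0 hQ0
    rw [alpha_single_apply, if_neg n1, if_neg n2, add_zero]
  convert! h using 1
  ext R
  rw [uDiv_eq_uDiv_alpha, uDiv, Finsupp.sum, Finset.mul_sum]

/-- The weak form of `Δu_D = deg D (K - 4 F_W) / (g + 1) + 2π δ_{α(D)}`. -/
lemma weakEquation_uDiv (hg : 2 ≤ g) (D : E.Divisor) (φ : TestFunction E) :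
    Integrable (fun R => (uDiv D R : ℂ) * laplaceBeltrami φ R) (area E) ∧
      ∫ R, (uDiv D R : ℂ) * laplaceBeltrami φ R ∂(area E) =
        deg D * distOfFun regularPart φ + 2 * Real.pi * deltaDiv (alpha D) φ := by
  have hφ : ContMDiff 𝓘(ℝ, ℂ) 𝓘(ℝ, ℂ) ∞ φ.1 := φ.2
  have e : (fun R => (uDiv D R : ℂ) * laplaceBeltrami φ R) = fun R => ∑ P ∈ D.support,
      (D P : ℂ) * ((Real.log (FPoint P R) : ℂ) * laplaceBeltrami φ R) := by
    ext1 R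
    rw [uDiv, Finsupp.sum, Complex.ofReal_sum, Finset.sum_mul]
    refine Finset.sum_congr rfl fun P _ => ?_
    push_cast
    ring
  have hi : ∀ P ∈ D.support, Integrable (fun R =>
      (D P : ℂ) * ((Real.log (FPoint P R) : ℂ) * laplaceBeltrami φ R)) (area E) := fun P _ =>
    (weakEquation hg P hφ).1.const_mul _
  have hδ : deltaDiv (alpha D) φ = ∑ P ∈ D.support, (D P : ℂ) * (φ P + φ (involution P)) := by
    rw [deltaDiv, sum_alpha D (by simp) (fun P m n => by push_cast; ring), Finsupp.sum,
      Finsupp.sum, ← Finset.sum_add_distrib]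
    exact Finset.sum_congr rfl fun P _ => (mul_add _ _ _).symm
  rw [e]
  refine ⟨integrable_finsetSum _ hi, ?_⟩
  rw [integral_finsetSum _ hi, hδ, deg, Finsupp.sum, Int.cast_sum, Finset.sum_mul, Finset.mul_sum,
    ← Finset.sum_add_distrib]
  refine Finset.sum_congr rfl fun P _ => ?_
  rw [integral_const_mul, (weakEquation hg P hφ).2, distOfFun]
  ring

/-! ### Excision of coordinate discs -/

lemma eventually_closedBall_subset {Q : E.Curve} {c : OpenPartialHomeomorph E.Curve ℂ}
    (hc : IsCoordinateAt Q c) : ∀ᶠ ε in 𝓝[>] (0 : ℝ), Metric.closedBall (0 : ℂ) ε ⊆ c.target := by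
  have h0 : (0 : ℂ) ∈ c.target := hc.2.2 ▸ c.map_source hc.2.1
  obtain ⟨r, hr, hrT⟩ := Metric.nhds_basis_closedBall.mem_iff.1 (c.open_target.mem_nhds h0)
  filter_upwards [mem_nhdsWithin_of_mem_nhds (Iio_mem_nhds hr)] with ε hε
  exact (Metric.closedBall_subset_closedBall (le_of_lt hε)).trans hrT

lemma eventually_notMem_coordDisc {P Q : E.Curve} {c : OpenPartialHomeomorph E.Curve ℂ}
    (hc : IsCoordinateAt Q c) (hPQ : P ≠ Q) : ∀ᶠ ε in 𝓝[>] (0 : ℝ), P ∉ coordDisc c ε := by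
  by_cases hP : P ∈ c.source
  · have hne : c P ≠ 0 := fun h => hPQ (c.injOn hP hc.2.1 (h.trans hc.2.2.symm))
    filter_upwards [eventually_closedBall_subset hc,
      mem_nhdsWithin_of_mem_nhds (Iio_mem_nhds (norm_pos_iff.2 hne))] with ε hε hε'
    rintro ⟨s, hs, rfl⟩
    rw [c.right_inv (hε hs)] at hε'
    exact absurd (mem_closedBall_zero_iff.1 hs) (not_le.2 hε')
  · filter_upwards [eventually_closedBall_subset hc] with ε hε
    rintro ⟨s, hs, rfl⟩
    exact hP (c.map_target (hε hs))

lemma eventually_measurableSet_coordDisc {Q : E.Curve} {c : OpenPartialHomeomorph E.Curve ℂ}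
    (hc : IsCoordinateAt Q c) : ∀ᶠ ε in 𝓝[>] (0 : ℝ), MeasurableSet (coordDisc c ε) := by
  filter_upwards [eventually_closedBall_subset hc] with ε hε
  exact ((isCompact_closedBall (0 : ℂ) ε).image_of_continuousOn
    (c.continuousOn_symm.mono hε)).isClosed.measurableSet

/-- If `u Δφ` is integrable for all `φ`, then the integrals over the complements of small coordinate
discs converge to the integral over the whole curve. -/
lemma isDistributionalLaplacian_of_integrable {u : E.Curve → ℝ} (S : Finset E.Curve)
    {T : TestFunction E → ℂ} (h : ∀ φ : TestFunction E,
      Integrable (fun R => (u R : ℂ) * laplaceBeltrami φ R) (area E) ∧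
      ∫ R, (u R : ℂ) * laplaceBeltrami φ R ∂(area E) = T φ) :
    IsDistributionalLaplacian u S T := by
  intro c hc φ
  obtain ⟨hi, hT⟩ := h φ
  refine ⟨.of_forall fun ε => hi.integrableOn, ?_⟩
  have hmeas : ∀ᶠ ε in 𝓝[>] (0 : ℝ), MeasurableSet (⋃ Q ∈ S, coordDisc (c Q) ε)ᶜ := by
    filter_upwards [(Filter.eventually_all_finset S).2 fun Q hQ =>
      eventually_measurableSet_coordDisc (hc Q hQ)] with ε hε
    exact (S.measurableSet_biUnion hε).compl
  have hlim : Tendsto (fun ε : ℝ => ∫ R, ((⋃ Q ∈ S, coordDisc (c Q) ε)ᶜ).indicator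
      (fun R => (u R : ℂ) * laplaceBeltrami φ R) R ∂(area E)) (𝓝[>] 0) (𝓝 (T φ)) := by
    rw [← hT]
    refine tendsto_integral_filter_of_dominated_convergence
      (fun R => ‖(u R : ℂ) * laplaceBeltrami φ R‖) ?_ ?_ hi.norm ?_
    · filter_upwards [hmeas] with ε hε
      exact hi.aestronglyMeasurable.indicator hε
    · exact .of_forall fun ε => .of_forall fun R => norm_indicator_le_norm_self _ _
    · have hS : area E (S : Set E.Curve) = 0 := by
        rw [← biUnion_of_singleton (S : Set E.Curve),
          measure_biUnion_null_iff S.countable_toSet]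
        exact fun Q _ => area_singleton Q
      have hS' : ∀ᵐ R ∂(area E), R ∉ (S : Set E.Curve) := measure_eq_zero_iff_ae_notMem.1 hS
      filter_upwards [hS'] with R hR
      refine tendsto_const_nhds.congr' ?_
      filter_upwards [(Filter.eventually_all_finset S).2 fun Q hQ =>
        eventually_notMem_coordDisc (P := R) (hc Q hQ) (by rintro rfl; exact hR hQ)] with ε hε
      rw [indicator_of_mem]
      simpa using hε
  refine hlim.congr' ?_
  filter_upwards [hmeas] with ε hε
  exact integral_indicator hε

/-! ### Continuity in the Fréchet topology -/

/-- Convergence in `C^∞(X, ℂ)` implies uniform convergence. -/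
lemma eventually_forall_dist_lt (φ₀ : TestFunction E) {ε : ℝ} (hε : 0 < ε) :
    ∀ᶠ φ : TestFunction E in 𝓝 φ₀, ∀ R, dist (φ₀ R) (φ R) < ε := by
  have hQ : ∀ Q : E.Curve, ∃ U : Set E.Curve, IsOpen U ∧ Q ∈ U ∧
      ∀ᶠ φ : TestFunction E in 𝓝 φ₀, ∀ R ∈ U, dist (φ₀ R) (φ R) < ε := by
    intro Q
    obtain ⟨r, hr, hrT⟩ := Metric.nhds_basis_closedBall.mem_iff.1
      ((chartAt ℂ Q).open_target.mem_nhds (mem_chart_target ℂ Q))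
    refine ⟨(chartAt ℂ Q).source ∩ chartAt ℂ Q ⁻¹' Metric.ball (chartAt ℂ Q Q) r,
      (chartAt ℂ Q).isOpen_inter_preimage Metric.isOpen_ball,
      ⟨_root_.mem_chart_source ℂ Q, by simp [hr]⟩, ?_⟩
    have hcont : Continuous (fun φ : TestFunction E =>
        UniformOnFun.ofFun {s : Set ℂ | IsCompact s ∧ s ⊆ (chartAt ℂ Q).target}
          (iteratedFDeriv ℝ 0 (φ ∘ (chartAt ℂ Q).symm))) :=
      continuous_iInf_dom (i := Q) (continuous_iInf_dom (i := 0) continuous_induced_dom)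
    have h1 := UniformOnFun.tendsto_iff_tendstoUniformlyOn.1 (hcont.tendsto φ₀)
      (Metric.closedBall (chartAt ℂ Q Q) r) ⟨isCompact_closedBall _ _, hrT⟩
    filter_upwards [Metric.tendstoUniformlyOn_iff.1 h1 ε hε] with φ hφ R hR
    have h2 := hφ (chartAt ℂ Q R) (Metric.ball_subset_closedBall hR.2)
    simp only [Function.comp_apply, UniformOnFun.toFun_ofFun, iteratedFDeriv_zero_eq_comp,
      LinearIsometryEquiv.dist_map] at h2
    rwa [(chartAt ℂ Q).left_inv hR.1] at h2
  choose U hUo hU hev using hQ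
  obtain ⟨s, hs⟩ := isCompact_univ.elim_finite_subcover U hUo
    fun Q _ => mem_iUnion.2 ⟨Q, hU Q⟩
  filter_upwards [(Filter.eventually_all_finset s).2 fun Q _ => hev Q] with φ hφ R
  obtain ⟨Q, hQ, hR⟩ := mem_iUnion₂.1 (hs (mem_univ R))
  exact hφ Q hQ R hR

lemma continuous_eval (Q : E.Curve) : Continuous fun φ : TestFunction E => φ Q := by
  refine continuous_iff_continuousAt.2 fun φ₀ => Metric.tendsto_nhds.2 fun ε hε => ?_
  filter_upwards [eventually_forall_dist_lt φ₀ hε] with φ hφ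
  rw [dist_comm]
  exact hφ Q

lemma continuous_testFunction (φ : TestFunction E) : Continuous (φ : E.Curve → ℂ) :=
  ContMDiff.continuous (I := 𝓘(ℝ, ℂ)) (I' := 𝓘(ℝ, ℂ)) (n := ∞) φ.2

lemma continuous_deltaDiv (D : E.Divisor) : Continuous (deltaDiv D) :=
  continuous_finsetSum _ fun P _ => continuous_const.mul (continuous_eval P)

lemma continuous_distOfFun (hg : 2 ≤ g) {h : E.Curve → ℝ} (hh : Continuous h) :
    Continuous (distOfFun h) := by
  have hfin := isFiniteMeasure_area (E := E) hg
  have hi : ∀ φ : TestFunction E, Integrable (fun P => (h P : ℂ) * φ P) (area E) := fun φ =>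
    integrable_mul_of_continuous hg hh (continuous_testFunction φ)
  have hhi : Integrable (fun P => ‖h P‖) (area E) :=
    (hh.integrable_of_hasCompactSupport (HasCompactSupport.of_compactSpace _)).norm
  set C := ∫ P, ‖h P‖ ∂(area E)
  have hC : 0 ≤ C := integral_nonneg fun _ => norm_nonneg _
  refine continuous_iff_continuousAt.2 fun φ₀ => Metric.tendsto_nhds.2 fun ε hε => ?_
  filter_upwards [eventually_forall_dist_lt φ₀ (div_pos hε (by positivity : 0 < C + 1))] with φ hφ
  rw [dist_eq_norm, distOfFun, distOfFun, ← integral_sub (hi φ) (hi φ₀)]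
  calc _ ≤ ∫ P, ‖h P‖ * (ε / (C + 1)) ∂(area E) := by
        refine norm_integral_le_of_norm_le (hhi.mul_const _) (.of_forall fun P => ?_)
        rw [← mul_sub, norm_mul, Complex.norm_real, ← dist_eq_norm, dist_comm]
        exact mul_le_mul_of_nonneg_left (hφ P).le (norm_nonneg _)
    _ = C * (ε / (C + 1)) := integral_mul_const _ _
    _ < ε := by
        rw [mul_div_assoc', div_lt_iff₀ (by positivity)]
        nlinarith

lemma distOfFun_add (hg : 2 ≤ g) {h : E.Curve → ℝ} (hh : Continuous h) (φ ψ : TestFunction E) :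
    distOfFun h (φ + ψ) = distOfFun h φ + distOfFun h ψ := by
  have hi : ∀ φ : TestFunction E, Integrable (fun P => (h P : ℂ) * φ P) (area E) := fun φ =>
    integrable_mul_of_continuous hg hh (continuous_testFunction φ)
  rw [distOfFun, distOfFun, distOfFun, ← integral_add (hi φ) (hi ψ)]
  exact integral_congr_ae (.of_forall fun P => mul_add _ _ _)

lemma distOfFun_smul (h : E.Curve → ℝ) (c : ℂ) (φ : TestFunction E) :
    distOfFun h (c • φ) = c * distOfFun h φ := by
  rw [distOfFun, distOfFun, ← integral_const_mul]
  exact integral_congr_ae (.of_forall fun P => mul_left_comm _ _ _)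

lemma deltaDiv_add (D : E.Divisor) (φ ψ : TestFunction E) :
    deltaDiv D (φ + ψ) = deltaDiv D φ + deltaDiv D ψ := by
  rw [deltaDiv, deltaDiv, deltaDiv, Finsupp.sum, Finsupp.sum, Finsupp.sum,
    ← Finset.sum_add_distrib]
  exact Finset.sum_congr rfl fun P _ => mul_add _ _ _

lemma deltaDiv_smul (D : E.Divisor) (c : ℂ) (φ : TestFunction E) :
    deltaDiv D (c • φ) = c * deltaDiv D φ := by
  rw [deltaDiv, deltaDiv, Finsupp.sum, Finsupp.sum, Finset.mul_sum]
  exact Finset.sum_congr rfl fun P _ => mul_left_comm _ _ _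

lemma distOfFun_regularPart (hg : 2 ≤ g) (φ : TestFunction E) :
    distOfFun regularPart φ =
      (distOfFun gaussCurvature φ - 4 * distOfFun (FDiv (weierstrassDiv E)) φ) / (g + 1) := by
  have i1 := integrable_mul_of_continuous hg (continuous_gaussCurvature (E := E) hg)
    (continuous_testFunction φ)
  have i2 := integrable_mul_of_continuous hg (continuous_FDiv_weierstrassDiv (E := E) hg)
    (continuous_testFunction φ)
  rw [distOfFun, distOfFun, distOfFun, ← integral_const_mul, ← integral_sub i1 (i2.const_mul 4),
    ← integral_div]
  refine integral_congr_ae (.of_forall fun P => ?_)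
  simp only [regularPart]
  push_cast
  ring

/-- The right hand side of the equation for `Δu_D`, as a continuous linear functional. -/
noncomputable def laplacianFunctional (hg : 2 ≤ g) (D : E.Divisor) : TestFunction E →L[ℂ] ℂ where
  toFun := ((deg D : ℂ) / (g + 1)) • distOfFun gaussCurvature
          - (4 * (deg D : ℂ) / (g + 1)) • distOfFun (FDiv (weierstrassDiv E))
          + (2 * (Real.pi : ℂ)) • deltaDiv (alpha D)
  map_add' φ ψ := by
    simp only [Pi.add_apply, Pi.sub_apply, Pi.smul_apply, smul_eq_mul, deltaDiv_add,
      distOfFun_add hg (continuous_gaussCurvature hg),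
      distOfFun_add hg (continuous_FDiv_weierstrassDiv hg)]
    ring
  map_smul' c φ := by
    simp only [Pi.add_apply, Pi.sub_apply, Pi.smul_apply, smul_eq_mul, deltaDiv_smul,
      distOfFun_smul, RingHom.id_apply]
    ring
  cont := (((continuous_distOfFun hg (continuous_gaussCurvature hg)).const_smul _).sub
    ((continuous_distOfFun hg (continuous_FDiv_weierstrassDiv hg)).const_smul _)).add
    ((continuous_deltaDiv _).const_smul _)

end HyperellipticEquation

theorem corollaryp2 {g : ℕ} (hg : 2 ≤ g) (E : HyperellipticEquation g) (D : E.Divisor) :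
    -- `u_D` is `log F_D`, and is smooth off the support of `α(D)`
    (∀ Q : E.Curve, Q ∉ D.support → Q ∉ (involutionDiv D).support →
      uDiv D Q = Real.log (FDiv D Q)) ∧
    ContMDiffOn 𝓘(ℝ, ℂ) 𝓘(ℝ, ℝ) ∞ (uDiv D) {Q : E.Curve | Q ∉ (alpha D).support} ∧
    -- `K φ` and `F_W φ` are integrable for every smooth `φ`
    (∀ φ : TestFunction E,
      Integrable (fun P => (gaussCurvature P : ℂ) * φ P) (area E) ∧
      Integrable (fun P => (FDiv (weierstrassDiv E) P : ℂ) * φ P) (area E)) ∧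
    -- `Δu_D` is a well defined continuous linear functional, and satisfies the two equations
    ∃ T : TestFunction E →L[ℂ] ℂ,
      IsDistributionalLaplacian (uDiv D) (alpha D).support T ∧
      (T : TestFunction E → ℂ) =
        ((deg D : ℂ) / (g + 1)) • distOfFun gaussCurvature
          - (4 * (deg D : ℂ) / (g + 1)) • distOfFun (FDiv (weierstrassDiv E))
          + (2 * (Real.pi : ℂ)) • deltaDiv (alpha D) ∧
      (g = 2 →
        (∀ P : E.Curve, gaussCurvature P = -2 * FDiv (weierstrassDiv E) P) ∧
        (T : TestFunction E → ℂ) =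
          (deg D : ℂ) • distOfFun gaussCurvature + (2 * (Real.pi : ℂ)) • deltaDiv (alpha D)) := by
  refine ⟨fun Q h1 h2 => uDiv_eq_log_FDiv hg D h1 h2, contMDiffOn_uDiv hg D, fun φ =>
    ⟨integrable_mul_of_continuous hg (continuous_gaussCurvature hg) (continuous_testFunction φ),
      integrable_mul_of_continuous hg (continuous_FDiv_weierstrassDiv hg)
        (continuous_testFunction φ)⟩,
    laplacianFunctional hg D, isDistributionalLaplacian_of_integrable _ fun φ => ?_, rfl, ?_⟩
  · refine ⟨(weakEquation_uDiv hg D φ).1, ?_⟩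
    rw [(weakEquation_uDiv hg D φ).2, distOfFun_regularPart hg]
    change _ = (deg D : ℂ) / (g + 1) * distOfFun gaussCurvature φ -
      4 * (deg D : ℂ) / (g + 1) * distOfFun (FDiv (weierstrassDiv E)) φ +
      2 * (Real.pi : ℂ) * deltaDiv (alpha D) φ
    ring
  · rintro rfl
    refine ⟨gaussCurvature_eq_of_genus_two, ?_⟩
    have hK : distOfFun (E := E) gaussCurvature =
        (-2 : ℂ) • distOfFun (FDiv (weierstrassDiv E)) := by
      ext φ
      rw [Pi.smul_apply, smul_eq_mul, distOfFun, distOfFun, ← integral_const_mul]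
      refine integral_congr_ae (.of_forall fun P => ?_)
      simp only [gaussCurvature_eq_of_genus_two]
      push_cast
      ring
    change ((deg D : ℂ) / ((2 : ℕ) + 1)) • distOfFun gaussCurvature
      - (4 * (deg D : ℂ) / ((2 : ℕ) + 1)) • distOfFun (FDiv (weierstrassDiv E))
      + (2 * (Real.pi : ℂ)) • deltaDiv (alpha D) = _
    rw [hK]
    push_cast
    module
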